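/- Let $\mathcal H$ be a complex Hilbert space; inner products and sesquilinear forms are antilinear in the first variable. For a self-adjoint operator $A$ on $\mathcal H$ with spectral measure $E_A$, and a Borel function $f:\mathbb R\to\mathbb R$, put $f(A)=\int f\,dE_A$; let $\mathcal H_{\rm ac}(A)$ (resp. $\mathcal H_{\rm sc}(A)$) be the subspace of those $\psi$ for which $\|E_A(\cdot)\psi\|^2$ is absolutely continuous (resp. singular and without atoms) with respect to Lebesgue measure, let $A_{\rm ac}$, $A_{\rm sc}$ be the reduced parts of $A$ in these subspaces, and $\sigma_{\rm ac}(A)=\sigma(A_{\rm ac})$, $\sigma_{\rm sc}(A)=\sigma(A_{\rm sc})$. Let $\sigma_{\rm p}(A)$ be the set of eigenvalues of $A$ and $\sigma_{\rm disc}(A)$ the set of eigenvalues of finite multiplicity that are isolated points of $\sigma(A)$. A strong time operator of $A$ is a symmetric (densely defined) operator $T$ such that $e^{-itA}D(T)\subset D(T)$ and $Te^{-itA}\psi=e^{-itA}(T+t)\psi$ for all $t\in\mathbb R$, $\psi\in D(T)$. A self-adjoint operator $H$ belongs to the class $S_1(\mathcal H)$ if $\sigma_{\rm sc}(H)=\emptyset$;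 $\sigma_{\rm ac}(H)=[0,\infty)$; $\sigma_{\rm disc}(H)=\sigma_{\rm p}(H)=\{E_n\}_{n=1}^\infty$ with $E_1<E_2<\cdots<0$ and $\lim_{n\to\infty}E_n=0$; and $H_{\rm ac}$ has a strong time operator in $\mathcal H_{\rm ac}(H)$. A sesquilinear form $\mathfrak t:\mathcal D_1\times\mathcal D_2\to\mathbb C$, with $\mathcal D_1,\mathcal D_2$ non-zero subspaces of $\mathcal H$, is an ultra-weak time operator of a self-adjoint operator $A$ if there are non-zero subspaces $\mathcal D,\mathscr E\subset\mathcal D_1\cap\mathcal D_2$ such that (i) $\mathscr E\subset D(A)\cap\mathcal D$; (ii) $\mathfrak t[\phi,\psi]^*=\mathfrak t[\psi,\phi]$ for all $\phi,\psi\in\mathcal D$; (iii) $A\mathscr E\subset\mathcal D_1$ and $\mathfrak t[A\phi,\psi]-\mathfrak t[A\psi,\phi]^*=-i(\phi,\psi)$ for all $\phi,\psi\in\mathscr E$. Such an $\mathscr E$ is called an ultra-weak CCR-domain for $(A,\mathfrak t)$. **Corollary.** Let $H\in S_1(\mathcal H)$ and let $f:\mathbb R\to\mathbb R$ be Borel measurable.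 Suppose that 1. there is a closed Lebesgue-null set $K\subset\mathbb R$ such that $f\in C^2(\mathbb R\setminus K)$ and $\{\lambda\in\mathbb R\setminus K\mid f'(\lambda)=0\}$ is Lebesgue-null; 2. $f$ is continuous at $0$; 3. $f(\sigma_{\rm disc}(H))$ is an infinite set, and each of its points has finite multiplicity as an eigenvalue of $f(H)$; 4. $f(0)\notin\sigma_{\rm p}(f(H))$. Then $f(H)$ is self-adjoint and has an ultra-weak time operator with a dense ultra-weak CCR-domain. -/

import Mathlib

open MeasureTheory Filter Topology
open scoped ComplexConjugate InnerProductSpace ENNReal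

noncomputable section

namespace TimeOp

/-! ### Projection-valued measures on the real line -/

/-- A projection-valued measure on the Borel sets of `ℝ` with values in the orthogonal projections
of the complex Hilbert space `𝓗`: it is multiplicative, normalised and countably additive in the
strong operator topology. (By convention it vanishes on sets that are not Borel sets.) -/
structure ProjectionValuedMeasure (𝓗 : Type*) [NormedAddCommGroup 𝓗] [InnerProductSpace ℂ 𝓗]
    [CompleteSpace 𝓗] where
  proj : Set ℝ → (𝓗 →L[ℂ] 𝓗)
  isStarProjection : ∀ B, IsStarProjection (proj B)
  proj_of_not_measurable : ∀ B, ¬ MeasurableSet B → proj B = 0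
  proj_empty : proj ∅ = 0
  proj_univ : proj Set.univ = 1
  proj_inter : ∀ B C, MeasurableSet B → MeasurableSet C → proj (B ∩ C) = proj B * proj C
  hasSum_iUnion : ∀ B : ℕ → Set ℝ, (∀ n, MeasurableSet (B n)) → Pairwise (Function.onFun Disjoint B) →
    ∀ ψ : 𝓗, HasSum (fun n => proj (B n) ψ) (proj (⋃ n, B n) ψ)

namespace ProjectionValuedMeasure

variable {𝓗 : Type*} [NormedAddCommGroup 𝓗] [InnerProductSpace ℂ 𝓗] [CompleteSpace 𝓗]

/-- The projection-valued measure that is concentrated at `0`. -/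
instance : Inhabited (ProjectionValuedMeasure 𝓗) where
  default :=
    open Classical in
    { proj := fun B => if MeasurableSet B ∧ (0 : ℝ) ∈ B then 1 else 0
      isStarProjection := fun B => by
        split_ifs
        · exact IsStarProjection.one _
        · exact IsStarProjection.zero _
      proj_of_not_measurable := fun B hB => by simp [hB]
      proj_empty := by simp
      proj_univ := by simp
      proj_inter := fun B C hB hC => by
        by_cases h1 : (0 : ℝ) ∈ B <;> by_cases h2 : (0 : ℝ) ∈ C <;> simp [hB, hC, h1, h2]
      hasSum_iUnion := fun B hB hd ψ => by
        classical
        by_cases h : ∃ n, (0 : ℝ) ∈ B n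
        · obtain ⟨n, hn⟩ := h
          have h1 : (0 : ℝ) ∈ ⋃ n, B n := Set.mem_iUnion.2 ⟨n, hn⟩
          have h2 : MeasurableSet (⋃ n, B n) := MeasurableSet.iUnion hB
          rw [if_pos ⟨h2, h1⟩]
          have h3 : ∀ m, m ≠ n →
              (if MeasurableSet (B m) ∧ (0 : ℝ) ∈ B m then (1 : 𝓗 →L[ℂ] 𝓗) else 0) ψ = 0 := by
            intro m hm
            have h4 : (0 : ℝ) ∉ B m := fun h0 => Set.disjoint_left.1 (hd hm) h0 hn
            rw [if_neg (fun h5 => h4 h5.2), zero_apply]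
          have := hasSum_single n h3
          simpa [hB n, hn] using this
        · have h1 : (0 : ℝ) ∉ ⋃ n, B n := fun h' => h (Set.mem_iUnion.1 h')
          have h2 : ∀ n, (0 : ℝ) ∉ B n := fun n hn => h ⟨n, hn⟩
          simp only [h1, h2, and_false, if_false]
          simp [hasSum_zero] }

variable (E : ProjectionValuedMeasure 𝓗)

theorem inner_proj_self (B : Set ℝ) (ψ : 𝓗) :
    ⟪ψ, E.proj B ψ⟫_ℂ = ((‖E.proj B ψ‖ ^ 2 : ℝ) : ℂ) := by
  have h1 : E.proj B (E.proj B ψ) = E.proj B ψ := by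
    have := congrArg (fun T : 𝓗 →L[ℂ] 𝓗 => T ψ) (E.isStarProjection B).isIdempotentElem.eq
    simpa using this
  have h2 : (E.proj B).adjoint = E.proj B := (E.isStarProjection B).isSelfAdjoint
  calc ⟪ψ, E.proj B ψ⟫_ℂ = ⟪ψ, E.proj B (E.proj B ψ)⟫_ℂ := by rw [h1]
    _ = ⟪(E.proj B).adjoint ψ, E.proj B ψ⟫_ℂ := (ContinuousLinearMap.adjoint_inner_left _ _ _).symm
    _ = _ := by rw [h2, inner_self_eq_norm_sq_to_K]; simp

theorem inner_proj_of_disjoint {B C : Set ℝ} (hB : MeasurableSet B) (hC : MeasurableSet C)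
    (h : Disjoint B C) (ψ : 𝓗) : ⟪E.proj B ψ, E.proj C ψ⟫_ℂ = 0 := by
  have h2 : (E.proj B).adjoint = E.proj B := (E.isStarProjection B).isSelfAdjoint
  have h3 : E.proj B (E.proj C ψ) = 0 := by
    have := congrArg (fun T : 𝓗 →L[ℂ] 𝓗 => T ψ) (E.proj_inter B C hB hC)
    simpa [h.inter_eq, E.proj_empty] using this.symm
  rw [← h2, ContinuousLinearMap.adjoint_inner_left, h3, inner_zero_right]

theorem hasSum_norm_sq (B : ℕ → Set ℝ) (hB : ∀ n, MeasurableSet (B n))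
    (hd : Pairwise (Function.onFun Disjoint B)) (ψ : 𝓗) :
    HasSum (fun n => ‖E.proj (B n) ψ‖ ^ 2) (‖E.proj (⋃ n, B n) ψ‖ ^ 2) := by
  have h := (E.hasSum_iUnion B hB hd ψ).mapL (innerSL ℂ ψ)
  simp only [innerSL_apply_apply, inner_proj_self] at h
  exact_mod_cast h

/-- The scalar spectral measure `μ_ψ(B) = ‖E(B)ψ‖²`. -/
def scalarMeasure (ψ : 𝓗) : Measure ℝ :=
  Measure.ofMeasurable (fun B _ => ENNReal.ofReal (‖E.proj B ψ‖ ^ 2))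
    (by simp [E.proj_empty])
    (fun B hB hd => by
      have h := E.hasSum_norm_sq B hB hd ψ
      rw [← h.tsum_eq, ENNReal.ofReal_tsum_of_nonneg (fun n => by positivity) h.summable])

theorem scalarMeasure_apply (ψ : 𝓗) {B : Set ℝ} (hB : MeasurableSet B) :
    E.scalarMeasure ψ B = ENNReal.ofReal (‖E.proj B ψ‖ ^ 2) :=
  Measure.ofMeasurable_apply B hB

instance (ψ : 𝓗) : IsFiniteMeasure (E.scalarMeasure ψ) :=
  ⟨by rw [E.scalarMeasure_apply ψ MeasurableSet.univ]; exact ENNReal.ofReal_lt_top⟩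

theorem scalarMeasure_zero : E.scalarMeasure 0 = 0 := by
  ext B hB
  simp [E.scalarMeasure_apply _ hB]

theorem scalarMeasure_smul_le (c : ℂ) (ψ : 𝓗) :
    E.scalarMeasure (c • ψ) ≤ ENNReal.ofReal (‖c‖ ^ 2) • E.scalarMeasure ψ := by
  refine Measure.le_iff.2 fun B hB => ?_
  rw [Measure.smul_apply, smul_eq_mul, E.scalarMeasure_apply _ hB, E.scalarMeasure_apply _ hB,
    ← ENNReal.ofReal_mul (by positivity), map_smul, norm_smul, mul_pow]

theorem scalarMeasure_add_le (ψ φ : 𝓗) :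
    E.scalarMeasure (ψ + φ) ≤ (2 : ℝ≥0∞) • (E.scalarMeasure ψ + E.scalarMeasure φ) := by
  refine Measure.le_iff.2 fun B hB => ?_
  rw [Measure.smul_apply, smul_eq_mul, Measure.add_apply, E.scalarMeasure_apply _ hB,
    E.scalarMeasure_apply _ hB, E.scalarMeasure_apply _ hB,
    ← ENNReal.ofReal_add (by positivity) (by positivity),
    show (2 : ℝ≥0∞) = ENNReal.ofReal 2 by simp, ← ENNReal.ofReal_mul (by norm_num), map_add]
  refine ENNReal.ofReal_le_ofReal ?_
  have h1 := parallelogram_law_with_norm ℂ (E.proj B ψ) (E.proj B φ)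
  nlinarith [sq_nonneg ‖E.proj B ψ - E.proj B φ‖]

theorem scalarMeasure_add_ac (ψ φ : 𝓗) :
    E.scalarMeasure (ψ + φ) ≪ E.scalarMeasure ψ + E.scalarMeasure φ :=
  Measure.absolutelyContinuous_of_le_smul (E.scalarMeasure_add_le ψ φ)

theorem scalarMeasure_smul_ac (c : ℂ) (ψ : 𝓗) :
    E.scalarMeasure (c • ψ) ≪ E.scalarMeasure ψ :=
  Measure.absolutelyContinuous_of_le_smul (E.scalarMeasure_smul_le c ψ)

/-! ### Integration of Borel functions against a projection-valued measure -/

/-- `∫ s dE = ∑ z • E({s = z})` for a Borel simple function `s`. -/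
def simpleIntegral (s : SimpleFunc ℝ ℂ) : 𝓗 →L[ℂ] 𝓗 :=
  ∑ z ∈ s.range, z • E.proj (s ⁻¹' {z})

theorem proj_union {B C : Set ℝ} (hB : MeasurableSet B) (hC : MeasurableSet C)
    (h : Disjoint B C) (ψ : 𝓗) : E.proj (B ∪ C) ψ = E.proj B ψ + E.proj C ψ := by
  let F : ℕ → Set ℝ := fun n => if n = 0 then B else if n = 1 then C else ∅
  have hU : (⋃ n, F n) = B ∪ C := by
    ext x
    simp only [Set.mem_iUnion, Set.mem_union]
    constructor
    · rintro ⟨n, hn⟩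
      by_cases h0 : n = 0
      · left; simpa [F, h0] using hn
      · by_cases h1 : n = 1
        · right; simpa [F, h1] using hn
        · simp [F, h0, h1] at hn
    · rintro (hx | hx)
      · exact ⟨0, by simpa [F] using hx⟩
      · exact ⟨1, by simpa [F] using hx⟩
  have hF : ∀ n, MeasurableSet (F n) := by
    intro n
    simp only [F]
    split_ifs
    exacts [hB, hC, MeasurableSet.empty]
  have hd : Pairwise (Function.onFun Disjoint F) := by
    intro m n hmn
    simp only [Function.onFun, F]
    split_ifs <;> first | omega | exact h | exact h.symm | simp
  have h1 := E.hasSum_iUnion F hF hd ψ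
  rw [hU] at h1
  have h2 := hasSum_sum_of_ne_finset_zero (L := SummationFilter.unconditional ℕ)
    (f := fun n => E.proj (F n) ψ) (s := Finset.range 2)
    (fun n hn => by
      have h0 : n ≠ 0 := by rintro rfl; simp at hn
      have h1 : n ≠ 1 := by rintro rfl; simp at hn
      simp [F, h0, h1, E.proj_empty])
  have h3 := h1.unique h2
  simpa [Finset.sum_range_succ, F] using h3

/-- The set function `B ↦ (z ↦ z • E(B)ψ)`. -/
def smulProj (ψ : 𝓗) (B : Set ℝ) : ℂ →L[ℝ] 𝓗 :=
  (ContinuousLinearMap.toSpanSingleton ℂ (E.proj B ψ)).restrictScalars ℝ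

theorem finMeasAdditive_smulProj (ψ : 𝓗) :
    FinMeasAdditive (E.scalarMeasure ψ) (E.smulProj ψ) := by
  intro B C hB hC _ _ h
  ext z
  simp [smulProj, E.proj_union hB hC h]

theorem simpleIntegral_apply (s : SimpleFunc ℝ ℂ) (ψ : 𝓗) :
    E.simpleIntegral s ψ = SimpleFunc.setToSimpleFunc (E.smulProj ψ) s := by
  simp [simpleIntegral, SimpleFunc.setToSimpleFunc, smulProj]

theorem simpleIntegral_sub (s t : SimpleFunc ℝ ℂ) (ψ : 𝓗) :
    E.simpleIntegral (s - t) ψ = E.simpleIntegral s ψ - E.simpleIntegral t ψ := by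
  simp only [simpleIntegral_apply]
  exact SimpleFunc.setToSimpleFunc_sub _ (E.finMeasAdditive_smulProj ψ)
    (SimpleFunc.integrable_of_isFiniteMeasure s) (SimpleFunc.integrable_of_isFiniteMeasure t)

theorem norm_sq_simpleIntegral (s : SimpleFunc ℝ ℂ) (ψ : 𝓗) :
    ‖E.simpleIntegral s ψ‖ ^ 2 = ∑ z ∈ s.range, ‖z‖ ^ 2 * ‖E.proj (s ⁻¹' {z}) ψ‖ ^ 2 := by
  have h : ⟪E.simpleIntegral s ψ, E.simpleIntegral s ψ⟫_ℂ
      = ∑ z ∈ s.range, ((‖z‖ ^ 2 * ‖E.proj (s ⁻¹' {z}) ψ‖ ^ 2 : ℝ) : ℂ) := by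
    simp only [simpleIntegral, sum_apply, sum_inner, inner_sum]
    refine Finset.sum_congr rfl fun z hz => ?_
    rw [Finset.sum_eq_single_of_mem z hz]
    · simp only [smul_apply]
      rw [inner_self_eq_norm_sq_to_K, norm_smul]
      simp [mul_pow]
    · intro w _ hw
      have hd : Disjoint (s ⁻¹' {z}) (s ⁻¹' {w}) :=
        Disjoint.preimage _ (Set.disjoint_singleton.2 hw.symm)
      simp only [smul_apply, inner_smul_left, inner_smul_right]
      rw [E.inner_proj_of_disjoint (s.measurableSet_fiber w) (s.measurableSet_fiber z) hd.symm]
      simp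
  rw [inner_self_eq_norm_sq_to_K, ← Complex.ofReal_sum] at h
  exact Complex.ofReal_injective (by rw [← h]; simp)

theorem enorm_simpleIntegral (s : SimpleFunc ℝ ℂ) (ψ : 𝓗) :
    ‖E.simpleIntegral s ψ‖ₑ = eLpNorm s 2 (E.scalarMeasure ψ) := by
  have h : ‖E.simpleIntegral s ψ‖ₑ ^ 2 = eLpNorm s 2 (E.scalarMeasure ψ) ^ 2 := by
    have h1 : eLpNorm s 2 (E.scalarMeasure ψ) ^ 2 = ∫⁻ x, ‖s x‖ₑ ^ 2 ∂(E.scalarMeasure ψ) := by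
      have := eLpNorm_nnreal_pow_eq_lintegral (f := s) (μ := E.scalarMeasure ψ) (p := 2) (by norm_num)
      simpa using this
    have h2 : ∫⁻ x, ‖s x‖ₑ ^ 2 ∂(E.scalarMeasure ψ)
        = ∑ z ∈ s.range, ‖z‖ₑ ^ 2 * E.scalarMeasure ψ (s ⁻¹' {z}) := by
      have := SimpleFunc.map_lintegral (μ := E.scalarMeasure ψ) (fun z : ℂ => ‖z‖ₑ ^ 2) s
      rw [← this, ← SimpleFunc.lintegral_eq_lintegral]
      rfl
    rw [h1, h2, ← ofReal_norm, ← ENNReal.ofReal_pow (norm_nonneg _), E.norm_sq_simpleIntegral,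
      ENNReal.ofReal_sum_of_nonneg (fun z _ => by positivity)]
    refine Finset.sum_congr rfl fun z _ => ?_
    rw [E.scalarMeasure_apply ψ (s.measurableSet_fiber z), ENNReal.ofReal_mul (by positivity),
      ENNReal.ofReal_pow (norm_nonneg _), ofReal_norm]
  exact (ENNReal.pow_right_strictMono two_ne_zero).injective h

/-- A sequence of Borel simple functions that converges to the Borel function `f`, pointwise and in
every `L²(μ)` that contains `f`. -/
def approx (f : ℝ → ℂ) (hf : Measurable f) (n : ℕ) : SimpleFunc ℝ ℂ :=
  SimpleFunc.approxOn f hf Set.univ 0 (Set.mem_univ 0) n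

/-- The vector `(∫ f dE) ψ = lim (∫ sₙ dE) ψ` (the limit exists when `f ∈ L²(μ_ψ)`). -/
def apply (f : ℝ → ℂ) (hf : Measurable f) (ψ : 𝓗) : 𝓗 :=
  limUnder atTop fun n => E.simpleIntegral (approx f hf n) ψ

theorem tendsto_apply (f : ℝ → ℂ) (hf : Measurable f) (ψ : 𝓗)
    (h : MemLp f 2 (E.scalarMeasure ψ)) :
    Tendsto (fun n => E.simpleIntegral (approx f hf n) ψ) atTop (𝓝 (E.apply f hf ψ)) := by
  have h0 : Tendsto (fun n => eLpNorm (⇑(approx f hf n) - f) 2 (E.scalarMeasure ψ)) atTop (𝓝 0) :=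
    SimpleFunc.tendsto_approxOn_Lp_eLpNorm hf (Set.mem_univ 0) (by simp)
      (by simp) (by simpa using h.2)
  refine CauchySeq.tendsto_limUnder (Metric.cauchySeq_iff'.2 fun ε hε => ?_)
  have hε' : (0 : ℝ≥0∞) < ENNReal.ofReal (ε / 2) := by simpa using hε
  obtain ⟨N, hN⟩ := eventually_atTop.1 (h0.eventually_lt_const hε')
  refine ⟨N, fun n hn => ?_⟩
  have h1 : ‖E.simpleIntegral (approx f hf n) ψ - E.simpleIntegral (approx f hf N) ψ‖ₑ
      < ENNReal.ofReal ε := by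
    rw [← simpleIntegral_sub, enorm_simpleIntegral]
    calc eLpNorm (⇑(approx f hf n - approx f hf N)) 2 (E.scalarMeasure ψ)
        = eLpNorm ((⇑(approx f hf n) - f) - (⇑(approx f hf N) - f)) 2 (E.scalarMeasure ψ) := by
          congr 1; ext x; simp
      _ ≤ eLpNorm (⇑(approx f hf n) - f) 2 (E.scalarMeasure ψ)
          + eLpNorm (⇑(approx f hf N) - f) 2 (E.scalarMeasure ψ) :=
        eLpNorm_sub_le (((approx f hf n).measurable.sub hf).aestronglyMeasurable)
          (((approx f hf N).measurable.sub hf).aestronglyMeasurable) (by norm_num)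
      _ < ENNReal.ofReal (ε / 2) + ENNReal.ofReal (ε / 2) :=
        ENNReal.add_lt_add (hN n hn) (hN N le_rfl)
      _ = ENNReal.ofReal ε := by
        rw [← ENNReal.ofReal_add (by positivity) (by positivity)]; congr 1; ring
  rw [dist_eq_norm]
  rw [← ofReal_norm] at h1
  exact (ENNReal.ofReal_lt_ofReal_iff hε).1 h1

theorem memLp_two_add_measure {f : ℝ → ℂ} (hf : Measurable f) {μ ν : Measure ℝ}
    (hμ : MemLp f 2 μ) (hν : MemLp f 2 ν) : MemLp f 2 (μ + ν) := by
  rw [memLp_two_iff_integrable_sq_norm hf.aestronglyMeasurable] at *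
  exact hμ.add_measure hν

/-- The operator `∫ f dE` with its natural domain `{ψ | ∫ |f|² dμ_ψ < ∞}`. -/
def integral (f : ℝ → ℂ) (hf : Measurable f) : 𝓗 →ₗ.[ℂ] 𝓗 where
  domain :=
    { carrier := {ψ | MemLp f 2 (E.scalarMeasure ψ)}
      zero_mem' := by simp [E.scalarMeasure_zero]
      add_mem' := fun {ψ φ} hψ hφ =>
        (memLp_two_add_measure hf hψ hφ).of_measure_le_smul (by simp) (E.scalarMeasure_add_le ψ φ)
      smul_mem' := fun c ψ hψ =>
        MemLp.of_measure_le_smul (by simp) (E.scalarMeasure_smul_le c ψ) hψ }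
  toFun :=
    { toFun := fun ψ => E.apply f hf ψ
      map_add' := fun ψ φ => by
        have h := (E.tendsto_apply f hf ψ ψ.2).add (E.tendsto_apply f hf φ φ.2)
        refine tendsto_nhds_unique (E.tendsto_apply f hf _ (ψ + φ).2) ?_
        simpa using h
      map_smul' := fun c ψ => by
        have h := (E.tendsto_apply f hf ψ ψ.2).const_smul c
        refine tendsto_nhds_unique (E.tendsto_apply f hf _ (c • ψ).2) ?_
        simpa using h }

/-! ### The absolutely continuous and the singular continuous subspace -/

/-- The vectors whose scalar spectral measure is absolutely continuous with respect to Lebesgue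
measure. -/
def acSubspace : Submodule ℂ 𝓗 where
  carrier := {ψ | E.scalarMeasure ψ ≪ volume}
  zero_mem' := by simp [E.scalarMeasure_zero, Measure.AbsolutelyContinuous.zero]
  add_mem' := fun {ψ φ} hψ hφ =>
    (E.scalarMeasure_add_ac ψ φ).trans (Measure.AbsolutelyContinuous.add_left hψ hφ)
  smul_mem' := fun c ψ hψ => (E.scalarMeasure_smul_ac c ψ).trans hψ

theorem isClosed_acSubspace : IsClosed (E.acSubspace : Set 𝓗) := by
  have h : (E.acSubspace : Set 𝓗) =
      ⋂ (B : Set ℝ) (_ : MeasurableSet B ∧ volume B = 0), {ψ | E.proj B ψ = 0} := by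
    ext ψ
    simp only [Set.mem_iInter, Set.mem_ofPred_eq]
    constructor
    · rintro hψ B ⟨hB, h0⟩
      have h1 : E.scalarMeasure ψ B = 0 := hψ h0
      rw [E.scalarMeasure_apply ψ hB, ENNReal.ofReal_eq_zero] at h1
      exact norm_eq_zero.1 (pow_eq_zero_iff two_ne_zero |>.1 (le_antisymm h1 (by positivity)))
    · intro hψ
      refine Measure.AbsolutelyContinuous.mk fun B hB h0 => ?_
      rw [E.scalarMeasure_apply ψ hB, hψ B ⟨hB, h0⟩]
      simp
  rw [h]
  exact isClosed_iInter fun B => isClosed_iInter fun _ =>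
    isClosed_eq (E.proj B).continuous continuous_const

instance : CompleteSpace E.acSubspace := E.isClosed_acSubspace.completeSpace_coe

/-- The vectors whose scalar spectral measure has no atoms and is singular with respect to Lebesgue
measure. -/
def scSubspace : Submodule ℂ 𝓗 where
  carrier := {ψ | E.scalarMeasure ψ ⟂ₘ volume ∧ ∀ x, E.scalarMeasure ψ {x} = 0}
  zero_mem' := by simp [E.scalarMeasure_zero, Measure.MutuallySingular.zero_left]
  add_mem' := fun {ψ φ} hψ hφ =>
    ⟨(hψ.1.add_left hφ.1).mono_ac (E.scalarMeasure_add_ac ψ φ) Measure.AbsolutelyContinuous.rfl,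
      fun x => E.scalarMeasure_add_ac ψ φ (by simp [hψ.2 x, hφ.2 x])⟩
  smul_mem' := fun c ψ hψ =>
    ⟨hψ.1.mono_ac (E.scalarMeasure_smul_ac c ψ) Measure.AbsolutelyContinuous.rfl,
      fun x => E.scalarMeasure_smul_ac c ψ (hψ.2 x)⟩

end ProjectionValuedMeasure

/-! ### Spectral theory of unbounded operators -/

section Spectral

variable {𝓗 : Type*} [NormedAddCommGroup 𝓗] [InnerProductSpace ℂ 𝓗]

/-- The spectrum of `A`: those `z` for which `A - z` has no bounded everywhere defined inverse. -/
def spectrum (A : 𝓗 →ₗ.[ℂ] 𝓗) : Set ℂ :=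
  {z | ∃ R : 𝓗 →L[ℂ] 𝓗,
    (∀ ψ : 𝓗, ∃ h : R ψ ∈ A.domain, A ⟨R ψ, h⟩ - z • R ψ = ψ) ∧
    (∀ ψ : A.domain, R (A ψ - z • (ψ : 𝓗)) = ψ)}ᶜ

/-- The eigenspace `{ψ ∈ D(A) | Aψ = zψ}`. -/
def eigenspace (A : 𝓗 →ₗ.[ℂ] 𝓗) (z : ℂ) : Submodule ℂ 𝓗 where
  carrier := {ψ | ∃ h : ψ ∈ A.domain, A ⟨ψ, h⟩ = z • ψ}
  zero_mem' := ⟨A.domain.zero_mem, by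
    have : A (0 : A.domain) = 0 := A.map_zero
    rw [smul_zero]
    exact this⟩
  add_mem' := by
    rintro ψ φ ⟨h1, e1⟩ ⟨h2, e2⟩
    refine ⟨A.domain.add_mem h1 h2, ?_⟩
    have : A (⟨ψ, h1⟩ + ⟨φ, h2⟩ : A.domain) = A ⟨ψ, h1⟩ + A ⟨φ, h2⟩ := A.map_add _ _
    rw [smul_add, ← e1, ← e2, ← this]
    rfl
  smul_mem' := by
    rintro c ψ ⟨h1, e1⟩
    refine ⟨A.domain.smul_mem c h1, ?_⟩
    have : A (c • ⟨ψ, h1⟩ : A.domain) = c • A ⟨ψ, h1⟩ := A.map_smul _ _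
    rw [smul_comm, ← e1, ← this]
    rfl

/-- The point spectrum: the set of all eigenvalues. -/
def pointSpectrum (A : 𝓗 →ₗ.[ℂ] 𝓗) : Set ℂ := {z | eigenspace A z ≠ ⊥}

/-- The discrete spectrum: the eigenvalues of finite multiplicity that are isolated points of the
spectrum. -/
def discreteSpectrum (A : 𝓗 →ₗ.[ℂ] 𝓗) : Set ℂ :=
  {z | z ∈ pointSpectrum A ∧ FiniteDimensional ℂ (eigenspace A z) ∧
    ∃ ε > 0, spectrum A ∩ Metric.ball z ε = {z}}

/-- The part of `A` in the subspace `K`, with domain `{ψ ∈ K ∩ D(A) | Aψ ∈ K}`. If `K` reduces `A`,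
this is the reduced part of `A` to `K`. -/
def part (A : 𝓗 →ₗ.[ℂ] 𝓗) (K : Submodule ℂ 𝓗) : K →ₗ.[ℂ] K where
  domain :=
    { carrier := {ψ | ∃ h : (ψ : 𝓗) ∈ A.domain, A ⟨ψ, h⟩ ∈ K}
      zero_mem' := ⟨A.domain.zero_mem, by
        have : A (0 : A.domain) = 0 := A.map_zero
        have h : A ⟨((0 : K) : 𝓗), A.domain.zero_mem⟩ = 0 := this
        rw [h]
        exact K.zero_mem⟩
      add_mem' := by
        rintro ψ φ ⟨h1, e1⟩ ⟨h2, e2⟩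
        refine ⟨A.domain.add_mem h1 h2, ?_⟩
        have : A (⟨ψ, h1⟩ + ⟨φ, h2⟩ : A.domain) ∈ K := by
          rw [A.map_add]; exact K.add_mem e1 e2
        exact this
      smul_mem' := by
        rintro c ψ ⟨h1, e1⟩
        refine ⟨A.domain.smul_mem c h1, ?_⟩
        have : A (c • ⟨ψ, h1⟩ : A.domain) ∈ K := by
          rw [A.map_smul]; exact K.smul_mem c e1
        exact this }
  toFun :=
    { toFun := fun ψ => ⟨A ⟨ψ, ψ.2.1⟩, ψ.2.2⟩
      map_add' := fun ψ φ => Subtype.ext (A.map_add ⟨ψ, ψ.2.1⟩ ⟨φ, φ.2.1⟩)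
      map_smul' := fun c ψ => Subtype.ext (A.map_smul c ⟨ψ, ψ.2.1⟩) }

variable [CompleteSpace 𝓗]

/-- The spectral measure of `A`: the projection-valued measure `E` with `A = ∫ λ dE(λ)`, which
exists and is unique if `A` is self-adjoint (an arbitrary fixed value otherwise). -/
def spectralMeasure (A : 𝓗 →ₗ.[ℂ] 𝓗) : ProjectionValuedMeasure 𝓗 :=
  open Classical in
  if h : ∃ E : ProjectionValuedMeasure 𝓗, E.integral (fun x => (x : ℂ)) Complex.measurable_ofReal = A
  then h.choose else default

/-- The operator `f(A) = ∫ f dE` for a real Borel function `f`. -/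
def functionalCalculus (A : 𝓗 →ₗ.[ℂ] 𝓗) (f : ℝ → ℝ) (hf : Measurable f) : 𝓗 →ₗ.[ℂ] 𝓗 :=
  (spectralMeasure A).integral (fun x => (f x : ℂ)) (Complex.measurable_ofReal.comp hf)

/-- The vector `e^{-itA} ψ`. -/
def evolution (A : 𝓗 →ₗ.[ℂ] 𝓗) (t : ℝ) (ψ : 𝓗) : 𝓗 :=
  (spectralMeasure A).apply (fun x => Complex.exp (-(Complex.I * t * x))) (by fun_prop) ψ

/-- The reduced part `A_ac` of `A` in its subspace of absolute continuity. -/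
def acPart (A : 𝓗 →ₗ.[ℂ] 𝓗) :
    (spectralMeasure A).acSubspace →ₗ.[ℂ] (spectralMeasure A).acSubspace :=
  part A (spectralMeasure A).acSubspace

/-- The reduced part `A_sc` of `A` in its subspace of singular continuity. -/
def scPart (A : 𝓗 →ₗ.[ℂ] 𝓗) :
    (spectralMeasure A).scSubspace →ₗ.[ℂ] (spectralMeasure A).scSubspace :=
  part A (spectralMeasure A).scSubspace

end Spectral

/-! ### Time operators -/

section Time

variable {𝓗 : Type*} [NormedAddCommGroup 𝓗] [InnerProductSpace ℂ 𝓗]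

/-- A symmetric operator: densely defined and formally self-adjoint. -/
def IsSymmetricOperator (T : 𝓗 →ₗ.[ℂ] 𝓗) : Prop :=
  Dense (T.domain : Set 𝓗) ∧ T.IsFormalAdjoint T

variable [CompleteSpace 𝓗]

/-- `T` is a strong time operator of `A`: the self-adjoint operator `A` and the symmetric operator
`T` satisfy the weak Weyl relation `T e^{-itA} ψ = e^{-itA} (T + t) ψ` on `D(T)`. -/
structure IsStrongTimeOperator (A T : 𝓗 →ₗ.[ℂ] 𝓗) : Prop where
  isSelfAdjoint : IsSelfAdjoint A
  isSymmetric : IsSymmetricOperator T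
  weakWeyl : ∀ (t : ℝ) (ψ : T.domain), ∃ h : evolution A t ψ ∈ T.domain,
    T ⟨evolution A t ψ, h⟩ = evolution A t (T ψ + (t : ℂ) • (ψ : 𝓗))

/-- The class `S₁(𝓗)` of self-adjoint operators. -/
structure ClassS1 (H : 𝓗 →ₗ.[ℂ] 𝓗) : Prop where
  isSelfAdjoint : IsSelfAdjoint H
  sc_spectrum : spectrum (scPart H) = ∅
  ac_spectrum : spectrum (acPart H) = (fun x : ℝ => (x : ℂ)) '' Set.Ici 0
  discrete : ∃ e : ℕ → ℝ, StrictMono e ∧ (∀ n, e n < 0) ∧ Tendsto e atTop (𝓝 0) ∧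
    discreteSpectrum H = Set.range (fun n => (e n : ℂ)) ∧
    pointSpectrum H = Set.range (fun n => (e n : ℂ))
  exists_strong : ∃ T, IsStrongTimeOperator (acPart H) T

/-- `𝓔` is an ultra-weak CCR-domain for `(A, 𝔱)`, where `𝔱` is a sesquilinear form on `D₁ × D₂`,
antilinear in the first variable: `𝓔` is non-zero and there is a non-zero symmetric domain
`D ⊆ D₁ ∩ D₂` of `𝔱` with `𝓔 ⊆ D(A) ∩ D`, `A 𝓔 ⊆ D₁` and
`𝔱[Aφ, ψ] - 𝔱[Aψ, φ]^* = -i ⟨φ, ψ⟩` for all `φ, ψ ∈ 𝓔`. -/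
def IsUltraWeakCCRDomain (A : 𝓗 →ₗ.[ℂ] 𝓗) {D₁ D₂ : Submodule ℂ 𝓗}
    (𝔱 : D₁ →ₗ⋆[ℂ] D₂ →ₗ[ℂ] ℂ) (𝓔 : Submodule ℂ 𝓗) : Prop :=
  𝓔 ≠ ⊥ ∧ ∃ D : Submodule ℂ 𝓗, D ≠ ⊥ ∧
    ∃ (hD₁ : D ≤ D₁) (hD₂ : D ≤ D₂) (hE : 𝓔 ≤ A.domain ⊓ D),
      (∀ φ ψ : D, conj (𝔱 ⟨φ, hD₁ φ.2⟩ ⟨ψ, hD₂ ψ.2⟩) = 𝔱 ⟨ψ, hD₁ ψ.2⟩ ⟨φ, hD₂ φ.2⟩) ∧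
      ∃ hA : ∀ φ : 𝓔, A ⟨φ, (hE φ.2).1⟩ ∈ D₁,
        ∀ φ ψ : 𝓔,
          𝔱 ⟨A ⟨φ, (hE φ.2).1⟩, hA φ⟩ ⟨ψ, hD₂ (hE ψ.2).2⟩
            - conj (𝔱 ⟨A ⟨ψ, (hE ψ.2).1⟩, hA ψ⟩ ⟨φ, hD₂ (hE φ.2).2⟩)
          = -Complex.I * ⟪(φ : 𝓗), (ψ : 𝓗)⟫_ℂ

/-- The sesquilinear form `𝔱` on `D₁ × D₂`, antilinear in the first variable, is an ultra-weak time
operator of the self-adjoint operator `A`. -/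
structure IsUltraWeakTimeOperator (A : 𝓗 →ₗ.[ℂ] 𝓗) {D₁ D₂ : Submodule ℂ 𝓗}
    (𝔱 : D₁ →ₗ⋆[ℂ] D₂ →ₗ[ℂ] ℂ) : Prop where
  isSelfAdjoint : IsSelfAdjoint A
  left_ne_bot : D₁ ≠ ⊥
  right_ne_bot : D₂ ≠ ⊥
  exists_domain : ∃ 𝓔 : Submodule ℂ 𝓗, IsUltraWeakCCRDomain A 𝔱 𝓔

end Time

end TimeOp

end

/-! Write `E` for the spectral measure of `H`, so that `f(H)` is the integral of `f` against `E`; it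
is self-adjoint because `f` is real (`isSelfAdjoint_integral`). An empty singular continuous
spectrum forces the singular continuous subspace to vanish (`scSubspace_eq_bot`), so the absolutely
continuous subspace and the eigenvectors together are total (`eq_zero_of_orthogonal`). A time form
is built on each of the two pieces, and the two are added.

Absolutely continuous piece. The weak Weyl relation says that `[T, g(H)] = i g'(H)` when `g` is an
exponential. The relation survives linear combinations and bounded pointwise limits, hence holds for
every compactly supported `C¹` function (`IsExpClosed.of_hasCompactSupport`). Let `U` be the open
set of full measure where `f` is `C²` and `f' ≠ 0`, and put `u = 1/f'`. The symmetrised product `S =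
(T u(H) + u(H) T)/2` then makes sense on the vectors `g(H)ψ` with `g` a test function on `U` and `ψ`
in the domain of `T`. It is symmetric there and satisfies `S f(H) = f(H) S + i`, because `u f' = 1`
(`IsWeakWeyl.exists_conjugate`). These vectors span a dense subspace because absolutely continuous
vectors do not charge the complement of `U`.

Point piece. Choose an orthonormal family of eigenvectors `e j` of `f(H)`, with eigenvalues `lam j`,
that spans all eigenvectors of `H` topologically. There are infinitely many eigenvalues, each
repeated finitely often, so the index set splits into infinite classes on which `lam` is injective
(`exists_infinite_injective_classes`). Inside a class take the matrix `i/(lam j - lam k)`, with zero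
diagonal. Its commutator with the diagonal operator is `-i` times the identity plus `i` times the
all-ones matrix of the class, and the all-ones matrix vanishes on differences `e j - e k`
(`exists_form_conjugate_to_diagonal`). The differences are total: a vector orthogonal to them has
constant coefficients along an infinite class, and square summability makes these zero. Since only a
form is required, no convergence or boundedness of the matrix enters.

Two general facts are needed in between. The spectral theorem (`exists_generator_eq`) shows that the
chosen spectral measure does represent `H`; it comes from the continuous functional calculus of a
resolvent. Uniqueness of the unitary group (`expOp_eq_of_generator_eq`) identifies the evolution of
the absolutely continuous part with the restriction of `E`. -/

noncomputable section

namespace TimeOp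

/-! ### Borel functional calculus of a projection-valued measure. -/

section

namespace ProjectionValuedMeasure

variable {𝓗 : Type*} [NormedAddCommGroup 𝓗] [InnerProductSpace ℂ 𝓗] [CompleteSpace 𝓗]
variable (E : ProjectionValuedMeasure 𝓗)

/-! ### Functional calculus -/

theorem proj_proj {B C : Set ℝ} (hB : MeasurableSet B) (hC : MeasurableSet C) (ψ : 𝓗) :
    E.proj B (E.proj C ψ) = E.proj (B ∩ C) ψ := by
  rw [E.proj_inter B C hB hC]; rfl

theorem proj_comm {B C : Set ℝ} (hB : MeasurableSet B) (hC : MeasurableSet C) (ψ : 𝓗) :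
    E.proj B (E.proj C ψ) = E.proj C (E.proj B ψ) := by
  rw [E.proj_proj hB hC, E.proj_proj hC hB, Set.inter_comm]

theorem inner_proj_left (B : Set ℝ) (φ ψ : 𝓗) :
    ⟪E.proj B φ, ψ⟫_ℂ = ⟪φ, E.proj B ψ⟫_ℂ := by
  have h2 : (E.proj B).adjoint = E.proj B := (E.isStarProjection B).isSelfAdjoint
  conv_lhs => rw [← h2]
  exact ContinuousLinearMap.adjoint_inner_left _ _ _

theorem inner_simpleIntegral_left (s : SimpleFunc ℝ ℂ) (φ ψ : 𝓗) :
    ⟪E.simpleIntegral s φ, ψ⟫_ℂ = ∑ z ∈ s.range, conj z * ⟪φ, E.proj (s ⁻¹' {z}) ψ⟫_ℂ := by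
  simp only [simpleIntegral, sum_apply, smul_apply, sum_inner, inner_smul_left, inner_proj_left]

theorem proj_simpleIntegral {B : Set ℝ} (hB : MeasurableSet B) (s : SimpleFunc ℝ ℂ) (ψ : 𝓗) :
    E.proj B (E.simpleIntegral s ψ) = E.simpleIntegral s (E.proj B ψ) := by
  simp only [simpleIntegral, sum_apply, smul_apply, map_sum, map_smul]
  exact Finset.sum_congr rfl fun z _ => by rw [E.proj_comm hB (s.measurableSet_fiber z)]

theorem scalarMeasure_proj {B : Set ℝ} (hB : MeasurableSet B) (ψ : 𝓗) :
    E.scalarMeasure (E.proj B ψ) = (E.scalarMeasure ψ).restrict B := by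
  ext C hC
  rw [Measure.restrict_apply hC, E.scalarMeasure_apply _ hC, E.scalarMeasure_apply _ (hC.inter hB),
    E.proj_proj hC hB]

/-- Simple functions act isometrically from `L²(μ_ψ)`, so the limit does not depend on the
approximating sequence. This frees later arguments from the particular sequence used in the
definition of `apply`. -/
theorem tendsto_simpleIntegral {f : ℝ → ℂ} (hf : Measurable f) {ψ : 𝓗}
    (h : MemLp f 2 (E.scalarMeasure ψ)) (s : ℕ → SimpleFunc ℝ ℂ)
    (hs : Tendsto (fun n => eLpNorm (⇑(s n) - f) 2 (E.scalarMeasure ψ)) atTop (𝓝 0)) :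
    Tendsto (fun n => E.simpleIntegral (s n) ψ) atTop (𝓝 (E.apply f hf ψ)) := by
  have h0 : Tendsto (fun n => eLpNorm (⇑(approx f hf n) - f) 2 (E.scalarMeasure ψ)) atTop (𝓝 0) :=
    SimpleFunc.tendsto_approxOn_Lp_eLpNorm hf (Set.mem_univ 0) (by simp)
      (by simp) (by simpa using h.2)
  have h1 : Tendsto (fun n => E.simpleIntegral (s n) ψ - E.simpleIntegral (approx f hf n) ψ) atTop
      (𝓝 0) := by
    rw [tendsto_zero_iff_enorm_tendsto_zero]
    refine tendsto_of_tendsto_of_tendsto_of_le_of_le tendsto_const_nhds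
      (by simpa using hs.add h0) (fun _ => zero_le) fun n => ?_
    rw [← simpleIntegral_sub, enorm_simpleIntegral]
    calc eLpNorm (⇑(s n - approx f hf n)) 2 (E.scalarMeasure ψ)
        = eLpNorm ((⇑(s n) - f) - (⇑(approx f hf n) - f)) 2 (E.scalarMeasure ψ) := by
          congr 1; ext x; simp
      _ ≤ _ := eLpNorm_sub_le (((s n).measurable.sub hf).aestronglyMeasurable)
          (((approx f hf n).measurable.sub hf).aestronglyMeasurable) (by norm_num)
  simpa using h1.add (E.tendsto_apply f hf ψ h)

theorem tendsto_approx {f : ℝ → ℂ} (hf : Measurable f) {μ : Measure ℝ} (h : MemLp f 2 μ) :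
    Tendsto (fun n => eLpNorm (⇑(approx f hf n) - f) 2 μ) atTop (𝓝 0) :=
  SimpleFunc.tendsto_approxOn_Lp_eLpNorm hf (Set.mem_univ 0) (by simp) (by simp) (by simpa using h.2)

theorem apply_simpleFunc (s : SimpleFunc ℝ ℂ) (ψ : 𝓗) :
    E.apply s s.measurable ψ = E.simpleIntegral s ψ :=
  tendsto_nhds_unique (E.tendsto_simpleIntegral s.measurable
    (SimpleFunc.memLp_of_isFiniteMeasure s _ _) (fun _ => s) (by simp)) tendsto_const_nhds

/-- The isometry passes from simple functions to their `L²` limits. Most of the calculus below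
reduces to it. -/
theorem enorm_apply {f : ℝ → ℂ} (hf : Measurable f) {ψ : 𝓗} (h : MemLp f 2 (E.scalarMeasure ψ)) :
    ‖E.apply f hf ψ‖ₑ = eLpNorm f 2 (E.scalarMeasure ψ) := by
  refine tendsto_nhds_unique (E.tendsto_apply f hf ψ h).enorm ?_
  simp only [enorm_simpleIntegral]
  have h1 := (Lp.tendsto_Lp_iff_tendsto_eLpNorm'' (fun n => ⇑(approx f hf n))
    (fun n => SimpleFunc.memLp_of_isFiniteMeasure _ _ _) f h).2 (tendsto_approx hf h)
  simpa only [Lp.enorm_toLp] using h1.enorm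

theorem simpleIntegral_add (s t : SimpleFunc ℝ ℂ) (ψ : 𝓗) :
    E.simpleIntegral (s + t) ψ = E.simpleIntegral s ψ + E.simpleIntegral t ψ := by
  simp only [simpleIntegral_apply]
  exact SimpleFunc.setToSimpleFunc_add _ (E.finMeasAdditive_smulProj ψ)
    (SimpleFunc.integrable_of_isFiniteMeasure s) (SimpleFunc.integrable_of_isFiniteMeasure t)

theorem simpleIntegral_smul (c : ℂ) (s : SimpleFunc ℝ ℂ) (ψ : 𝓗) :
    E.simpleIntegral (c • s) ψ = c • E.simpleIntegral s ψ := by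
  simp only [simpleIntegral_apply]
  exact SimpleFunc.setToSimpleFunc_smul _ (E.finMeasAdditive_smulProj ψ)
    (fun c B z => by simp [smulProj, mul_smul]) c (SimpleFunc.integrable_of_isFiniteMeasure s)

theorem apply_add {f g : ℝ → ℂ} (hf : Measurable f) (hg : Measurable g) {ψ : 𝓗}
    (h : MemLp f 2 (E.scalarMeasure ψ)) (h' : MemLp g 2 (E.scalarMeasure ψ)) :
    E.apply (fun x => f x + g x) (hf.add hg) ψ = E.apply f hf ψ + E.apply g hg ψ := by
  refine tendsto_nhds_unique (E.tendsto_simpleIntegral (hf.add hg) (h.add h')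
    (fun n => approx f hf n + approx g hg n) ?_)
    (by simpa only [simpleIntegral_add] using (E.tendsto_apply f hf ψ h).add (E.tendsto_apply g hg ψ h'))
  refine tendsto_of_tendsto_of_tendsto_of_le_of_le tendsto_const_nhds
      (by simpa using (tendsto_approx hf h).add (tendsto_approx hg h')) (fun _ => zero_le) fun n => ?_
  calc _ = eLpNorm ((⇑(approx f hf n) - f) + (⇑(approx g hg n) - g)) 2 (E.scalarMeasure ψ) := by
          congr 1; ext x; simp; ring
      _ ≤ _ := eLpNorm_add_le (((approx f hf n).measurable.sub hf).aestronglyMeasurable)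
          (((approx g hg n).measurable.sub hg).aestronglyMeasurable) (by norm_num)

theorem apply_const_mul {f : ℝ → ℂ} (hf : Measurable f) (c : ℂ) {ψ : 𝓗}
    (h : MemLp f 2 (E.scalarMeasure ψ)) :
    E.apply (fun x => c * f x) (hf.const_mul c) ψ = c • E.apply f hf ψ := by
  refine tendsto_nhds_unique (E.tendsto_simpleIntegral (hf.const_mul c) (h.const_mul c)
    (fun n => c • approx f hf n) ?_)
    (by simpa only [simpleIntegral_smul] using (E.tendsto_apply f hf ψ h).const_smul c)
  have : ∀ n, eLpNorm (⇑(c • approx f hf n) - fun x => c * f x) 2 (E.scalarMeasure ψ)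
      = ‖c‖ₑ * eLpNorm (⇑(approx f hf n) - f) 2 (E.scalarMeasure ψ) := fun n => by
    rw [← eLpNorm_const_smul]
    congr 1; ext x; simp; ring
  simp only [this]
  simpa using ENNReal.Tendsto.const_mul (tendsto_approx hf h) (a := ‖c‖ₑ) (by simp)

theorem apply_sub {f g : ℝ → ℂ} (hf : Measurable f) (hg : Measurable g) {ψ : 𝓗}
    (h : MemLp f 2 (E.scalarMeasure ψ)) (h' : MemLp g 2 (E.scalarMeasure ψ)) :
    E.apply (fun x => f x - g x) (hf.sub hg) ψ = E.apply f hf ψ - E.apply g hg ψ := by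
  have := E.apply_add hf (hg.const_mul (-1)) h (h'.const_mul (-1))
  rw [E.apply_const_mul hg (-1) h'] at this
  simpa [sub_eq_add_neg] using this

theorem apply_congr {f g : ℝ → ℂ} (hf : Measurable f) (hg : Measurable g) {ψ : 𝓗}
    (h : MemLp f 2 (E.scalarMeasure ψ)) (hfg : f =ᵐ[E.scalarMeasure ψ] g) :
    E.apply f hf ψ = E.apply g hg ψ := by
  have h' : MemLp g 2 (E.scalarMeasure ψ) := (memLp_congr_ae hfg).1 h
  rw [← sub_eq_zero, ← E.apply_sub hf hg h h', ← enorm_eq_zero,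
    E.enorm_apply (f := fun x => f x - g x) _ (h.sub h'),
    eLpNorm_eq_zero_iff (f := fun x => f x - g x) (hf.sub hg).aestronglyMeasurable (by norm_num)]
  filter_upwards [hfg] with x hx
  simp [hx]

theorem tendsto_apply_of_tendsto {f : ℝ → ℂ} (hf : Measurable f) {ψ : 𝓗}
    (h : MemLp f 2 (E.scalarMeasure ψ)) {ι : Type*} {l : Filter ι} (g : ι → ℝ → ℂ)
    (hg : ∀ n, Measurable (g n)) (hg' : ∀ n, MemLp (g n) 2 (E.scalarMeasure ψ))
    (hs : Tendsto (fun n => eLpNorm (fun x => g n x - f x) 2 (E.scalarMeasure ψ)) l (𝓝 0)) :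
    Tendsto (fun n => E.apply (g n) (hg n) ψ) l (𝓝 (E.apply f hf ψ)) := by
  rw [tendsto_iff_norm_sub_tendsto_zero, ← tendsto_zero_iff_norm_tendsto_zero,
    tendsto_zero_iff_enorm_tendsto_zero]
  refine hs.congr fun n => ?_
  rw [← E.apply_sub (hg n) hf (hg' n) h, E.enorm_apply (f := fun x => g n x - f x) _ ((hg' n).sub h)]

theorem memLp_proj {f : ℝ → ℂ} {ψ : 𝓗} (h : MemLp f 2 (E.scalarMeasure ψ)) {B : Set ℝ}
    (hB : MeasurableSet B) : MemLp f 2 (E.scalarMeasure (E.proj B ψ)) := by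
  rw [E.scalarMeasure_proj hB]; exact h.restrict B

theorem proj_apply {B : Set ℝ} (hB : MeasurableSet B) {f : ℝ → ℂ} (hf : Measurable f) {ψ : 𝓗}
    (h : MemLp f 2 (E.scalarMeasure ψ)) :
    E.proj B (E.apply f hf ψ) = E.apply f hf (E.proj B ψ) := by
  refine tendsto_nhds_unique (((E.proj B).continuous.tendsto _).comp (E.tendsto_apply f hf ψ h)) ?_
  simpa only [Function.comp_def, E.proj_simpleIntegral hB] using
    E.tendsto_apply f hf _ (E.memLp_proj h hB)

theorem enorm_apply_sq {f : ℝ → ℂ} (hf : Measurable f) {ψ : 𝓗}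
    (h : MemLp f 2 (E.scalarMeasure ψ)) :
    ‖E.apply f hf ψ‖ₑ ^ 2 = ∫⁻ x, ‖f x‖ₑ ^ 2 ∂(E.scalarMeasure ψ) := by
  rw [E.enorm_apply hf h]
  have := eLpNorm_nnreal_pow_eq_lintegral (f := f) (μ := E.scalarMeasure ψ) (p := 2) (by norm_num)
  simpa using this

theorem scalarMeasure_apply' (ψ : 𝓗) {B : Set ℝ} (hB : MeasurableSet B) :
    E.scalarMeasure ψ B = ‖E.proj B ψ‖ₑ ^ 2 := by
  rw [E.scalarMeasure_apply ψ hB, ENNReal.ofReal_pow (norm_nonneg _), ofReal_norm]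

/-- Spectral projections commute with `∫ f dE`, so the mass of `B` is the squared norm of `∫ f dE`
at `E(B)ψ`, an integral of `|f|²` over `B`. It controls domains of products and stability of the
spectral subspaces. -/
theorem scalarMeasure_of_apply {f : ℝ → ℂ} (hf : Measurable f) {ψ : 𝓗}
    (h : MemLp f 2 (E.scalarMeasure ψ)) :
    E.scalarMeasure (E.apply f hf ψ) = (E.scalarMeasure ψ).withDensity fun x => ‖f x‖ₑ ^ 2 := by
  ext B hB
  rw [E.scalarMeasure_apply' _ hB, E.proj_apply hB hf h, E.enorm_apply_sq hf (E.memLp_proj h hB),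
    withDensity_apply _ hB, E.scalarMeasure_proj hB]

theorem eLpNorm_withDensity {f g : ℝ → ℂ} (hf : Measurable f) (hg : Measurable g) (μ : Measure ℝ) :
    eLpNorm g 2 (μ.withDensity fun x => ‖f x‖ₑ ^ 2) = eLpNorm (fun x => g x * f x) 2 μ := by
  refine (ENNReal.pow_right_strictMono two_ne_zero).injective ?_
  have h1 : ∀ (k : ℝ → ℂ) (ν : Measure ℝ), eLpNorm k 2 ν ^ 2 = ∫⁻ x, ‖k x‖ₑ ^ 2 ∂ν := fun k ν => by
    have := eLpNorm_nnreal_pow_eq_lintegral (f := k) (μ := ν) (p := 2) (by norm_num)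
    simpa using this
  simp only [h1]
  rw [lintegral_withDensity_eq_lintegral_mul _ (by fun_prop) (by fun_prop)]
  refine lintegral_congr fun x => ?_
  simp [mul_pow, mul_comm]

theorem memLp_apply_iff {f g : ℝ → ℂ} (hf : Measurable f) (hg : Measurable g) {ψ : 𝓗}
    (h : MemLp f 2 (E.scalarMeasure ψ)) :
    MemLp g 2 (E.scalarMeasure (E.apply f hf ψ)) ↔
      MemLp (fun x => g x * f x) 2 (E.scalarMeasure ψ) := by
  rw [E.scalarMeasure_of_apply hf h]
  simp only [MemLp, eLpNorm_withDensity hf hg, hg.aestronglyMeasurable,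
    (show Measurable fun x => g x * f x from hg.mul hf).aestronglyMeasurable]

theorem proj_eq_apply {B : Set ℝ} (hB : MeasurableSet B) (ψ : 𝓗) :
    E.proj B ψ = E.apply (B.indicator 1) (measurable_one.indicator hB) ψ := by
  classical
  let s : SimpleFunc ℝ ℂ := SimpleFunc.piecewise B hB (SimpleFunc.const ℝ 1) (SimpleFunc.const ℝ 0)
  have hs : (s : ℝ → ℂ) = B.indicator 1 := by
    ext x; by_cases hx : x ∈ B <;> simp [s, hx]
  have h1 := E.apply_simpleFunc s ψ
  simp only [hs] at h1
  rw [h1, simpleIntegral]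
  have hsub : s.range ⊆ {0, 1} := by
    intro z hz
    obtain ⟨x, rfl⟩ := SimpleFunc.mem_range.1 hz
    rw [hs]
    by_cases hx : x ∈ B <;> simp [hx]
  have hpre : s ⁻¹' {1} = B := by
    rw [hs]; ext x; by_cases hx : x ∈ B <;> simp [hx]
  by_cases h : (1 : ℂ) ∈ s.range
  · rw [Finset.sum_eq_single_of_mem 1 h]
    · rw [hpre, one_smul]
    · intro z hz h1
      have := hsub hz
      simp only [Finset.mem_insert, Finset.mem_singleton, h1, or_false] at this
      simp [this]
  · have hBe : B = ∅ := by
      rw [← hpre]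
      exact SimpleFunc.preimage_eq_empty_iff _ _ |>.2 h
    rw [Finset.sum_eq_zero]
    · simp [hBe, E.proj_empty]
    · intro z hz
      have := hsub hz
      have h2 : z ≠ 1 := fun h' => h (h' ▸ hz)
      simp only [Finset.mem_insert, Finset.mem_singleton, h2, or_false] at this
      simp [this]

/-- Split `f` into its restrictions to `B` and to the complement; a projection kills the part of `f`
supported on a disjoint set. -/
theorem proj_apply_eq_apply_indicator {B : Set ℝ} (hB : MeasurableSet B) {f : ℝ → ℂ}
    (hf : Measurable f) {ψ : 𝓗} (h : MemLp f 2 (E.scalarMeasure ψ)) :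
    E.proj B (E.apply f hf ψ) = E.apply (B.indicator f) (hf.indicator hB) ψ := by
  have h1 := E.apply_add (hf.indicator hB) (hf.indicator hB.compl) (h.indicator hB)
    (h.indicator hB.compl)
  have h2 : (fun x => B.indicator f x + Bᶜ.indicator f x) = f :=
    Set.indicator_self_add_compl B f
  simp only [h2] at h1
  have key : ∀ {C D : Set ℝ} (hC : MeasurableSet C) (hD : MeasurableSet D), Disjoint C D →
      E.proj C (E.apply (D.indicator f) (hf.indicator hD) ψ) = 0 := by
    intro C D hC hD hCD
    rw [E.proj_apply hC _ (h.indicator hD), ← enorm_eq_zero,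
      E.enorm_apply _ (E.memLp_proj (h.indicator hD) hC), E.scalarMeasure_proj hC,
      eLpNorm_eq_zero_iff (hf.indicator hD).aestronglyMeasurable (by norm_num)]
    filter_upwards [ae_restrict_mem hC] with x hx
    simp [Set.disjoint_left.1 hCD hx]
  have h3 : ∀ φ, E.proj B φ + E.proj Bᶜ φ = φ := fun φ => by
    rw [← E.proj_union hB hB.compl disjoint_compl_right]
    simp [E.proj_univ]
  rw [h1, map_add, key hB hB.compl disjoint_compl_right, add_zero]
  conv_rhs => rw [← h3 (E.apply (B.indicator f) _ ψ), key hB.compl hB disjoint_compl_left, add_zero]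

theorem simpleIntegral_apply_eq (s : SimpleFunc ℝ ℂ) {f : ℝ → ℂ} (hf : Measurable f) {ψ : 𝓗}
    (h : MemLp f 2 (E.scalarMeasure ψ)) :
    E.simpleIntegral s (E.apply f hf ψ)
      = E.apply (fun x => s x * f x) (s.measurable.mul hf) ψ := by
  have hm : ∀ s : SimpleFunc ℝ ℂ, MemLp (fun x => s x * f x) 2 (E.scalarMeasure ψ) := fun s => by
    obtain ⟨C, hC⟩ := s.exists_forall_norm_le
    refine MemLp.of_le_mul (c := C) h (s.measurable.mul hf).aestronglyMeasurable
      (Eventually.of_forall fun x => ?_)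
    rw [norm_mul]
    exact mul_le_mul_of_nonneg_right (hC x) (norm_nonneg _)
  induction s using SimpleFunc.induction with
  | @const c B hB =>
    rw [← E.apply_simpleFunc]
    have h2 : ∀ φ : 𝓗, E.apply (SimpleFunc.piecewise B hB (SimpleFunc.const ℝ c)
        (SimpleFunc.const ℝ 0)) (SimpleFunc.measurable _) φ = c • E.proj B φ := fun φ => by
      rw [E.proj_eq_apply hB, ← E.apply_const_mul (f := B.indicator 1) _ _ ((memLp_const (1 : ℂ)).indicator hB)]
      congr 1
      ext x; by_cases hx : x ∈ B <;> simp [hx]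
    rw [h2, E.proj_apply_eq_apply_indicator hB hf h, ← E.apply_const_mul _ _ (h.indicator hB)]
    congr 1
    ext x; by_cases hx : x ∈ B <;> simp [hx]
  | @add s t hst hs ht =>
    rw [simpleIntegral_add, hs, ht, ← E.apply_add _ _ (hm s) (hm t)]
    congr 1
    ext x; simp [add_mul]

/-- Multiplicativity is known for simple `s` in place of `g`. Since the measure of the vector `(∫ f
dE)ψ` is `|f|² μ_ψ`, approximating `g` in its `L²` space is the same as approximating `g f` in
`L²(μ_ψ)`. -/
theorem apply_apply {f g : ℝ → ℂ} (hf : Measurable f) (hg : Measurable g) {ψ : 𝓗}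
    (h : MemLp f 2 (E.scalarMeasure ψ))
    (h' : MemLp (fun x => g x * f x) 2 (E.scalarMeasure ψ)) :
    E.apply g hg (E.apply f hf ψ) = E.apply (fun x => g x * f x) (hg.mul hf) ψ := by
  have hg' := (E.memLp_apply_iff hf hg h).2 h'
  refine tendsto_nhds_unique (E.tendsto_apply g hg _ hg') ?_
  simp only [E.simpleIntegral_apply_eq _ hf h]
  have hm : ∀ s : SimpleFunc ℝ ℂ, MemLp (fun x => s x * f x) 2 (E.scalarMeasure ψ) := fun s =>
    (E.memLp_apply_iff hf s.measurable h).1 (SimpleFunc.memLp_of_isFiniteMeasure s _ _)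
  refine E.tendsto_apply_of_tendsto (hg.mul hf) h' _ _ (fun n => hm _) ?_
  have := tendsto_approx hg hg'
  rw [E.scalarMeasure_of_apply hf h] at this
  refine this.congr fun n => ?_
  rw [eLpNorm_withDensity hf ((approx g hg n).measurable.sub hg)]
  congr 1; ext x; simp [sub_mul]

theorem inner_apply_left {f : ℝ → ℂ} (hf : Measurable f) {φ ψ : 𝓗}
    (h : MemLp f 2 (E.scalarMeasure φ)) (h' : MemLp f 2 (E.scalarMeasure ψ)) :
    ⟪E.apply f hf φ, ψ⟫_ℂ
      = ⟪φ, E.apply (fun x => conj (f x)) (Complex.continuous_conj.measurable.comp hf) ψ⟫_ℂ := by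
  have hs : ∀ s : SimpleFunc ℝ ℂ,
      ⟪E.simpleIntegral s φ, ψ⟫_ℂ = ⟪φ, E.simpleIntegral (s.map conj) ψ⟫_ℂ := by
    intro s
    rw [inner_simpleIntegral_left, simpleIntegral, sum_apply, inner_sum, SimpleFunc.range_map,
      Finset.sum_image (fun x _ y _ hxy => (starRingEnd ℂ).injective hxy)]
    refine Finset.sum_congr rfl fun z _ => ?_
    rw [smul_apply, inner_smul_right]
    congr 4
    ext x
    simp [(starRingEnd ℂ).injective.eq_iff]
  refine tendsto_nhds_unique ((E.tendsto_apply f hf φ h).inner tendsto_const_nhds) ?_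
  simp only [hs]
  refine tendsto_const_nhds.inner (E.tendsto_simpleIntegral _ h'.star _ ?_)
  refine (tendsto_approx hf h').congr fun n => ?_
  refine eLpNorm_congr_norm_ae (Eventually.of_forall fun x => ?_)
  simp only [Pi.sub_apply, SimpleFunc.map_apply, Pi.star_apply]
  rw [← starRingEnd_apply, ← map_sub, RCLike.norm_conj]

/-! ### Bounded Borel functions -/

/-- Bounded Borel functions. -/
structure IsBddMeasurable {α : Type*} [MeasurableSpace α] (g : α → ℂ) : Prop where
  measurable : Measurable g
  bdd : ∃ C, ∀ x, ‖g x‖ ≤ C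

namespace IsBddMeasurable

variable {α : Type*} [MeasurableSpace α] {g h : α → ℂ}

theorem const (c : ℂ) : IsBddMeasurable fun _ : α => c := ⟨measurable_const, ‖c‖, fun _ => le_rfl⟩

theorem add (hg : IsBddMeasurable g) (hh : IsBddMeasurable h) :
    IsBddMeasurable fun x => g x + h x := by
  obtain ⟨⟨hg, C, hC⟩, ⟨hh, D, hD⟩⟩ := And.intro hg hh
  exact ⟨hg.add hh, C + D, fun x => (norm_add_le _ _).trans (add_le_add (hC x) (hD x))⟩

theorem mul (hg : IsBddMeasurable g) (hh : IsBddMeasurable h) :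
    IsBddMeasurable fun x => g x * h x := by
  obtain ⟨⟨hg, C, hC⟩, ⟨hh, D, hD⟩⟩ := And.intro hg hh
  refine ⟨hg.mul hh, C * D, fun x => ?_⟩
  rw [norm_mul]
  exact mul_le_mul (hC x) (hD x) (norm_nonneg _) ((norm_nonneg _).trans (hC x))

theorem const_mul (c : ℂ) (hg : IsBddMeasurable g) : IsBddMeasurable fun x => c * g x :=
  (const c).mul hg

theorem sub (hg : IsBddMeasurable g) (hh : IsBddMeasurable h) :
    IsBddMeasurable fun x => g x - h x := by
  simpa [sub_eq_add_neg] using hg.add (hh.const_mul (-1))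

theorem conjugate (hg : IsBddMeasurable g) : IsBddMeasurable fun x => conj (g x) := by
  obtain ⟨hg, C, hC⟩ := hg
  exact ⟨Complex.continuous_conj.measurable.comp hg, C, fun x => by simpa using hC x⟩

theorem indicator {B : Set α} (hB : MeasurableSet B) (hg : IsBddMeasurable g) :
    IsBddMeasurable (B.indicator g) := by
  obtain ⟨hg, C, hC⟩ := hg
  exact ⟨hg.indicator hB, C, fun x => (norm_indicator_le_norm_self _ _).trans (hC x)⟩

theorem memLp (hg : IsBddMeasurable g) (μ : Measure α) [IsFiniteMeasure μ] : MemLp g 2 μ := by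
  obtain ⟨hg, C, hC⟩ := hg
  exact MemLp.of_bound hg.aestronglyMeasurable C (Eventually.of_forall hC)

end IsBddMeasurable

theorem mem_integral_domain {f : ℝ → ℂ} {hf : Measurable f} {ψ : 𝓗} :
    ψ ∈ (E.integral f hf).domain ↔ MemLp f 2 (E.scalarMeasure ψ) := Iff.rfl

theorem integral_apply {f : ℝ → ℂ} {hf : Measurable f} (ψ : (E.integral f hf).domain) :
    E.integral f hf ψ = E.apply f hf ψ := rfl

/-- The bounded operator `∫ g dE` for a bounded Borel function `g`. -/
def op (g : ℝ → ℂ) (hg : IsBddMeasurable g) : 𝓗 →L[ℂ] 𝓗 :=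
  LinearMap.mkContinuousOfExistsBound
    { toFun := E.apply g hg.measurable
      map_add' := fun ψ φ => (E.integral g hg.measurable).map_add
        ⟨ψ, hg.memLp (E.scalarMeasure ψ)⟩ ⟨φ, hg.memLp (E.scalarMeasure φ)⟩
      map_smul' := fun c ψ => (E.integral g hg.measurable).map_smul c
        ⟨ψ, hg.memLp (E.scalarMeasure ψ)⟩ }
    (by
      obtain ⟨C, hC⟩ := hg.bdd
      refine ⟨C, fun ψ => ?_⟩
      have h0 : 0 ≤ C := (norm_nonneg _).trans (hC 0)
      rw [← ENNReal.ofReal_le_ofReal_iff (by positivity), ENNReal.ofReal_mul h0, ofReal_norm,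
        ofReal_norm]
      change ‖E.apply g hg.measurable ψ‖ₑ ≤ _
      refine (ENNReal.pow_right_strictMono two_ne_zero).le_iff_le.1 ?_
      rw [E.enorm_apply_sq _ (hg.memLp _), mul_pow]
      have h1 : ‖ψ‖ₑ ^ 2 = E.scalarMeasure ψ Set.univ := by
        rw [E.scalarMeasure_apply' ψ MeasurableSet.univ, E.proj_univ]; rfl
      rw [h1, ← lintegral_const]
      refine lintegral_mono fun x => ?_
      rw [← ofReal_norm]
      gcongr
      exact hC x)

variable {g h : ℝ → ℂ} (hg : IsBddMeasurable g) (hh : IsBddMeasurable h)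

theorem op_apply (ψ : 𝓗) : E.op g hg ψ = E.apply g hg.measurable ψ := rfl

theorem op_add_apply (ψ : 𝓗) :
    E.op (fun x => g x + h x) (hg.add hh) ψ = E.op g hg ψ + E.op h hh ψ :=
  E.apply_add hg.measurable hh.measurable (hg.memLp _) (hh.memLp _)

theorem op_sub_apply (ψ : 𝓗) :
    E.op (fun x => g x - h x) (hg.sub hh) ψ = E.op g hg ψ - E.op h hh ψ :=
  E.apply_sub hg.measurable hh.measurable (hg.memLp _) (hh.memLp _)

theorem op_const_mul_apply (c : ℂ) (ψ : 𝓗) :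
    E.op (fun x => c * g x) (hg.const_mul c) ψ = c • E.op g hg ψ :=
  E.apply_const_mul hg.measurable c (hg.memLp _)

theorem op_op (ψ : 𝓗) : E.op g hg (E.op h hh ψ) = E.op (fun x => g x * h x) (hg.mul hh) ψ :=
  E.apply_apply hh.measurable hg.measurable (hh.memLp _) ((hg.mul hh).memLp _)

theorem inner_op_left (φ ψ : 𝓗) :
    ⟪E.op g hg φ, ψ⟫_ℂ = ⟪φ, E.op (fun x => conj (g x)) hg.conjugate ψ⟫_ℂ :=
  E.inner_apply_left hg.measurable (hg.memLp _) (hg.memLp _)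

theorem enorm_op_sq (ψ : 𝓗) : ‖E.op g hg ψ‖ₑ ^ 2 = ∫⁻ x, ‖g x‖ₑ ^ 2 ∂(E.scalarMeasure ψ) :=
  E.enorm_apply_sq hg.measurable (hg.memLp _)

theorem op_congr_ae {ψ : 𝓗} (hgh : g =ᵐ[E.scalarMeasure ψ] h) : E.op g hg ψ = E.op h hh ψ :=
  E.apply_congr hg.measurable hh.measurable (hg.memLp _) hgh

theorem proj_eq_op {B : Set ℝ} (hB : MeasurableSet B) (ψ : 𝓗) :
    E.proj B ψ = E.op (B.indicator 1) ((IsBddMeasurable.const 1).indicator hB) ψ :=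
  E.proj_eq_apply hB ψ

theorem op_one (ψ : 𝓗) : E.op (fun _ => 1) (IsBddMeasurable.const 1) ψ = ψ := by
  have := E.proj_eq_op MeasurableSet.univ ψ
  rw [E.proj_univ] at this
  simp only [Set.indicator_univ] at this
  exact this.symm

/-- Dominated convergence in `L²(μ_ψ)`, the measure being finite. It is what makes commutation
relations stable under bounded pointwise limits. -/
theorem tendsto_op (G : ℕ → ℝ → ℂ) (hG : ∀ n, IsBddMeasurable (G n)) (C : ℝ)
    (hC : ∀ n x, ‖G n x‖ ≤ C) (hlim : ∀ x, Tendsto (fun n => G n x) atTop (𝓝 (g x))) (ψ : 𝓗) :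
    Tendsto (fun n => E.op (G n) (hG n) ψ) atTop (𝓝 (E.op g hg ψ)) := by
  obtain ⟨D, hD⟩ := hg.bdd
  rw [tendsto_iff_norm_sub_tendsto_zero, ← tendsto_zero_iff_norm_tendsto_zero,
    tendsto_zero_iff_enorm_tendsto_zero]
  have h1 : Tendsto (fun n => ∫⁻ x, ‖G n x - g x‖ₑ ^ 2 ∂(E.scalarMeasure ψ)) atTop
      (𝓝 (∫⁻ _, 0 ∂(E.scalarMeasure ψ))) := by
    refine tendsto_lintegral_of_dominated_convergence (fun _ => ENNReal.ofReal (C + D) ^ 2)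
      (fun n => ((hG n).measurable.sub hg.measurable).enorm.pow_const 2)
      (fun n => Eventually.of_forall fun x => ?_) ?_ (Eventually.of_forall fun x => ?_)
    · simp only [← ofReal_norm]
      gcongr
      exact (norm_sub_le _ _).trans (add_le_add (hC n x) (hD x))
    · simp [ENNReal.mul_eq_top]
    · have := ENNReal.Tendsto.pow (n := 2) ((hlim x).sub_const (g x)).enorm
      simpa using this
  have h2 := h1.ennrpow_const (1 / 2)
  simp only [lintegral_zero] at h2
  rw [ENNReal.zero_rpow_of_pos (by norm_num)] at h2
  refine h2.congr fun n => ?_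
  rw [← E.enorm_op_sq ((hG n).sub hg), ← E.op_sub_apply (hG n) hg, ← ENNReal.rpow_natCast,
    ← ENNReal.rpow_mul]
  norm_num

/-- If `f g` is bounded, then `(∫ g dE) ψ` is in the domain of `∫ f dE`. -/
theorem op_mem_domain {f : ℝ → ℂ} (hf : Measurable f)
    (hfg : IsBddMeasurable fun x => f x * g x) (ψ : 𝓗) :
    E.op g hg ψ ∈ (E.integral f hf).domain :=
  (E.memLp_apply_iff hg.measurable hf (hg.memLp _)).2 (hfg.memLp _)

theorem apply_op {f : ℝ → ℂ} (hf : Measurable f)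
    (hfg : IsBddMeasurable fun x => f x * g x) (ψ : 𝓗) :
    E.apply f hf (E.op g hg ψ) = E.op (fun x => f x * g x) hfg ψ :=
  E.apply_apply hg.measurable hf (hg.memLp _) (hfg.memLp _)

/-! ### Self-adjointness -/

section SelfAdjoint

variable {f : ℝ → ℝ}

theorem tendsto_proj_cutoff (hf : Measurable f) (ψ : 𝓗) :
    Tendsto (fun n : ℕ => E.proj {x | |f x| ≤ n} ψ) atTop (𝓝 ψ) := by
  have hB : ∀ n : ℕ, MeasurableSet {x | |f x| ≤ n} := fun n =>
    measurableSet_le hf.abs measurable_const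
  have h := E.tendsto_op (IsBddMeasurable.const 1) (fun n : ℕ => {x | |f x| ≤ n}.indicator 1)
    (fun n => (IsBddMeasurable.const 1).indicator (hB n)) 1 (fun n x => by
      by_cases hx : x ∈ {x | |f x| ≤ n} <;> simp [hx]) (fun x => by
      obtain ⟨N, hN⟩ := exists_nat_ge |f x|
      refine tendsto_const_nhds.congr' ?_
      filter_upwards [eventually_ge_atTop N] with n hn
      have : x ∈ {x | |f x| ≤ n} := hN.trans (by exact_mod_cast hn)
      simp [this]) ψ
  rw [E.op_one] at h
  exact h.congr fun n => (E.proj_eq_op (hB n) ψ).symm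

theorem isBddMeasurable_cutoff (hf : Measurable f) (n : ℕ) :
    IsBddMeasurable fun x => (f x : ℂ) * {x | |f x| ≤ n}.indicator (1 : ℝ → ℂ) x := by
  refine ⟨(Complex.measurable_ofReal.comp hf).mul
    (measurable_one.indicator (measurableSet_le hf.abs measurable_const)), n, fun x => ?_⟩
  by_cases hx : |f x| ≤ n <;> simp [Set.indicator, hx]

theorem proj_cutoff_mem_domain (hf : Measurable f) (n : ℕ) (ψ : 𝓗) :
    E.proj {x | |f x| ≤ n} ψ ∈
      (E.integral (fun x => (f x : ℂ)) (Complex.measurable_ofReal.comp hf)).domain := by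
  rw [E.proj_eq_op (measurableSet_le hf.abs measurable_const)]
  exact E.op_mem_domain _ _ (isBddMeasurable_cutoff hf n) ψ

theorem dense_integral_domain (hf : Measurable f) :
    Dense ((E.integral (fun x => (f x : ℂ)) (Complex.measurable_ofReal.comp hf)).domain : Set 𝓗) :=
  fun ψ => mem_closure_of_tendsto (E.tendsto_proj_cutoff hf ψ)
    (Eventually.of_forall fun n => E.proj_cutoff_mem_domain hf n ψ)

theorem isFormalAdjoint_integral (hf : Measurable f) :
    (E.integral (fun x => (f x : ℂ)) (Complex.measurable_ofReal.comp hf)).IsFormalAdjoint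
      (E.integral (fun x => (f x : ℂ)) (Complex.measurable_ofReal.comp hf)) := fun φ ψ => by
  rw [integral_apply, integral_apply, E.inner_apply_left _ φ.2 ψ.2]
  simp only [Complex.conj_ofReal]

/-- `∫ f dE` is self-adjoint for a real Borel function `f`. -/
theorem isSelfAdjoint_integral (hf : Measurable f) :
    IsSelfAdjoint (E.integral (fun x => (f x : ℂ)) (Complex.measurable_ofReal.comp hf)) := by
  set A := E.integral (fun x => (f x : ℂ)) (Complex.measurable_ofReal.comp hf) with hA
  have hd : Dense (A.domain : Set 𝓗) := E.dense_integral_domain hf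
  have hle := (E.isFormalAdjoint_integral hf).le_adjoint hd
  have hB : ∀ n : ℕ, MeasurableSet {x | |f x| ≤ n} := fun n =>
    measurableSet_le hf.abs measurable_const
  refine (LinearPMap.eq_of_le_of_domain_eq hle (le_antisymm hle.1 fun φ hφ => ?_)).symm
  let η := LinearPMap.adjoint A ⟨φ, hφ⟩
  -- Testing the adjoint relation against cut-off vectors identifies the truncated operator at `φ`
  -- with a projection of `η`. Its norm is thus bounded by that of `η`, uniformly in `n`, and
  -- monotone convergence puts `f` in `L²(μ_φ)`.
  have h1 : ∀ n : ℕ, E.op _ (isBddMeasurable_cutoff hf n) φ = E.proj {x | |f x| ≤ n} η := fun n => by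
    refine ext_inner_right ℂ fun ξ => ?_
    have h2 := LinearPMap.adjoint_isFormalAdjoint hd ⟨φ, hφ⟩
      ⟨_, E.proj_cutoff_mem_domain hf n ξ⟩
    rw [E.inner_proj_left, h2, E.inner_op_left, integral_apply]
    simp only [E.proj_eq_op (hB n)]
    rw [E.apply_op _ _ (isBddMeasurable_cutoff hf n)]
    congr 3
    ext x
    by_cases hx : |f x| ≤ n <;> simp [Set.indicator, hx]
  have h2 : ∀ n : ℕ, ∫⁻ x in {x | |f x| ≤ n}, ‖(f x : ℂ)‖ₑ ^ 2 ∂(E.scalarMeasure φ)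
      ≤ E.scalarMeasure η Set.univ := fun n => by
    refine le_trans (le_of_eq ?_) (measure_mono (Set.subset_univ {x | |f x| ≤ n}))
    rw [E.scalarMeasure_apply' _ (hB n), ← h1 n, enorm_op_sq, ← lintegral_indicator (hB n)]
    refine lintegral_congr fun x => ?_
    by_cases hx : |f x| ≤ n <;> simp [Set.indicator, hx]
  have h3 : ∫⁻ x, ‖(f x : ℂ)‖ₑ ^ 2 ∂(E.scalarMeasure φ) ≤ E.scalarMeasure η Set.univ := by
    have hU : (⋃ n : ℕ, {x | |f x| ≤ n}) = Set.univ := by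
      ext x
      simpa using exists_nat_ge |f x|
    have hmono : Monotone fun n : ℕ => {x | |f x| ≤ n} := fun m n hmn x hx =>
      le_trans (α := ℝ) hx (by exact_mod_cast hmn)
    rw [← setLIntegral_univ, ← hU, setLIntegral_iUnion_of_directed _ hmono.directed_le, hU]
    exact iSup_le h2
  refine ⟨(Complex.measurable_ofReal.comp hf).aestronglyMeasurable, ?_⟩
  have h4 := eLpNorm_nnreal_pow_eq_lintegral (f := fun x => (f x : ℂ)) (μ := E.scalarMeasure φ)
    (p := 2) (by norm_num)
  have h5 : eLpNorm (fun x => (f x : ℂ)) 2 (E.scalarMeasure φ) ^ 2 < ⊤ := by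
    have h6 : eLpNorm (fun x => (f x : ℂ)) 2 (E.scalarMeasure φ) ^ 2
        = ∫⁻ x, ‖(f x : ℂ)‖ₑ ^ 2 ∂(E.scalarMeasure φ) := by simpa using h4
    rw [h6]
    exact h3.trans_lt (measure_lt_top _ _)
  simpa using h5

end SelfAdjoint

end ProjectionValuedMeasure

end

/-! ### From exponentials to compactly supported `C¹` functions. -/

section

/-! ### Approximation of `C¹` functions by trigonometric polynomials -/

section Trigonometric

/-- A relation between functions and their derivatives that is closed under linear combinations and
bounded pointwise limits and holds for all exponentials. -/
structure IsExpClosed (P : (ℝ → ℂ) → (ℝ → ℂ) → Prop) : Prop where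
  exp : ∀ t : ℝ, P (fun x => Complex.exp (-(Complex.I * t * x)))
    (fun x => -(Complex.I * t) * Complex.exp (-(Complex.I * t * x)))
  add : ∀ g k g' k', P g k → P g' k' → P (fun x => g x + g' x) (fun x => k x + k' x)
  const_mul : ∀ (c : ℂ) g k, P g k → P (fun x => c * g x) (fun x => c * k x)
  lim : ∀ (G K : ℕ → ℝ → ℂ) (g k : ℝ → ℂ) (C : ℝ), (∀ n, P (G n) (K n)) →
    (∀ n x, ‖G n x‖ ≤ C ∧ ‖K n x‖ ≤ C) → (∀ x, Tendsto (fun n => G n x) atTop (𝓝 (g x))) →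
    (∀ x, Tendsto (fun n => K n x) atTop (𝓝 (k x))) → P g k

variable {P : (ℝ → ℂ) → (ℝ → ℂ) → Prop}

theorem IsExpClosed.const (hP : IsExpClosed P) (c : ℂ) : P (fun _ => c) (fun _ => 0) := by
  simpa using hP.const_mul c _ _ (hP.exp 0)

/-- A trigonometric polynomial has, up to its mean value, a trigonometric polynomial as primitive. -/
theorem IsExpClosed.exists_primitive (hP : IsExpClosed P) {p : ℝ} [hp : Fact (0 < p)] (a : ℝ)
    (q : C(AddCircle p, ℂ)) (hq : q ∈ Submodule.span ℂ (Set.range (@fourier p))) :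
    ∃ (F : ℝ → ℂ) (c : ℂ), Function.Periodic F p ∧ F a = 0 ∧
      (∀ x : ℝ, HasDerivAt F (q x - c) x) ∧ P F (fun x => q x - c) := by
  induction hq using Submodule.span_induction with
  | mem q hq =>
    obtain ⟨n, rfl⟩ := hq
    by_cases hn : n = 0
    · subst hn
      refine ⟨fun _ => 0, 1, fun _ => rfl, rfl, fun x => ?_, ?_⟩
      · simpa using hasDerivAt_const x (0 : ℂ)
      · simpa using hP.const 0
    · have hp0 : (p : ℂ) ≠ 0 := by exact_mod_cast hp.out.ne'
      have hw : 2 * Real.pi * Complex.I * n / p ≠ (0 : ℂ) := by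
        simp [hn, hp0, Real.pi_ne_zero]
      set w : ℂ := 2 * Real.pi * Complex.I * n / p with hw_def
      refine ⟨fun x => w⁻¹ * (fourier n (x : AddCircle p) - fourier n (a : AddCircle p)), 0,
        fun x => by simp, by simp, fun x => ?_, ?_⟩
      · have := ((hasDerivAt_fourier p n x).sub_const (fourier n (a : AddCircle p))).const_mul w⁻¹
        rw [← hw_def, ← mul_assoc, inv_mul_cancel₀ hw, one_mul] at this
        simpa using this
      -- The parameter is chosen so that the exponential is the `n`-th Fourier character of period
      -- `p`.
      · have h1 := hP.exp (-(2 * Real.pi * n / p))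
        have h2 : ∀ x : ℝ, Complex.exp (-(Complex.I * ((-(2 * Real.pi * n / p) : ℝ) : ℂ) * x))
            = fourier n (x : AddCircle p) := fun x => by
          rw [fourier_coe_apply]
          congr 1
          push_cast
          ring
        have h3 : -(Complex.I * ((-(2 * Real.pi * n / p) : ℝ) : ℂ)) = w := by
          rw [hw_def]; push_cast; ring
        simp only [h2, h3] at h1
        have h4 := hP.const_mul w⁻¹ _ _ (hP.add _ _ _ _ h1 (hP.const (-fourier n (a : AddCircle p))))
        simpa [hw, sub_eq_add_neg] using h4
  | zero =>
    refine ⟨fun _ => 0, 0, fun _ => rfl, rfl, fun x => ?_, ?_⟩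
    · simpa using hasDerivAt_const x (0 : ℂ)
    · simpa using hP.const 0
  | add q r _ _ hq hr =>
    obtain ⟨F, c, h1, h2, h3, h4⟩ := hq
    obtain ⟨F', c', h1', h2', h3', h4'⟩ := hr
    have h5 : ∀ x : ℝ, (q + r) (x : AddCircle p) - (c + c') = (q x - c) + (r x - c') := fun x => by
      simp only [ContinuousMap.add_apply]; ring
    refine ⟨fun x => F x + F' x, c + c', fun x => by simp [h1 x, h1' x], by simp [h2, h2'],
      fun x => ?_, ?_⟩
    · rw [h5]; exact (h3 x).add (h3' x)
    · simp only [h5]; exact hP.add _ _ _ _ h4 h4'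
  | smul z q _ hq =>
    obtain ⟨F, c, h1, h2, h3, h4⟩ := hq
    have h5 : ∀ x : ℝ, (z • q) (x : AddCircle p) - z * c = z * (q x - c) := fun x => by
      simp only [ContinuousMap.smul_apply, smul_eq_mul]; ring
    refine ⟨fun x => z * F x, z * c, fun x => by simp [h1 x], by simp [h2], fun x => ?_, ?_⟩
    · rw [h5]; exact (h3 x).const_mul z
    · simp only [h5]; exact hP.const_mul _ _ _ h4

/-- Approximate the derivative, not the function: periodise `k` with period `2R`, take a uniformly
close trigonometric polynomial `q`, and integrate `q` minus its mean. The mean is small because `g`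
vanishes at both ends, so `k` has integral zero. -/
theorem IsExpClosed.exists_approx (hP : IsExpClosed P) {g k : ℝ → ℂ}
    (hg : ∀ x, HasDerivAt g (k x) x) (hk : Continuous k) {R : ℝ} (hR : 0 < R)
    (hgR : ∀ x, R ≤ |x| → g x = 0 ∧ k x = 0) {M : ℝ} (hM : ∀ x, ‖g x‖ ≤ M ∧ ‖k x‖ ≤ M)
    {ε : ℝ} (hε : 0 < ε) :
    ∃ G Q : ℝ → ℂ, P G Q ∧ (∀ x, |x| < R → ‖G x - g x‖ ≤ ε ∧ ‖Q x - k x‖ ≤ ε) ∧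
      ∀ x, ‖G x‖ ≤ M + ε ∧ ‖Q x‖ ≤ M + ε := by
  have hp : Fact (0 < 2 * R) := ⟨by linarith⟩
  set p := 2 * R with hp_def
  have hap : -R + p = R := by rw [hp_def]; ring
  -- The factor `2` pays for two errors, that of `q` and that of its mean `c`; the factor `p`
  -- appears when they are integrated over a period.
  obtain ⟨δ, hδ, hδε, hδp⟩ : ∃ δ > 0, 2 * δ ≤ ε ∧ 2 * δ * p ≤ ε := by
    refine ⟨min (ε / 2) (ε / (2 * p)), lt_min (by linarith) (by have := hp.out; positivity), ?_, ?_⟩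
    · have := min_le_left (ε / 2) (ε / (2 * p)); linarith
    · have h1 := min_le_right (ε / 2) (ε / (2 * p))
      have h2 := hp.out
      calc 2 * min (ε / 2) (ε / (2 * p)) * p ≤ 2 * (ε / (2 * p)) * p := by gcongr
        _ = ε := by field_simp
  have hk0 : k (-R) = 0 ∧ k R = 0 ∧ g (-R) = 0 ∧ g R = 0 :=
    ⟨(hgR _ (by rw [abs_neg, abs_of_pos hR])).2, (hgR _ (le_abs_self R)).2,
      (hgR _ (by rw [abs_neg, abs_of_pos hR])).1, (hgR _ (le_abs_self R)).1⟩
  let kp : C(AddCircle p, ℂ) := ⟨AddCircle.liftIco p (-R) k,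
    AddCircle.liftIco_continuous (by rw [hap, hk0.1, hk0.2.1]) hk.continuousOn⟩
  have hkp : ∀ x ∈ Set.Ico (-R) (-R + p), kp x = k x := fun x hx =>
    AddCircle.liftIco_coe_apply hx
  have hmem : kp ∈ (Submodule.span ℂ (Set.range (@fourier p))).topologicalClosure := by
    rw [span_fourier_closure_eq_top]; trivial
  obtain ⟨q, hq, hqk⟩ := Metric.mem_closure_iff.1 hmem δ hδ
  obtain ⟨F, c, hF1, hF2, hF3, hF4⟩ := hP.exists_primitive (-R) q hq
  have hqk' : ∀ x ∈ Set.Ico (-R) (-R + p), ‖q x - k x‖ ≤ δ := fun x hx => by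
    rw [← hkp x hx, ← dist_eq_norm, dist_comm]
    exact (ContinuousMap.dist_apply_le_dist _).trans hqk.le
  have hD : ∀ x ∈ Set.Icc (-R) (-R + p), ‖F x - g x + c * (x + R)‖ ≤ δ * (x + R) := fun x hx => by
    have h1 : ∀ y ∈ Set.Icc (-R) (-R + p), HasDerivWithinAt (fun y : ℝ => F y - g y + c * (y + R))
        (q y - k y) (Set.Icc (-R) (-R + p)) y := fun y _ => by
      have h2 : HasDerivAt (fun y : ℝ => c * ((y : ℂ) + R)) c y := by
        simpa using ((Complex.ofRealCLM.hasDerivAt (x := y)).add_const (R : ℂ)).const_mul c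
      have h3 := (((hF3 y).sub (hg y)).add h2).hasDerivWithinAt (s := Set.Icc (-R) (-R + p))
      refine h3.congr_deriv (by ring)
    have h2 := norm_image_sub_le_of_norm_deriv_le_segment' h1 hqk' x hx
    simpa [hF2, hk0] using h2
  -- At the right end point both `F` and `g` vanish, so the estimate `hD` bounds `c` alone.
  have hc : ‖c‖ ≤ δ := by
    have h1 := hD R ⟨by linarith, by rw [hap]⟩
    have h2 : F R = 0 := by rw [← hap, hF1, hF2]
    rw [h2, hk0.2.2.2, sub_zero, zero_add, norm_mul] at h1
    have h3 : ‖(R : ℂ) + R‖ = R + R := by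
      rw [← Complex.ofReal_add, Complex.norm_real, Real.norm_of_nonneg (by linarith)]
    rw [h3] at h1
    exact le_of_mul_le_mul_right h1 (by linarith)
  have hmain : ∀ x ∈ Set.Ico (-R) (-R + p), ‖F x - g x‖ ≤ ε ∧ ‖(q x - c) - k x‖ ≤ ε := by
    intro x hx
    have hx1 : 0 ≤ x + R := by linarith [hx.1]
    have hx2 : x + R ≤ p := by linarith [hx.2]
    constructor
    · have h1 := hD x (Set.Ico_subset_Icc_self hx)
      have h2 : ‖c * ((x : ℂ) + R)‖ ≤ δ * (x + R) := by
        rw [norm_mul, ← Complex.ofReal_add, Complex.norm_real, Real.norm_of_nonneg hx1]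
        gcongr
      have h3 := norm_sub_le (F x - g x + c * (x + R)) (c * ((x : ℂ) + R))
      rw [add_sub_cancel_right] at h3
      nlinarith
    · have h1 : (q x - c) - k x = (q x - k x) - c := by ring
      rw [h1]
      have := norm_sub_le (q x - k x) c
      linarith [hqk' x hx]
  have hmain' : ∀ x ∈ Set.Ico (-R) (-R + p), ‖F x‖ ≤ M + ε ∧ ‖q x - c‖ ≤ M + ε := by
    intro x hx
    have h1 := norm_add_le (g x) (F x - g x)
    have h2 := norm_add_le (k x) ((q x - c) - k x)
    rw [add_sub_cancel] at h1 h2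
    exact ⟨by linarith [(hM x).1, (hmain x hx).1], by linarith [(hM x).2, (hmain x hx).2]⟩
  refine ⟨F, fun x => q x - c, hF4, fun x hx => hmain x ?_, fun x => ?_⟩
  · rw [abs_lt] at hx
    exact ⟨hx.1.le, by rw [hap]; exact hx.2⟩
  -- Outside the window the approximation is false, but periodicity still carries over the bound.
  · have hper : Function.Periodic (fun x : ℝ => (F x, q (x : AddCircle p))) p := fun x => by
      simp [hF1 x]
    obtain ⟨y, hy, hxy⟩ := hper.exists_mem_Ico hp.out x (-R)
    simp only [Prod.mk.injEq] at hxy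
    change ‖F x‖ ≤ _ ∧ ‖q x - c‖ ≤ _
    rw [hxy.1, hxy.2]
    exact hmain' y hy

/-- Approximate on the windows of radius `R + n` with error `1/(n+1)`. Every point eventually lies
in the window and the bounds are uniform, so closure under bounded pointwise limits applies. -/
theorem IsExpClosed.of_hasCompactSupport (hP : IsExpClosed P) {g : ℝ → ℂ} (hg : ContDiff ℝ 1 g)
    (hc : HasCompactSupport g) : P g (deriv g) := by
  have hd : ∀ x, HasDerivAt g (deriv g x) x := fun x =>
    (hg.differentiable (by norm_num) x).hasDerivAt
  have hk : Continuous (deriv g) := hg.continuous_deriv le_rfl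
  obtain ⟨M₁, hM₁⟩ := hc.exists_bound_of_continuous hg.continuous
  obtain ⟨M₂, hM₂⟩ := hc.deriv.exists_bound_of_continuous hk
  obtain ⟨R, hR0, hR⟩ : ∃ R > 0, ∀ x : ℝ, R ≤ |x| → g x = 0 ∧ deriv g x = 0 := by
    obtain ⟨R, hR⟩ := hc.isCompact.isBounded.subset_closedBall (0 : ℝ)
    refine ⟨max R 0 + 1, by positivity, fun x hx => ?_⟩
    have hx' : x ∉ tsupport g := fun h => by
      have := hR h
      rw [Metric.mem_closedBall, dist_zero_right, Real.norm_eq_abs] at this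
      linarith [le_max_left R 0]
    refine ⟨image_eq_zero_of_notMem_tsupport hx', ?_⟩
    have := support_deriv_subset (f := g)
    by_contra h
    exact hx' (this h)
  have key : ∀ n : ℕ, ∃ G Q : ℝ → ℂ, P G Q ∧ (∀ x, |x| < R + n → ‖G x - g x‖ ≤ 1 / ((n : ℝ) + 1) ∧
      ‖Q x - deriv g x‖ ≤ 1 / ((n : ℝ) + 1)) ∧
      ∀ x, ‖G x‖ ≤ max M₁ M₂ + 1 / ((n : ℝ) + 1) ∧ ‖Q x‖ ≤ max M₁ M₂ + 1 / ((n : ℝ) + 1) := fun n =>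
    hP.exists_approx hd hk (by positivity)
      (fun x hx => hR x (le_trans (by simp) hx))
      (fun x => ⟨(hM₁ x).trans (le_max_left _ _), (hM₂ x).trans (le_max_right _ _)⟩) (by positivity)
  choose G Q h1 h2 h3 using key
  have h4 : ∀ n : ℕ, 1 / ((n : ℝ) + 1) ≤ 1 := fun n => by
    rw [div_le_one (by positivity)]; simp
  have h5 : ∀ x : ℝ, ∀ᶠ n : ℕ in atTop, |x| < R + n := fun x => by
    obtain ⟨N, hN⟩ := exists_nat_gt |x|
    filter_upwards [eventually_ge_atTop N] with n hn
    have : (N : ℝ) ≤ n := by exact_mod_cast hn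
    linarith
  refine hP.lim G Q g (deriv g) (max M₁ M₂ + 1) h1
    (fun n x => ⟨(h3 n x).1.trans (by linarith [h4 n]), (h3 n x).2.trans (by linarith [h4 n])⟩)
    (fun x => ?_) (fun x => ?_)
  · rw [tendsto_iff_norm_sub_tendsto_zero]
    refine squeeze_zero' (Eventually.of_forall fun _ => norm_nonneg _) ?_
      tendsto_one_div_add_atTop_nhds_zero_nat
    filter_upwards [h5 x] with n hn using (h2 n x hn).1
  · rw [tendsto_iff_norm_sub_tendsto_zero]
    refine squeeze_zero' (Eventually.of_forall fun _ => norm_nonneg _) ?_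
      tendsto_one_div_add_atTop_nhds_zero_nat
    filter_upwards [h5 x] with n hn using (h2 n x hn).2

end Trigonometric

end

/-! ### From the weak Weyl relation to an operator conjugate to `f(H)`. -/

section

/-! ### Linear algebra of densely defined symmetric families -/

section LinearAlgebra

variable {𝓗 : Type*} [NormedAddCommGroup 𝓗] [InnerProductSpace ℂ 𝓗]

/-- An algebraic extension without continuity; it allows linear computations without carrying domain
proofs in the terms. -/
theorem exists_linearMap_extension (A : 𝓗 →ₗ.[ℂ] 𝓗) :
    ∃ A' : 𝓗 →ₗ[ℂ] 𝓗, ∀ ψ : A.domain, A' ψ = A ψ := by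
  obtain ⟨A', hA'⟩ := A.toFun.exists_extend
  exact ⟨A', fun ψ => LinearMap.congr_fun hA' ψ⟩

/-- A symmetric assignment on a total family extends to a linear map. -/
theorem exists_linearMap_of_symmetric {ι : Type*} (v s : ι → 𝓗)
    (hsym : ∀ i j, ⟪s i, v j⟫_ℂ = ⟪v i, s j⟫_ℂ)
    (hd : Dense (Submodule.span ℂ (Set.range v) : Set 𝓗)) :
    ∃ S : 𝓗 →ₗ[ℂ] 𝓗, ∀ i, S (v i) = s i := by
  let Lv := Finsupp.linearCombination ℂ v
  let Ls := Finsupp.linearCombination ℂ s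
  have hinner : ∀ c j, ⟪Ls c, v j⟫_ℂ = ⟪Lv c, s j⟫_ℂ := fun c j => by
    simp only [Lv, Ls, Finsupp.linearCombination_apply, Finsupp.sum, sum_inner, inner_smul_left,
      hsym]
  -- Well-definedness: if a combination of the `v i` vanishes, symmetry makes the same combination
  -- of the `s i` orthogonal to every `v j`, hence zero by density.
  have hker : ∀ c, Lv c = 0 → Ls c = 0 := fun c hc => by
    refine hd.eq_zero_of_inner_left (𝕜 := ℂ) fun x hx => ?_
    induction hx using Submodule.span_induction with
    | mem x hx =>
      obtain ⟨j, rfl⟩ := hx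
      rw [hinner, hc, inner_zero_left]
    | zero => simp
    | add x y _ _ hx hy => rw [inner_add_right, hx, hy, add_zero]
    | smul c x _ hx => rw [inner_smul_right, hx, mul_zero]
  obtain ⟨r, hr⟩ := Lv.rangeRestrict.exists_rightInverse_of_surjective Lv.range_rangeRestrict
  obtain ⟨S, hS⟩ := (Ls ∘ₗ r).exists_extend
  refine ⟨S, fun i => ?_⟩
  have hv : Lv (Finsupp.single i 1) = v i := by simp [Lv]
  have hs : Ls (Finsupp.single i 1) = s i := by simp [Ls]
  let y := Lv.rangeRestrict (Finsupp.single i 1)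
  have hy : (y : 𝓗) = v i := hv
  have h1 : S y = Ls (r y) := LinearMap.congr_fun hS y
  have h2 : Lv (r y) = y := congrArg Subtype.val (LinearMap.congr_fun hr y)
  have h3 : Ls (r y - Finsupp.single i 1) = 0 := hker _ (by rw [map_sub, h2, hv, hy, sub_self])
  rw [← hy, h1, ← hs, ← sub_eq_zero, ← map_sub, h3]

end LinearAlgebra

/-! ### Test functions with compact support in an open set -/

/-- `Cⁿ` functions with compact support contained in `U`. -/
structure IsTest (n : ℕ) (U : Set ℝ) (g : ℝ → ℂ) : Prop where
  contDiff : ContDiff ℝ n g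
  hasCompactSupport : HasCompactSupport g
  tsupport_subset : tsupport g ⊆ U

namespace IsTest

open ProjectionValuedMeasure

variable {n : ℕ} {U : Set ℝ} {g h : ℝ → ℂ}

theorem isBddMeasurable (hg : IsTest n U g) : IsBddMeasurable g :=
  ⟨hg.contDiff.continuous.measurable,
    hg.hasCompactSupport.exists_bound_of_continuous hg.contDiff.continuous⟩

theorem eq_zero (hg : IsTest n U g) {x : ℝ} (hx : x ∉ U) : g x = 0 :=
  image_eq_zero_of_notMem_tsupport fun h => hx (hg.tsupport_subset h)

theorem add (hg : IsTest n U g) (hh : IsTest n U h) : IsTest n U fun x => g x + h x :=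
  ⟨hg.contDiff.add hh.contDiff, hg.hasCompactSupport.add hh.hasCompactSupport,
    (tsupport_add g h).trans (Set.union_subset hg.tsupport_subset hh.tsupport_subset)⟩

/-- The multiplier need only be smooth on `U`: off `U` the product vanishes near every point, since
the support of `g` is closed and contained in `U`. This is how `f` and `1/f'` enter. -/
theorem mul_left (hg : IsTest n U g) (hU : IsOpen U) {w : ℝ → ℂ} (hw : ContDiffOn ℝ n w U) :
    IsTest n U fun x => w x * g x := by
  have hsub : tsupport (fun x => w x * g x) ⊆ tsupport g :=
    closure_mono (Function.support_mul_subset_right w g)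
  refine ⟨contDiff_iff_contDiffAt.2 fun x => ?_, hg.hasCompactSupport.mul_left,
    hsub.trans hg.tsupport_subset⟩
  by_cases hx : x ∈ U
  · exact (hw.contDiffAt (hU.mem_nhds hx)).mul hg.contDiff.contDiffAt
  · have h0 : (fun x => w x * g x) =ᶠ[𝓝 x] fun _ => 0 := by
      filter_upwards [(isClosed_tsupport g).isOpen_compl.mem_nhds
        (fun h => hx (hg.tsupport_subset h) : x ∈ (tsupport g)ᶜ)] with y hy
      rw [image_eq_zero_of_notMem_tsupport hy, mul_zero]
    exact contDiffAt_const.congr_of_eventuallyEq h0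

theorem conjugate (hg : IsTest n U g) : IsTest n U fun x => conj (g x) := by
  have hs : Function.support (fun x => conj (g x)) = Function.support g := by
    ext x; simp
  have hts : tsupport (fun x => conj (g x)) = tsupport g := congrArg closure hs
  exact ⟨Complex.conjCLE.contDiff.comp hg.contDiff, by
    rw [HasCompactSupport, hts]; exact hg.hasCompactSupport, by
    rw [hts]; exact hg.tsupport_subset⟩

theorem zero_of_one (hg : IsTest 1 U g) : IsTest 0 U g :=
  ⟨hg.contDiff.of_le (by norm_num), hg.hasCompactSupport, hg.tsupport_subset⟩

theorem deriv (hg : IsTest 1 U g) : IsTest 0 U (deriv g) :=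
  ⟨contDiff_zero.2 (hg.contDiff.continuous_deriv le_rfl), hg.hasCompactSupport.deriv,
    tsupport_deriv_subset.trans hg.tsupport_subset⟩

theorem hasDerivAt (hg : IsTest 1 U g) (x : ℝ) : HasDerivAt g (_root_.deriv g x) x :=
  (hg.contDiff.differentiable (by norm_num) x).hasDerivAt

end IsTest

/-! ### Weak Weyl relation -/

namespace ProjectionValuedMeasure

variable {𝓗 : Type*} [NormedAddCommGroup 𝓗] [InnerProductSpace ℂ 𝓗] [CompleteSpace 𝓗]
variable (E : ProjectionValuedMeasure 𝓗) (T : 𝓗 →ₗ.[ℂ] 𝓗)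

theorem isBddMeasurable_exp (t : ℝ) :
    IsBddMeasurable fun x : ℝ => Complex.exp (-(Complex.I * t * x)) := by
  refine ⟨by fun_prop, 1, fun x => le_of_eq ?_⟩
  rw [show -(Complex.I * t * x) = ((-(t * x) : ℝ) : ℂ) * Complex.I by push_cast; ring]
  exact Complex.norm_exp_ofReal_mul_I _

/-- `T` is symmetric and obeys the weak Weyl relation with the unitary group `∫ e^{-itx} dE(x)`. -/
structure IsWeakWeyl : Prop where
  isSymmetric : IsSymmetricOperator T
  weakWeyl : ∀ (t : ℝ) (ψ : T.domain), ∃ h : E.op _ (isBddMeasurable_exp t) (ψ : 𝓗) ∈ T.domain,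
    T ⟨E.op _ (isBddMeasurable_exp t) (ψ : 𝓗), h⟩
      = E.op _ (isBddMeasurable_exp t) (T ψ + (t : ℂ) • (ψ : 𝓗))

/-- The commutation relation `[T, ∫ g dE] = i ∫ k dE` in the sense of forms on `D(T)`. -/
def HasCommutator (g k : ℝ → ℂ) : Prop :=
  ∃ (hg : IsBddMeasurable g) (hk : IsBddMeasurable k), ∀ φ ψ : T.domain,
    ⟪T φ, E.op g hg ψ⟫_ℂ - ⟪(φ : 𝓗), E.op g hg (T ψ)⟫_ℂ = Complex.I * ⟪(φ : 𝓗), E.op k hk ψ⟫_ℂ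

variable {E T}

/-- For exponentials the commutator is the weak Weyl relation combined with symmetry of `T`. Because
it is stated in form sense, with `T` only on fixed vectors, limits need no closedness of `T`. -/
theorem IsWeakWeyl.isExpClosed (hT : E.IsWeakWeyl T) : IsExpClosed (E.HasCommutator T) where
  exp t := by
    refine ⟨isBddMeasurable_exp t, (isBddMeasurable_exp t).const_mul _, fun φ ψ => ?_⟩
    obtain ⟨h1, h2⟩ := hT.weakWeyl t ψ
    have h3 := hT.isSymmetric.2 φ ⟨_, h1⟩
    rw [h2, map_add, map_smul, inner_add_right, inner_smul_right] at h3
    rw [h3, op_const_mul_apply _ (isBddMeasurable_exp t), inner_smul_right]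
    linear_combination ((t : ℂ) * ⟪(φ : 𝓗), E.op _ (isBddMeasurable_exp t) (ψ : 𝓗)⟫_ℂ)
      * Complex.I_mul_I
  add g k g' k' := by
    rintro ⟨hg, hk, h⟩ ⟨hg', hk', h'⟩
    refine ⟨hg.add hg', hk.add hk', fun φ ψ => ?_⟩
    simp only [op_add_apply _ hg hg', op_add_apply _ hk hk', inner_add_right]
    linear_combination h φ ψ + h' φ ψ
  const_mul c g k := by
    rintro ⟨hg, hk, h⟩
    refine ⟨hg.const_mul c, hk.const_mul c, fun φ ψ => ?_⟩
    simp only [op_const_mul_apply _ hg, op_const_mul_apply _ hk, inner_smul_right]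
    linear_combination c * h φ ψ
  lim G K g k C h hC hG hK := by
    choose hg hk h using h
    have hg' : IsBddMeasurable g :=
      ⟨measurable_of_tendsto_metrizable (fun n => (hg n).measurable) (tendsto_pi_nhds.2 hG), C,
        fun x => le_of_tendsto (hG x).norm (Eventually.of_forall fun n => (hC n x).1)⟩
    have hk' : IsBddMeasurable k :=
      ⟨measurable_of_tendsto_metrizable (fun n => (hk n).measurable) (tendsto_pi_nhds.2 hK), C,
        fun x => le_of_tendsto (hK x).norm (Eventually.of_forall fun n => (hC n x).2)⟩
    refine ⟨hg', hk', fun φ ψ => ?_⟩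
    have lG := fun χ => E.tendsto_op hg' G hg C (fun n x => (hC n x).1) hG χ
    have lK := fun χ => E.tendsto_op hk' K hk C (fun n x => (hC n x).2) hK χ
    refine tendsto_nhds_unique ((tendsto_const_nhds.inner (lG ψ)).sub
      (tendsto_const_nhds.inner (lG (T ψ)))) ?_
    simp only [h]
    exact (tendsto_const_nhds.inner (lK ψ)).const_mul _

theorem IsWeakWeyl.inner_op (hT : E.IsWeakWeyl T) {U : Set ℝ} {g : ℝ → ℂ} (hg : IsTest 1 U g)
    (φ ψ : T.domain) :
    ⟪T φ, E.op g hg.isBddMeasurable ψ⟫_ℂ = ⟪(φ : 𝓗), E.op g hg.isBddMeasurable (T ψ)⟫_ℂ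
      + Complex.I * ⟪(φ : 𝓗), E.op (deriv g) hg.deriv.isBddMeasurable ψ⟫_ℂ := by
  obtain ⟨_, _, h⟩ := hT.isExpClosed.of_hasCompactSupport hg.contDiff hg.hasCompactSupport
  rw [← h φ ψ, add_sub_cancel]

theorem op_congr {g h : ℝ → ℂ} (hg : IsBddMeasurable g) (hh : IsBddMeasurable h)
    (hgh : ∀ x, g x = h x) : E.op g hg = E.op h hh := by
  obtain rfl : g = h := funext hgh
  rfl

theorem inner_op_op {g h m : ℝ → ℂ} (hg : IsBddMeasurable g) (hh : IsBddMeasurable h)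
    (hm : IsBddMeasurable m) (hghm : ∀ x, conj (g x) * h x = m x) (φ ψ : 𝓗) :
    ⟪E.op g hg φ, E.op h hh ψ⟫_ℂ = ⟪φ, E.op m hm ψ⟫_ℂ := by
  rw [inner_op_left, op_op, op_congr (hg.conjugate.mul hh) hm hghm]

/-- If the scalar measures do not charge the complement of `U`, then the vectors `(∫ g dE) ψ` with a
test function `g` on `U` and `ψ` in a dense set span a dense subspace. -/
theorem dense_span_op {U : Set ℝ} (hU : IsOpen U) (hE : ∀ ψ, E.scalarMeasure ψ Uᶜ = 0)
    {D : Submodule ℂ 𝓗} (hD : Dense (D : Set 𝓗)) :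
    Dense (Submodule.span ℂ (Set.range fun i : {g // IsTest 1 U g} × D =>
      E.op i.1.1 i.1.2.isBddMeasurable i.2) : Set 𝓗) := by
  rw [Submodule.dense_iff_topologicalClosure_eq_top, Submodule.topologicalClosure_eq_top_iff,
    Submodule.eq_bot_iff]
  intro χ hχ
  -- Orthogonality is used for the conjugate of `g`, again a test function, and moved onto `χ`. Bump
  -- functions then show that `μ_χ` has no mass near any point of `U`.
  have h1 : ∀ g, ∀ hg : IsTest 1 U g, E.op g hg.isBddMeasurable χ = 0 := fun g hg => by
    refine hD.eq_zero_of_inner_right (𝕜 := ℂ) fun ψ hψ => ?_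
    have h2 := (Submodule.mem_orthogonal _ _).1 hχ _ (Submodule.subset_span
      ⟨(⟨_, hg.conjugate⟩, ⟨ψ, hψ⟩), rfl⟩)
    simp only [inner_op_left, Complex.conj_conj] at h2
    exact h2
  have h2 : E.scalarMeasure χ U = 0 := by
    refine measure_null_of_locally_null U fun x hx => ?_
    obtain ⟨r, hr, hrU⟩ := Metric.isOpen_iff.1 hU x hx
    let ρ : ContDiffBump x := ⟨r / 4, r / 2, by positivity, by linarith⟩
    have hts : tsupport (fun y => ((ρ y : ℝ) : ℂ)) = tsupport ρ := by
      refine congrArg closure ?_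
      ext y; simp
    have hg : IsTest 1 U fun y => ((ρ y : ℝ) : ℂ) := by
      refine ⟨Complex.ofRealCLM.contDiff.comp ρ.contDiff, ?_, ?_⟩
      · rw [HasCompactSupport, hts]; exact ρ.hasCompactSupport
      · rw [hts, ρ.tsupport_eq]
        refine (Metric.closedBall_subset_ball ?_).trans hrU
        change r / 2 < r
        linarith
    have h3 := E.enorm_op_sq hg.isBddMeasurable χ
    rw [h1 _ hg, enorm_zero, zero_pow two_ne_zero] at h3
    refine ⟨Metric.closedBall x (r / 4), mem_nhdsWithin_of_mem_nhds
      (Metric.closedBall_mem_nhds x (by positivity)), ?_⟩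
    refine le_antisymm ?_ zero_le
    rw [h3, ← setLIntegral_one]
    refine (lintegral_mono_ae ?_).trans (setLIntegral_le_lintegral (Metric.closedBall x (r / 4)) _)
    filter_upwards [ae_restrict_mem measurableSet_closedBall] with y hy
    rw [ρ.one_of_mem_closedBall hy]
    simp
  have h3 : E.scalarMeasure χ Set.univ = 0 := by
    rw [← Set.union_compl_self U]
    exact measure_union_null h2 (hE χ)
  rw [E.scalarMeasure_apply' χ MeasurableSet.univ, E.proj_univ] at h3
  simpa using h3

/-- If `T` is a symmetric operator that obeys the weak Weyl relation, and `f` is continuously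
differentiable on `U` with derivative `1 / u`, then the symmetrised product of `T` and `u` is
canonically conjugate to `∫ f dE`. -/
theorem IsWeakWeyl.exists_conjugate (hT : E.IsWeakWeyl T) {U : Set ℝ} (hU : IsOpen U)
    (hE : ∀ ψ, E.scalarMeasure ψ Uᶜ = 0) {f u : ℝ → ℝ} (hfm : Measurable f)
    (hf : ContDiffOn ℝ 1 f U) (hu : ContDiffOn ℝ 1 u U) (hfu : ∀ x ∈ U, u x * deriv f x = 1) :
    ∃ (𝓔 : Submodule ℂ 𝓗) (S : 𝓗 →ₗ[ℂ] 𝓗), Dense (𝓔 : Set 𝓗) ∧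
      (∀ φ ∈ 𝓔, φ ∈ (E.integral (fun x => (f x : ℂ)) (Complex.measurable_ofReal.comp hfm)).domain) ∧
      (∀ φ ∈ 𝓔, E.apply (fun x => (f x : ℂ)) (Complex.measurable_ofReal.comp hfm) φ ∈ 𝓔) ∧
      (∀ φ ∈ 𝓔, ∀ ψ ∈ 𝓔, ⟪S φ, ψ⟫_ℂ = ⟪φ, S ψ⟫_ℂ) ∧
      (∀ φ ∈ 𝓔, ∀ ψ ∈ 𝓔, ⟪S (E.apply (fun x => (f x : ℂ)) (Complex.measurable_ofReal.comp hfm) φ), ψ⟫_ℂ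
        - conj ⟪S (E.apply (fun x => (f x : ℂ)) (Complex.measurable_ofReal.comp hfm) ψ), φ⟫_ℂ
        = -Complex.I * ⟪φ, ψ⟫_ℂ) := by
  have hfC : ContDiffOn ℝ 1 (fun x => (f x : ℂ)) U := Complex.ofRealCLM.contDiff.comp_contDiffOn hf
  have huC : ContDiffOn ℝ 1 (fun x => (u x : ℂ)) U := Complex.ofRealCLM.contDiff.comp_contDiffOn hu
  have huC' : ContDiffOn ℝ 0 (fun x => ((deriv u x : ℝ) : ℂ) / 2) U := by
    have h1 := hu.continuousOn_deriv_of_isOpen hU le_rfl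
    exact contDiffOn_zero.2 ((Complex.continuous_ofReal.comp_continuousOn h1).div_const 2)
  have hdf : ∀ x ∈ U, HasDerivAt (fun x => (f x : ℂ)) ((deriv f x : ℝ) : ℂ) x := fun x hx =>
    ((hf.differentiableOn (by norm_num) x hx).differentiableAt (hU.mem_nhds hx)).hasDerivAt.ofReal_comp
  have hdu : ∀ x ∈ U, HasDerivAt (fun x => (u x : ℂ)) ((deriv u x : ℝ) : ℂ) x := fun x hx =>
    ((hu.differentiableOn (by norm_num) x hx).differentiableAt (hU.mem_nhds hx)).hasDerivAt.ofReal_comp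
  have ha : ∀ {g}, IsTest 1 U g → IsTest 1 U fun x => (u x : ℂ) * g x := fun hg => hg.mul_left hU huC
  have hb : ∀ {g}, IsTest 1 U g →
      IsTest 0 U fun x => (u x : ℂ) * deriv g x + ((deriv u x : ℝ) : ℂ) / 2 * g x := fun hg =>
    (hg.deriv.mul_left hU (huC.of_le (by norm_num))).add (hg.zero_of_one.mul_left hU huC')
  have hfg : ∀ {g}, IsTest 1 U g → IsTest 1 U fun x => (f x : ℂ) * g x := fun hg => hg.mul_left hU hfC
  let v : {g // IsTest 1 U g} × T.domain → 𝓗 := fun i => E.op i.1.1 i.1.2.isBddMeasurable i.2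
  -- This is formally `(T u + u T)/2` applied to `g(H)ψ`, with `T` commuted to the right by `[T, g]
  -- = i g'`; averaging `(u g)'` and `u g'` leaves `u g' + u' g / 2`.
  let s : {g // IsTest 1 U g} × T.domain → 𝓗 := fun i =>
    E.op _ (ha i.1.2).isBddMeasurable (T i.2)
      + Complex.I • E.op _ (hb i.1.2).isBddMeasurable (i.2 : 𝓗)
  have hd : Dense (Submodule.span ℂ (Set.range v) : Set 𝓗) := dense_span_op hU hE hT.isSymmetric.1
  have hsym : ∀ i j, ⟪s i, v j⟫_ℂ = ⟪v i, s j⟫_ℂ := by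
    rintro ⟨⟨g, hg⟩, ψ⟩ ⟨⟨k, hk⟩, χ⟩
    -- Symmetry is the commutator relation for the single test function `ḡ u k`: the two halves of
    -- `u'` make its derivative the sum of the first-order terms from both sides.
    have hm : IsTest 1 U fun x => conj (g x) * ((u x : ℂ) * k x) :=
      (ha hk).mul_left hU hg.conjugate.contDiff.contDiffOn
    have hc₁ := (hb hg).conjugate.isBddMeasurable.mul hk.isBddMeasurable
    have hc₂ := hg.conjugate.isBddMeasurable.mul (hb hk).isBddMeasurable
    have hdm : ∀ x, deriv (fun x => conj (g x) * ((u x : ℂ) * k x)) x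
        = conj ((u x : ℂ) * deriv g x + ((deriv u x : ℝ) : ℂ) / 2 * g x) * k x
          + conj (g x) * ((u x : ℂ) * deriv k x + ((deriv u x : ℝ) : ℂ) / 2 * k x) := fun x => by
      by_cases hx : x ∈ U
      · have h1 : HasDerivAt (fun x => conj (g x)) (conj (deriv g x)) x :=
          (hg.hasDerivAt x).star
        rw [(h1.fun_mul ((hdu x hx).fun_mul (hk.hasDerivAt x))).deriv]
        simp only [map_add, map_mul, map_div₀, Complex.conj_ofReal, map_ofNat]
        ring
      · rw [hm.deriv.eq_zero hx, hk.eq_zero hx, hg.eq_zero hx]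
        simp
    simp only [s, v]
    rw [inner_add_left, inner_add_right, inner_smul_left, inner_smul_right,
      inner_op_op _ _ hm.isBddMeasurable
        (fun x => by simp only [map_mul, Complex.conj_ofReal]; ring),
      inner_op_op _ _ hc₁ (fun x => rfl), inner_op_op _ _ hm.isBddMeasurable (fun x => rfl),
      inner_op_op _ _ hc₂ (fun x => rfl), hT.inner_op hm,
      op_congr hm.deriv.isBddMeasurable (hc₁.add hc₂) hdm, op_add_apply _ hc₁ hc₂, inner_add_right,
      Complex.conj_I]
    ring
  obtain ⟨S, hS⟩ := exists_linearMap_of_symmetric v s hsym hd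
  set 𝓔 := Submodule.span ℂ (Set.range v) with h𝓔
  set A := E.integral (fun x => (f x : ℂ)) (Complex.measurable_ofReal.comp hfm) with hA
  obtain ⟨A', hA'⟩ := exists_linearMap_extension A
  have hAop : ∀ {g} (hg : IsBddMeasurable g) (hfg : IsBddMeasurable fun x => (f x : ℂ) * g x) ψ,
      A' (E.op g hg ψ) = E.op _ hfg ψ := fun hg hfg ψ => by
    rw [← E.apply_op (f := fun x => (f x : ℂ)) hg (Complex.measurable_ofReal.comp hfm) hfg]
    exact hA' ⟨_, E.op_mem_domain hg _ hfg ψ⟩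
  -- In the commutator all terms cancel except `u f' g`, which equals `g` on `U`; off `U` both sides
  -- vanish. Here `S (v i)` is only shown to lie in the domain of `A`, not in `𝓔`.
  have hdom : ∀ i, v i ∈ A.domain ∧ A' (v i) ∈ 𝓔 ∧ S (v i) ∈ A.domain ∧
      S (A' (v i)) = A' (S (v i)) + Complex.I • v i := by
    rintro ⟨⟨g, hg⟩, ψ⟩
    have h1 : A' (v (⟨g, hg⟩, ψ)) = v (⟨_, hfg hg⟩, ψ) := hAop _ _ _
    have hfb : IsTest 0 U fun x => (f x : ℂ)
        * ((u x : ℂ) * deriv g x + ((deriv u x : ℝ) : ℂ) / 2 * g x) :=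
      (hb hg).mul_left hU (hfC.of_le (by norm_num))
    refine ⟨E.op_mem_domain _ _ (hfg hg).isBddMeasurable _, ?_, ?_, ?_⟩
    · rw [h1]; exact Submodule.subset_span ⟨_, rfl⟩
    · rw [hS]
      exact A.domain.add_mem (E.op_mem_domain _ _ (hfg (ha hg)).isBddMeasurable _)
        (A.domain.smul_mem _ (E.op_mem_domain _ _ hfb.isBddMeasurable _))
    · rw [h1, hS, hS]
      simp only [s, v, map_add, map_smul]
      rw [hAop _ (hfg (ha hg)).isBddMeasurable, hAop _ hfb.isBddMeasurable, add_assoc, ← smul_add,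
        ← op_add_apply]
      congr 2
      · exact op_congr _ _ fun x => by ring
      · refine congrArg (fun B : 𝓗 →L[ℂ] 𝓗 => B ψ) (op_congr _ _ fun x => ?_)
        by_cases hx : x ∈ U
        · rw [((hdf x hx).fun_mul (hg.hasDerivAt x)).deriv]
          have h2 : (u x : ℂ) * ((deriv f x : ℝ) : ℂ) = 1 := by exact_mod_cast hfu x hx
          linear_combination g x * h2
        · rw [(hfg hg).deriv.eq_zero hx, hg.deriv.eq_zero hx, hg.eq_zero hx]
          simp
  have hspan : ∀ φ ∈ 𝓔, φ ∈ A.domain ∧ A' φ ∈ 𝓔 ∧ S φ ∈ A.domain ∧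
      S (A' φ) = A' (S φ) + Complex.I • φ := fun φ hφ => by
    induction hφ using Submodule.span_induction with
    | mem x hx => obtain ⟨i, rfl⟩ := hx; exact hdom i
    | zero => simp
    | add x y _ _ hx hy =>
      refine ⟨A.domain.add_mem hx.1 hy.1, ?_, ?_, ?_⟩
      · rw [map_add]; exact 𝓔.add_mem hx.2.1 hy.2.1
      · rw [map_add]; exact A.domain.add_mem hx.2.2.1 hy.2.2.1
      · rw [map_add, map_add, hx.2.2.2, hy.2.2.2, map_add, map_add, smul_add]; abel
    | smul c x _ hx =>
      refine ⟨A.domain.smul_mem c hx.1, ?_, ?_, ?_⟩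
      · rw [map_smul]; exact 𝓔.smul_mem c hx.2.1
      · rw [map_smul]; exact A.domain.smul_mem c hx.2.2.1
      · rw [map_smul, map_smul, hx.2.2.2, map_smul, map_smul, smul_add, smul_comm c]
  have hsymS : ∀ φ ∈ 𝓔, ∀ ψ ∈ 𝓔, ⟪S φ, ψ⟫_ℂ = ⟪φ, S ψ⟫_ℂ := fun φ hφ ψ hψ => by
    induction hφ using Submodule.span_induction with
    | mem x hx =>
      obtain ⟨i, rfl⟩ := hx
      induction hψ using Submodule.span_induction with
      | mem y hy => obtain ⟨j, rfl⟩ := hy; rw [hS, hS, hsym]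
      | zero => simp
      | add y z _ _ hy hz => rw [map_add, inner_add_right, inner_add_right, hy, hz]
      | smul c y _ hy => rw [map_smul, inner_smul_right, inner_smul_right, hy]
    | zero => simp
    | add x y _ _ hx hy => rw [map_add, inner_add_left, inner_add_left, hx, hy]
    | smul c x _ hx => rw [map_smul, inner_smul_left, inner_smul_left, hx]
  have hAE : ∀ φ ∈ 𝓔, E.apply (fun x => (f x : ℂ)) (Complex.measurable_ofReal.comp hfm) φ = A' φ := fun φ hφ =>
    (hA' ⟨φ, (hspan φ hφ).1⟩).symm
  refine ⟨𝓔, S, hd, fun φ hφ => (hspan φ hφ).1, fun φ hφ => ?_, hsymS, fun φ hφ ψ hψ => ?_⟩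
  · rw [hAE φ hφ]; exact (hspan φ hφ).2.1
  -- The second term becomes `⟪A S φ, ψ⟫`, by symmetry of `S` on `𝓔` and then of `A`; what remains
  -- is `⟪i φ, ψ⟫ = -i ⟪φ, ψ⟫`.
  · rw [hAE φ hφ, hAE ψ hψ, inner_conj_symm, ← hsymS φ hφ _ (hspan ψ hψ).2.1,
      (hspan φ hφ).2.2.2, inner_add_left, inner_smul_left]
    have h1 := E.isFormalAdjoint_integral hfm ⟨_, (hspan φ hφ).2.2.1⟩ ⟨ψ, (hspan ψ hψ).1⟩
    rw [← hA' ⟨_, (hspan φ hφ).2.2.1⟩, ← hA' ⟨ψ, (hspan ψ hψ).1⟩] at h1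
    rw [h1, Complex.conj_I]
    ring

end ProjectionValuedMeasure

end

/-! ### Restriction to invariant subspaces, and uniqueness of the unitary group. -/

section

namespace ProjectionValuedMeasure

variable {𝓗 : Type*} [NormedAddCommGroup 𝓗] [InnerProductSpace ℂ 𝓗] [CompleteSpace 𝓗]
variable (E : ProjectionValuedMeasure 𝓗)

/-! ### Restriction to an invariant subspace -/

section Restrict

variable (K : Submodule ℂ 𝓗) [CompleteSpace K] (hK : ∀ B, ∀ ψ ∈ K, E.proj B ψ ∈ K)

/-- The restriction of a projection-valued measure to a closed invariant subspace. -/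
def restrict : ProjectionValuedMeasure K where
  proj B := ((E.proj B).comp K.subtypeL).codRestrict K fun ψ => hK B ψ ψ.2
  isStarProjection B := by
    refine ⟨?_, ?_⟩
    · ext ψ
      have := congrArg (fun T : 𝓗 →L[ℂ] 𝓗 => T ψ) (E.isStarProjection B).isIdempotentElem.eq
      exact this
    · rw [ContinuousLinearMap.isSelfAdjoint_iff_isSymmetric]
      intro φ ψ
      exact E.inner_proj_left B φ ψ
  proj_of_not_measurable B hB := by
    ext ψ
    simp [E.proj_of_not_measurable B hB]
  proj_empty := by ext ψ; simp [E.proj_empty]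
  proj_univ := by ext ψ; simp [E.proj_univ]
  proj_inter B C hB hC := by ext ψ; exact (E.proj_proj hB hC ψ).symm
  hasSum_iUnion B hB hd ψ := by
    rw [HasSum, tendsto_subtype_rng]
    refine Tendsto.congr (fun s => ?_) (E.hasSum_iUnion B hB hd ψ)
    rw [Submodule.coe_sum]
    rfl

theorem coe_restrict_proj (B : Set ℝ) (ψ : K) :
    (((E.restrict K hK).proj B ψ : K) : 𝓗) = E.proj B ψ := rfl

theorem restrict_scalarMeasure (ψ : K) :
    (E.restrict K hK).scalarMeasure ψ = E.scalarMeasure (ψ : 𝓗) := by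
  ext B hB
  rw [scalarMeasure_apply _ _ hB, scalarMeasure_apply _ _ hB]
  rfl

theorem coe_restrict_apply {f : ℝ → ℂ} (hf : Measurable f) {ψ : K}
    (h : MemLp f 2 (E.scalarMeasure (ψ : 𝓗))) :
    (((E.restrict K hK).apply f hf ψ : K) : 𝓗) = E.apply f hf ψ := by
  have h1 := (E.restrict K hK).tendsto_apply f hf ψ (by rwa [restrict_scalarMeasure])
  refine tendsto_nhds_unique (((continuous_subtype_val).tendsto _).comp h1) ?_
  refine (E.tendsto_apply f hf ψ h).congr fun n => ?_
  simp [simpleIntegral, sum_apply, coe_restrict_proj]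

/-- The extra domain condition in `part` is automatic: the vector `(∫ f dE)ψ` is computed inside the
closed subspace `K`. -/
theorem restrict_integral {f : ℝ → ℂ} (hf : Measurable f) :
    (E.restrict K hK).integral f hf = part (E.integral f hf) K := by
  refine LinearPMap.ext (Submodule.ext fun ψ => ?_) fun ψ h1 h2 => ?_
  · rw [mem_integral_domain, restrict_scalarMeasure]
    refine ⟨fun h => ⟨h, ?_⟩, fun ⟨h, _⟩ => h⟩
    rw [integral_apply, ← E.coe_restrict_apply K hK hf h]
    exact Subtype.mem _
  · refine Subtype.ext ?_
    exact E.coe_restrict_apply K hK hf (by rwa [mem_integral_domain, restrict_scalarMeasure] at h1)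

end Restrict

/-! ### The unitary group determines and is determined by the generator -/

-- The filter is general so that difference quotients over a punctured neighbourhood of `0` are
-- covered, and the dominating function may be unbounded.
variable {E} in
theorem tendsto_apply_of_dominated {ι : Type*} {l : Filter ι} [l.IsCountablyGenerated]
    {g b : ℝ → ℂ} (hg : Measurable g) {ψ : 𝓗} (hb : MemLp b 2 (E.scalarMeasure ψ))
    {G : ι → ℝ → ℂ} (hG : ∀ n, Measurable (G n)) (hGb : ∀ n x, ‖G n x‖ ≤ ‖b x‖)
    (hgb : ∀ x, ‖g x‖ ≤ ‖b x‖) (hlim : ∀ x, Tendsto (fun n => G n x) l (𝓝 (g x))) :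
    Tendsto (fun n => E.apply (G n) (hG n) ψ) l (𝓝 (E.apply g hg ψ)) := by
  have hG' : ∀ n, MemLp (G n) 2 (E.scalarMeasure ψ) := fun n =>
    hb.mono (hG n).aestronglyMeasurable (Eventually.of_forall (hGb n))
  have hg' : MemLp g 2 (E.scalarMeasure ψ) :=
    hb.mono hg.aestronglyMeasurable (Eventually.of_forall hgb)
  rw [tendsto_iff_norm_sub_tendsto_zero, ← tendsto_zero_iff_norm_tendsto_zero,
    tendsto_zero_iff_enorm_tendsto_zero]
  have h0 : ∫⁻ x, (2 * ‖b x‖ₑ) ^ 2 ∂(E.scalarMeasure ψ) ≠ ⊤ := by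
    have h1 := eLpNorm_nnreal_pow_eq_lintegral (f := fun x => 2 * b x) (μ := E.scalarMeasure ψ)
      (p := 2) (by norm_num)
    have h2 : ∀ x, ‖2 * b x‖ₑ = 2 * ‖b x‖ₑ := fun x => by
      rw [enorm_mul, ← ofReal_norm]; simp
    simp only [h2] at h1
    have h3 : eLpNorm (fun x => 2 * b x) 2 (E.scalarMeasure ψ) ^ 2
        = ∫⁻ x, (2 * ‖b x‖ₑ) ^ 2 ∂(E.scalarMeasure ψ) := by simpa using h1
    rw [← h3]
    exact ENNReal.pow_ne_top (hb.const_mul 2).2.ne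
  have h1 : Tendsto (fun n => ∫⁻ x, ‖G n x - g x‖ₑ ^ 2 ∂(E.scalarMeasure ψ)) l
      (𝓝 (∫⁻ _, 0 ∂(E.scalarMeasure ψ))) := by
    refine tendsto_lintegral_filter_of_dominated_convergence (fun x => (2 * ‖b x‖ₑ) ^ 2)
      (Eventually.of_forall fun n => ((hG n).sub hg).enorm.pow_const 2)
      (Eventually.of_forall fun n => Eventually.of_forall fun x => ?_) h0
      (Eventually.of_forall fun x => ?_)
    · gcongr
      calc ‖G n x - g x‖ₑ ≤ ‖G n x‖ₑ + ‖g x‖ₑ := enorm_sub_le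
        _ ≤ ‖b x‖ₑ + ‖b x‖ₑ := by
          gcongr
          · exact enorm_le_iff_norm_le.2 (hGb n x)
          · exact enorm_le_iff_norm_le.2 (hgb x)
        _ = 2 * ‖b x‖ₑ := (two_mul _).symm
    · have := ENNReal.Tendsto.pow (n := 2) ((hlim x).sub_const (g x)).enorm
      simpa using this
  have h2 := h1.ennrpow_const (1 / 2)
  simp only [lintegral_zero] at h2
  rw [ENNReal.zero_rpow_of_pos (by norm_num)] at h2
  refine h2.congr fun n => ?_
  rw [← E.apply_sub (hG n) hg (hG' n) hg', ← E.enorm_apply_sq (f := fun x => G n x - g x)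
    ((hG n).sub hg) ((hG' n).sub hg'), ← ENNReal.rpow_natCast, ← ENNReal.rpow_mul]
  norm_num

/-- The unitary operator `∫ e^{-itx} dE(x)`. -/
def expOp (t : ℝ) : 𝓗 →L[ℂ] 𝓗 := E.op _ (isBddMeasurable_exp t)

theorem expOp_add_apply (s t : ℝ) (ψ : 𝓗) : E.expOp s (E.expOp t ψ) = E.expOp (s + t) ψ := by
  rw [expOp, expOp, op_op, expOp]
  refine congrArg (fun B : 𝓗 →L[ℂ] 𝓗 => B ψ) (op_congr _ _ fun x => ?_)
  rw [← Complex.exp_add]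
  push_cast
  ring_nf

theorem expOp_zero (ψ : 𝓗) : E.expOp 0 ψ = ψ := by
  conv_rhs => rw [← E.op_one ψ]
  exact congrArg (fun B : 𝓗 →L[ℂ] 𝓗 => B ψ) (op_congr _ _ fun x => by simp)

theorem inner_expOp_left (t : ℝ) (φ ψ : 𝓗) : ⟪E.expOp t φ, ψ⟫_ℂ = ⟪φ, E.expOp (-t) ψ⟫_ℂ := by
  rw [expOp, inner_op_left]
  refine congrArg (fun B : 𝓗 →L[ℂ] 𝓗 => ⟪φ, B ψ⟫_ℂ) (op_congr _ _ fun x => ?_)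
  rw [← Complex.exp_conj]
  simp

/-- The operator `∫ x dE(x)`. -/
def generator : 𝓗 →ₗ.[ℂ] 𝓗 := E.integral (fun x => (x : ℂ)) Complex.measurable_ofReal

theorem dense_generator_domain : Dense (E.generator.domain : Set 𝓗) :=
  E.dense_integral_domain measurable_id

theorem generator_symmetric (φ ψ : E.generator.domain) :
    ⟪E.generator φ, (ψ : 𝓗)⟫_ℂ = ⟪(φ : 𝓗), E.generator ψ⟫_ℂ :=
  E.isFormalAdjoint_integral measurable_id φ ψ

theorem norm_exp_mul_sub_one_le (x : ℝ) : ‖Complex.exp (-(Complex.I * x)) - 1‖ ≤ |x| := by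
  have := Real.norm_exp_I_mul_ofReal_sub_one_le (x := -x)
  simpa using this

theorem expOp_mem_domain (t : ℝ) (ψ : E.generator.domain) :
    ∃ h : E.expOp t (ψ : 𝓗) ∈ E.generator.domain,
      E.generator ⟨E.expOp t (ψ : 𝓗), h⟩ = E.expOp t (E.generator ψ) := by
  have hm : Measurable fun x : ℝ => Complex.exp (-(Complex.I * t * x)) := by fun_prop
  have h1 : MemLp (fun x : ℝ => (x : ℂ)) 2 (E.scalarMeasure (ψ : 𝓗)) := ψ.2
  have h2 : MemLp (fun x : ℝ => (x : ℂ) * Complex.exp (-(Complex.I * t * x))) 2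
      (E.scalarMeasure (ψ : 𝓗)) := by
    refine h1.mono (by fun_prop) (Eventually.of_forall fun x => le_of_eq ?_)
    rw [norm_mul, show -(Complex.I * t * x) = ((-(t * x) : ℝ) : ℂ) * Complex.I by push_cast; ring,
      Complex.norm_exp_ofReal_mul_I, mul_one]
  have h3 := (isBddMeasurable_exp t).memLp (E.scalarMeasure (ψ : 𝓗))
  refine ⟨(E.memLp_apply_iff hm Complex.measurable_ofReal h3).2 h2, ?_⟩
  have h4 : MemLp (fun x : ℝ => Complex.exp (-(Complex.I * t * x)) * (x : ℂ)) 2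
      (E.scalarMeasure (ψ : 𝓗)) := by simpa only [mul_comm] using h2
  change E.apply _ _ (E.apply _ _ _) = E.apply _ _ (E.apply _ _ _)
  rw [E.apply_apply hm Complex.measurable_ofReal h3 h2,
    E.apply_apply Complex.measurable_ofReal hm h1 h4]
  simp only [mul_comm]

/-- At `0` the difference quotients of the exponential are dominated by `|x|`, which is in `L²(μ_ψ)`
exactly because `ψ` is in the domain. The group law transports the derivative to `t`. -/
theorem hasDerivAt_expOp (t : ℝ) (ψ : E.generator.domain) :
    HasDerivAt (fun t => E.expOp t (ψ : 𝓗)) (-Complex.I • E.expOp t (E.generator ψ)) t := by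
  have h1 : MemLp (fun x : ℝ => (x : ℂ)) 2 (E.scalarMeasure (ψ : 𝓗)) := ψ.2
  have key : HasDerivAt (fun t => E.expOp t (ψ : 𝓗)) (-Complex.I • E.generator ψ) 0 := by
    rw [hasDerivAt_iff_tendsto_slope_zero]
    have hb := E.apply_const_mul Complex.measurable_ofReal (-Complex.I) h1
    have hlim := tendsto_apply_of_dominated (E := E) (l := 𝓝[≠] (0 : ℝ))
      (g := fun x : ℝ => -Complex.I * x) (by fun_prop) h1
      (G := fun (h x : ℝ) => (h : ℂ)⁻¹ * (Complex.exp (-(Complex.I * h * x)) - 1))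
      (by fun_prop) (fun h x => ?_) (fun x => by simp) (fun x => ?_)
    · rw [hb] at hlim
      refine hlim.congr fun h => ?_
      have h2 := E.apply_const_mul ((isBddMeasurable_exp h).sub (IsBddMeasurable.const 1)).measurable
        (h : ℂ)⁻¹ (((isBddMeasurable_exp h).sub (IsBddMeasurable.const 1)).memLp
          (E.scalarMeasure (ψ : 𝓗)))
      rw [h2, zero_add, expOp_zero, ← Complex.coe_smul, Complex.ofReal_inv]
      congr 1
      have h3 := E.op_sub_apply (isBddMeasurable_exp h) (IsBddMeasurable.const 1) (ψ : 𝓗)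
      rw [op_one] at h3
      exact h3
    · rw [norm_mul, norm_inv, Complex.norm_real, Complex.norm_real]
      by_cases hh : h = 0
      · simp [hh]
      · have h2 := norm_exp_mul_sub_one_le (h * x)
        rw [inv_mul_le_iff₀ (by positivity), Real.norm_eq_abs, Real.norm_eq_abs, ← abs_mul]
        refine le_trans (le_of_eq ?_) h2
        push_cast
        ring_nf
    · have h2 : HasDerivAt (fun h : ℝ => Complex.exp (-(Complex.I * h * x))) (-Complex.I * x) 0 := by
        have h3 : HasDerivAt (fun h : ℝ => -(Complex.I * h * x)) (-Complex.I * x) (0 : ℝ) := by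
          have := (((Complex.ofRealCLM.hasDerivAt (x := (0 : ℝ))).const_mul Complex.I).mul_const
            (x : ℂ)).fun_neg
          simpa using this
        simpa using h3.cexp
      have h3 := hasDerivAt_iff_tendsto_slope_zero.1 h2
      simpa using h3
  have h2 : (fun s => E.expOp s (ψ : 𝓗)) = fun s => E.expOp t (E.expOp (s - t) (ψ : 𝓗)) := by
    ext s
    rw [expOp_add_apply, add_sub_cancel]
  rw [h2]
  have h3 : HasDerivAt (fun s => E.expOp (s - t) (ψ : 𝓗)) (-Complex.I • E.generator ψ) t := by
    exact HasDerivAt.comp_sub_const t t (by rw [sub_self]; exact key)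
  have h4 := ((E.expOp t).restrictScalars ℝ).hasFDerivAt.comp_hasDerivAt t h3
  simpa [Function.comp_def] using h4

/-- A projection-valued measure is determined by its generator, as far as the unitary group is
concerned. -/
theorem expOp_eq_of_generator_eq {F : ProjectionValuedMeasure 𝓗} (h : E.generator = F.generator)
    (t : ℝ) (ψ : 𝓗) : E.expOp t ψ = F.expOp t ψ := by
  have hF : ∀ (t : ℝ) (ψ : E.generator.domain), ∃ h : F.expOp t (ψ : 𝓗) ∈ E.generator.domain,
      E.generator ⟨F.expOp t (ψ : 𝓗), h⟩ = F.expOp t (E.generator ψ) := by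
    rw [h]; exact F.expOp_mem_domain
  have hF' : ∀ (t : ℝ) (ψ : E.generator.domain), HasDerivAt (fun t => F.expOp t (ψ : 𝓗))
      (-Complex.I • F.expOp t (E.generator ψ)) t := by
    rw [h]; exact F.hasDerivAt_expOp
  -- The inner product of the two evolutions has zero derivative, since both groups preserve the
  -- common domain and the common generator is symmetric.
  have key : ∀ φ ψ : E.generator.domain,
      ⟪E.expOp t (φ : 𝓗), F.expOp t (ψ : 𝓗)⟫_ℂ = ⟪(φ : 𝓗), (ψ : 𝓗)⟫_ℂ := fun φ ψ => by
    have h1 : ∀ s : ℝ, HasDerivAt (fun s => ⟪E.expOp s (φ : 𝓗), F.expOp s (ψ : 𝓗)⟫_ℂ) 0 s := fun s => by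
      refine ((E.hasDerivAt_expOp s φ).inner ℂ (hF' s ψ)).congr_deriv ?_
      obtain ⟨h2, h3⟩ := E.expOp_mem_domain s φ
      obtain ⟨h4, h5⟩ := hF s ψ
      have h6 := E.generator_symmetric ⟨_, h2⟩ ⟨_, h4⟩
      rw [h3, h5] at h6
      rw [inner_smul_left, inner_smul_right, h6]
      simp
    have h2 := is_const_of_deriv_eq_zero (fun s => (h1 s).differentiableAt)
      (fun s => (h1 s).deriv) t 0
    simpa [expOp_zero] using h2
  have key2 : ∀ ψ : E.generator.domain, E.expOp t (ψ : 𝓗) = F.expOp t (ψ : 𝓗) := fun ψ => by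
    have h1 : E.expOp (-t) (F.expOp t (ψ : 𝓗)) - ψ = 0 := by
      refine E.dense_generator_domain.eq_zero_of_inner_right (𝕜 := ℂ) fun φ hφ => ?_
      rw [inner_sub_right, ← inner_expOp_left, key ⟨φ, hφ⟩ ψ, sub_self]
    have h2 := congrArg (E.expOp t) (sub_eq_zero.1 h1)
    rw [expOp_add_apply, add_neg_cancel, expOp_zero] at h2
    exact h2.symm
  exact congrFun (Continuous.ext_on E.dense_generator_domain (E.expOp t).continuous
    (F.expOp t).continuous fun ψ hψ => key2 ⟨ψ, hψ⟩) ψ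

end ProjectionValuedMeasure

end

/-! ### Absolutely continuous, singular continuous and point subspaces. -/

section

namespace ProjectionValuedMeasure

variable {𝓗 : Type*} [NormedAddCommGroup 𝓗] [InnerProductSpace ℂ 𝓗] [CompleteSpace 𝓗]
variable (E : ProjectionValuedMeasure 𝓗)

/-! ### The spectral subspaces -/

theorem proj_eq_zero_iff {B : Set ℝ} (hB : MeasurableSet B) (ψ : 𝓗) :
    E.proj B ψ = 0 ↔ E.scalarMeasure ψ B = 0 := by
  rw [E.scalarMeasure_apply' ψ hB]
  simp

theorem eq_zero_of_scalarMeasure_univ {ψ : 𝓗} (h : E.scalarMeasure ψ Set.univ = 0) : ψ = 0 := by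
  rw [← proj_eq_zero_iff _ MeasurableSet.univ, E.proj_univ] at h
  exact h

theorem proj_apply_of_not_measurable {B : Set ℝ} (hB : ¬ MeasurableSet B) (ψ : 𝓗) :
    E.proj B ψ = 0 := by
  rw [E.proj_of_not_measurable B hB]; rfl

theorem proj_mem_acSubspace (B : Set ℝ) (ψ : 𝓗) (hψ : ψ ∈ E.acSubspace) :
    E.proj B ψ ∈ E.acSubspace := by
  by_cases hB : MeasurableSet B
  · change E.scalarMeasure (E.proj B ψ) ≪ volume
    rw [E.scalarMeasure_proj hB]
    exact Measure.restrict_le_self.absolutelyContinuous.trans hψ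
  · rw [E.proj_apply_of_not_measurable hB]
    exact E.acSubspace.zero_mem

theorem mem_scSubspace_of_absolutelyContinuous {φ ψ : 𝓗} (hψ : ψ ∈ E.scSubspace)
    (h : E.scalarMeasure φ ≪ E.scalarMeasure ψ) : φ ∈ E.scSubspace :=
  ⟨hψ.1.mono_ac h Measure.AbsolutelyContinuous.rfl, fun x => h (hψ.2 x)⟩

/-- With `B` a level set of `f`, the range of `E(B)` consists of eigenvectors of `∫ f dE`. It serves
both for `H` at a single point and for `f(H)`. -/
theorem apply_proj_of_eq {f : ℝ → ℂ} (hf : Measurable f) {B : Set ℝ} (hB : MeasurableSet B) {c : ℂ}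
    (hfB : ∀ x ∈ B, f x = c) (ψ : 𝓗) :
    MemLp f 2 (E.scalarMeasure (E.proj B ψ)) ∧ E.apply f hf (E.proj B ψ) = c • E.proj B ψ := by
  have hb : IsBddMeasurable (B.indicator (1 : ℝ → ℂ)) := (IsBddMeasurable.const 1).indicator hB
  have h1 : ∀ x, f x * B.indicator (1 : ℝ → ℂ) x = c * B.indicator (1 : ℝ → ℂ) x := fun x => by
    by_cases hx : x ∈ B
    · rw [hfB x hx]
    · simp [hx]
  have hfb : IsBddMeasurable fun x => f x * B.indicator (1 : ℝ → ℂ) x := by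
    simp only [h1]; exact hb.const_mul c
  rw [E.proj_eq_op hB]
  refine ⟨E.op_mem_domain hb hf hfb ψ, ?_⟩
  rw [E.apply_op hb hf hfb, ← op_const_mul_apply _ hb]
  exact congrArg (fun B : 𝓗 →L[ℂ] 𝓗 => B ψ) (op_congr _ _ h1)

/-- The vectors in the range of `E({x})` are eigenvectors of the generator. -/
theorem proj_singleton_mem_eigenspace (x : ℝ) (ψ : 𝓗) :
    E.proj {x} ψ ∈ eigenspace E.generator (x : ℂ) :=
  have h := E.apply_proj_of_eq (f := fun y : ℝ => (y : ℂ)) (c := x) Complex.measurable_ofReal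
    (measurableSet_singleton x) (fun _ hy => by rw [Set.mem_singleton_iff.1 hy]) ψ
  ⟨h.1, h.2⟩

/-- By the isometry, `(A - x)ψ = 0` says that `y - x` vanishes almost everywhere for `μ_ψ`, so the
measure is concentrated at `x`. -/
theorem proj_singleton_of_mem_eigenspace {x : ℝ} {ψ : 𝓗}
    (h : ψ ∈ eigenspace E.generator (x : ℂ)) : E.proj {x} ψ = ψ := by
  obtain ⟨hd, h⟩ := h
  have hd' : MemLp (fun x : ℝ => (x : ℂ)) 2 (E.scalarMeasure ψ) := hd
  have h1 := E.apply_sub Complex.measurable_ofReal measurable_const hd' (memLp_const (x : ℂ))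
  have h2 := E.apply_const_mul (measurable_const (a := (1 : ℂ))) (x : ℂ) (ψ := ψ) (memLp_const _)
  have h3 : E.apply (fun _ => 1) measurable_const ψ = ψ := E.op_one ψ
  simp only [mul_one] at h2
  rw [h2, h3] at h1
  have h4 : E.apply (fun x : ℝ => (x : ℂ)) Complex.measurable_ofReal ψ = (x : ℂ) • ψ := h
  rw [h4, sub_self, ← enorm_eq_zero, E.enorm_apply (f := fun y : ℝ => (y : ℂ) - x) _
    (hd'.sub (memLp_const _)), eLpNorm_eq_zero_iff (by fun_prop) (by norm_num)] at h1
  have h5 : ({x} : Set ℝ).indicator (1 : ℝ → ℂ) =ᵐ[E.scalarMeasure ψ] fun _ => 1 := by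
    filter_upwards [h1] with y hy
    have : y = x := by
      have := sub_eq_zero.1 hy
      exact_mod_cast this
    simp [this]
  rw [E.proj_eq_op (measurableSet_singleton x), E.op_congr_ae _ (IsBddMeasurable.const 1) h5, op_one]

theorem proj_singleton_ne_zero_iff (x : ℝ) :
    (∃ ψ, E.proj {x} ψ ≠ 0) ↔ (x : ℂ) ∈ pointSpectrum E.generator := by
  constructor
  · rintro ⟨ψ, hψ⟩ h
    exact hψ ((Submodule.eq_bot_iff _).1 h _ (E.proj_singleton_mem_eigenspace x ψ))
  · intro h
    obtain ⟨ψ, hψ, h0⟩ := Submodule.exists_mem_ne_zero_of_ne_bot h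
    exact ⟨ψ, by rwa [E.proj_singleton_of_mem_eigenspace hψ]⟩

theorem norm_op_apply_le {g : ℝ → ℂ} (hg : IsBddMeasurable g) {C : ℝ} (hC : ∀ x, ‖g x‖ ≤ C)
    (ψ : 𝓗) : ‖E.op g hg ψ‖ ≤ C * ‖ψ‖ := by
  have h0 : 0 ≤ C := (norm_nonneg _).trans (hC 0)
  rw [← ENNReal.ofReal_le_ofReal_iff (by positivity), ENNReal.ofReal_mul h0, ofReal_norm,
    ofReal_norm]
  refine (ENNReal.pow_right_strictMono two_ne_zero).le_iff_le.1 ?_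
  rw [E.enorm_op_sq, mul_pow]
  have h1 : ‖ψ‖ₑ ^ 2 = E.scalarMeasure ψ Set.univ := by
    rw [E.scalarMeasure_apply' ψ MeasurableSet.univ, E.proj_univ]; rfl
  rw [h1, ← lintegral_const]
  refine lintegral_mono fun x => ?_
  rw [← ofReal_norm]
  gcongr
  exact hC x

/-- The part of the generator in a non-zero spectral subspace has non-empty spectrum. -/
theorem scSubspace_eq_bot (h : spectrum (part E.generator E.scSubspace) = ∅) :
    E.scSubspace = ⊥ := by
  rw [Submodule.eq_bot_iff]
  intro ψ hψ
  refine E.eq_zero_of_scalarMeasure_univ (measure_null_of_locally_null _ fun x _ => ?_)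
  have hx : (x : ℂ) ∉ spectrum (part E.generator E.scSubspace) := by simp [h]
  obtain ⟨R, -, hR⟩ := Set.notMem_compl_iff.1 hx
  -- On the range of the projection of a ball of radius `ε` about `x`, the norm of `A - x` is at
  -- most `ε`. A left inverse of norm below `1/ε` therefore forces that range to meet the subspace
  -- trivially, and every `μ_ψ` is locally null.
  obtain ⟨ε, hε, hRε⟩ : ∃ ε > 0, ‖R‖ * ε < 1 :=
    ⟨1 / (‖R‖ + 1), by positivity, by
      rw [mul_one_div, div_lt_one (by positivity)]; linarith⟩
  let B := Metric.ball x ε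
  have hB : MeasurableSet B := Metric.isOpen_ball.measurableSet
  refine ⟨B, mem_nhdsWithin_of_mem_nhds (Metric.ball_mem_nhds x hε), ?_⟩
  rw [← E.proj_eq_zero_iff hB]
  set φ := E.proj B ψ with hφ_def
  have hb : IsBddMeasurable (B.indicator (1 : ℝ → ℂ)) := (IsBddMeasurable.const 1).indicator hB
  have hb1 : ∀ y : ℝ, ‖((y : ℂ) - x) * B.indicator (1 : ℝ → ℂ) y‖ ≤ ε := fun y => by
    by_cases hy : y ∈ B
    · rw [Set.indicator_of_mem hy, Pi.one_apply, mul_one, ← Complex.ofReal_sub, Complex.norm_real,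
        ← dist_eq_norm]
      exact (Metric.mem_ball.1 hy).le
    · simp [hy, hε.le]
  have hg : IsBddMeasurable fun y : ℝ => ((y : ℂ) - x) * B.indicator (1 : ℝ → ℂ) y :=
    ⟨(by fun_prop : Measurable fun y : ℝ => (y : ℂ) - x).mul hb.measurable, ε, hb1⟩
  have hxb : IsBddMeasurable fun y : ℝ => (y : ℂ) * B.indicator (1 : ℝ → ℂ) y := by
    have := hg.add (hb.const_mul x)
    simpa [sub_mul] using this
  have hφ : φ = E.op _ hb ψ := E.proj_eq_op hB ψ
  have hφφ : E.op _ hb φ = φ := by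
    rw [← E.proj_eq_op hB, hφ_def, E.proj_proj hB hB, Set.inter_self]
  have hφd : φ ∈ E.generator.domain := by
    rw [hφ]; exact E.op_mem_domain hb Complex.measurable_ofReal hxb ψ
  have hφsc : φ ∈ E.scSubspace := E.mem_scSubspace_of_absolutelyContinuous hψ (by
    rw [hφ_def, E.scalarMeasure_proj hB]; exact Measure.restrict_le_self.absolutelyContinuous)
  have hAφ : E.generator ⟨φ, hφd⟩ ∈ E.scSubspace :=
    E.mem_scSubspace_of_absolutelyContinuous hφsc (by
      change E.scalarMeasure (E.apply _ _ φ) ≪ _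
      rw [E.scalarMeasure_of_apply Complex.measurable_ofReal hφd]
      exact withDensity_absolutelyContinuous _ _)
  have h1 : E.generator ⟨φ, hφd⟩ - (x : ℂ) • φ = E.op _ hg φ := by
    have h2 : E.generator ⟨φ, hφd⟩ = E.op _ hxb φ := by
      conv_rhs => rw [← E.apply_op hb Complex.measurable_ofReal hxb]
      rw [hφφ]
      rfl
    rw [h2]
    conv_lhs => rw [← hφφ]
    rw [op_op]
    have h3 := E.op_sub_apply hxb (hb.const_mul x) φ
    rw [op_const_mul_apply _ hb, hφφ] at h3
    rw [op_congr hg (hxb.sub (hb.const_mul x)) (fun y => by ring), h3]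
    congr 2
    refine op_congr _ _ fun y => ?_
    by_cases hy : y ∈ B <;> simp [hy]
  have h2 := congrArg norm (hR ⟨⟨φ, hφsc⟩, hφd, hAφ⟩)
  have h3 := R.le_opNorm (part E.generator E.scSubspace ⟨⟨φ, hφsc⟩, hφd, hAφ⟩
    - (x : ℂ) • (⟨φ, hφsc⟩ : E.scSubspace))
  have h4 : ‖part E.generator E.scSubspace ⟨⟨φ, hφsc⟩, hφd, hAφ⟩
      - (x : ℂ) • (⟨φ, hφsc⟩ : E.scSubspace)‖ ≤ ε * ‖φ‖ := by
    change ‖E.generator ⟨φ, hφd⟩ - (x : ℂ) • φ‖ ≤ _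
    rw [h1]
    exact E.norm_op_apply_le hg hb1 φ
  rw [h2] at h3
  have h5 : ‖φ‖ ≤ ‖R‖ * (ε * ‖φ‖) := h3.trans (by gcongr)
  by_contra h6
  have h7 : 0 < ‖φ‖ := norm_pos_iff.2 h6
  nlinarith

/-- If there is no singular continuous subspace, then a vector that is orthogonal to the absolutely
continuous subspace and to all eigenvectors vanishes. -/
theorem eq_zero_of_orthogonal (hsc : E.scSubspace = ⊥) {ψ : 𝓗}
    (hac : ∀ φ ∈ E.acSubspace, ⟪φ, ψ⟫_ℂ = 0) (hp : ∀ x : ℝ, E.proj {x} ψ = 0) : ψ = 0 := by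
  set μ := E.scalarMeasure ψ with hμ
  have hs := Measure.mutuallySingular_singularPart μ volume
  -- `N` is null for the singular part and its complement is Lebesgue null. So `E(N)ψ` is absolutely
  -- continuous, and orthogonality gives `μ(N) = ⟪E(N)ψ, ψ⟫ = 0`: the measure of `ψ` is purely
  -- singular.
  set N := hs.nullSet with hN
  have hNm : MeasurableSet N := hs.measurableSet_nullSet
  have h1 : E.proj N ψ ∈ E.acSubspace := by
    change E.scalarMeasure (E.proj N ψ) ≪ volume
    rw [E.scalarMeasure_proj hNm, ← hμ]
    refine Measure.AbsolutelyContinuous.mk fun B hB h0 => ?_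
    rw [Measure.restrict_apply hB, Measure.haveLebesgueDecomposition_add μ volume,
      Measure.add_apply, add_eq_zero]
    refine ⟨measure_mono_null Set.inter_subset_right hs.measure_nullSet, ?_⟩
    exact withDensity_absolutelyContinuous _ _ (measure_mono_null Set.inter_subset_left h0)
  have h2 : μ N = 0 := by
    have h3 := hac _ h1
    rw [inner_proj_left, inner_proj_self] at h3
    rw [hμ, E.scalarMeasure_apply ψ hNm, ENNReal.ofReal_eq_zero]
    exact le_of_eq (by exact_mod_cast h3)
  have h3 : ψ ∈ E.scSubspace :=
    ⟨⟨N, hNm, h2, hs.measure_compl_nullSet⟩, fun x =>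
      (E.proj_eq_zero_iff (measurableSet_singleton x) ψ).1 (hp x)⟩
  rw [hsc] at h3
  exact h3

end ProjectionValuedMeasure

/-- Restricting the spectral measure of `H` to its subspace of absolute continuity. -/
def acMeasure {𝓗 : Type*} [NormedAddCommGroup 𝓗] [InnerProductSpace ℂ 𝓗] [CompleteSpace 𝓗]
    (E : ProjectionValuedMeasure 𝓗) : ProjectionValuedMeasure E.acSubspace :=
  E.restrict E.acSubspace E.proj_mem_acSubspace

variable {𝓗 : Type*} [NormedAddCommGroup 𝓗] [InnerProductSpace ℂ 𝓗] [CompleteSpace 𝓗]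

theorem generator_spectralMeasure {A : 𝓗 →ₗ.[ℂ] 𝓗}
    (h : ∃ E : ProjectionValuedMeasure 𝓗, E.generator = A) : (spectralMeasure A).generator = A := by
  have h' : ∃ E : ProjectionValuedMeasure 𝓗,
    E.integral (fun x => (x : ℂ)) Complex.measurable_ofReal = A := h
  rw [spectralMeasure, dif_pos h']
  exact h'.choose_spec

/-- A strong time operator of `H_ac` obeys the weak Weyl relation with respect to the restriction of
the spectral measure of `H`. -/
theorem IsStrongTimeOperator.isWeakWeyl {H : 𝓗 →ₗ.[ℂ] 𝓗}
    (hH : (spectralMeasure H).generator = H)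
    {T : (spectralMeasure H).acSubspace →ₗ.[ℂ] (spectralMeasure H).acSubspace}
    (hT : IsStrongTimeOperator (acPart H) T) : (acMeasure (spectralMeasure H)).IsWeakWeyl T := by
  have h1 : (acMeasure (spectralMeasure H)).generator = acPart H := by
    rw [ProjectionValuedMeasure.generator, acMeasure, ProjectionValuedMeasure.restrict_integral]
    conv_rhs => rw [acPart]
    have h2 : (spectralMeasure H).integral (fun x => (x : ℂ)) Complex.measurable_ofReal = H := hH
    rw [h2]
  -- `evolution` uses whatever measure was chosen for `acPart H`. It has the same generator as the
  -- restricted measure, which suffices for the exponentials to agree.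
  have h2 : ∀ t ψ, evolution (acPart H) t ψ = (acMeasure (spectralMeasure H)).expOp t ψ := fun t ψ =>
    (ProjectionValuedMeasure.expOp_eq_of_generator_eq _
      (h1.trans (generator_spectralMeasure ⟨_, h1⟩).symm) t ψ).symm
  refine ⟨hT.isSymmetric, fun t ψ => ?_⟩
  have h3 := hT.weakWeyl t ψ
  simp only [h2] at h3
  exact h3

end

/-! ### Conjugate forms on the span of eigenvectors. -/

section

/-! ### Colourings with injective infinite classes -/

/-- If `v : ι → W` is a surjection with finite fibres from a countable set to an infinite set, then
`ι` is partitioned into infinite classes on which `v` is injective. -/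
theorem exists_infinite_injective_classes {ι W : Type*} [Countable ι] [Infinite W] (v : ι → W)
    (hv : Function.Surjective v) (hfin : ∀ w, {j | v j = w}.Finite) :
    ∃ c : ι → ℕ, (∀ i j, c i = c j → v i = v j → i = j) ∧ ∀ i, {j | c j = c i}.Infinite := by
  classical
  have hW : Countable W := hv.countable
  obtain ⟨enc, henc⟩ := exists_injective_nat ι
  obtain ⟨hden⟩ := nonempty_denumerable W
  let e : W ≃ ℕ := Denumerable.eqv W
  obtain ⟨s, hs⟩ := hv.hasRightInverse
  -- One index `s w` is singled out in each fibre; every other index `i` gets the private colour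
  -- `enc i`. The predicate says that colour `a` may be given to `s w` without repeating a colour in
  -- the fibre of `w`.
  let ok : W → ℕ → Prop := fun w a => ∀ r, v r = w → enc r = a → r = s w
  have hok : ∀ w, ∃ a, ok w a := fun w => by
    obtain ⟨a, ha⟩ := ((hfin w).image enc).exists_notMem
    exact ⟨a, fun r hr hra => absurd ⟨r, hr, hra⟩ ha⟩
  -- The preferred colour of `s w` is the first coordinate of `w` under `W ≃ ℕ ≃ ℕ × ℕ`, so each
  -- colour is preferred by infinitely many `w`. Finiteness of fibres provides a substitute when the
  -- preferred one is not allowed.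
  have hk : ∀ w, ∃ a, ok w a ∧ (ok w (e w).unpair.1 → a = (e w).unpair.1) := fun w => by
    by_cases h : ok w (e w).unpair.1
    · exact ⟨_, h, fun _ => rfl⟩
    · obtain ⟨a, ha⟩ := hok w
      exact ⟨a, ha, fun h' => absurd h' h⟩
  choose k hk1 hk2 using hk
  let c : ι → ℕ := fun i => if i = s (v i) then k (v i) else enc i
  have hcs : ∀ w, c (s w) = k w := fun w => by simp [c, hs w]
  have hmix : ∀ i j, i = s (v i) → c i = c j → v i = v j → i = j := fun i j hi hc hvij => by
    by_cases hj : j = s (v j)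
    · rw [hi, hj, hvij]
    · have h1 : c i = k (v i) := by simp only [c]; rw [if_pos hi]
      have h2 : c j = enc j := by simp only [c]; rw [if_neg hj]
      have h3 := hk1 (v i) j hvij.symm (by rw [← h2, ← hc, h1])
      rw [h3, hi, hs]
  refine ⟨c, fun i j hc hvij => ?_, fun i => ?_⟩
  · by_cases hi : i = s (v i)
    · exact hmix i j hi hc hvij
    · by_cases hj : j = s (v j)
      · exact (hmix j i hj hc.symm hvij.symm).symm
      · simp only [c] at hc
        rw [if_neg hi, if_neg hj] at hc
        exact henc hc
  · let g : ℕ → ι := fun b => s (e.symm (Nat.pair (c i) b))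
    have hg : Function.Injective g := fun a b hab => by
      have h1 := congrArg v hab
      rw [hs, hs] at h1
      exact (Nat.pair_eq_pair.1 (e.symm.injective h1)).2
    -- Only one index has a given code, so a colour is refused in at most one of the fibres that
    -- prefer it; infinitely many accept it.
    have hbad : {b | ¬ ok (e.symm (Nat.pair (c i) b)) (c i)}.Subsingleton := by
      intro a ha b hb
      simp only [ok, Set.mem_ofPred_eq, not_forall] at ha hb
      obtain ⟨r, hr, hra, -⟩ := ha
      obtain ⟨r', hr', hra', -⟩ := hb
      obtain rfl : r = r' := henc (hra.trans hra'.symm)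
      exact (Nat.pair_eq_pair.1 (e.symm.injective (hr.symm.trans hr'))).2
    have hgood : {b | ok (e.symm (Nat.pair (c i) b)) (c i)}.Infinite := by
      have := hbad.finite.infinite_compl
      convert this using 1
      ext b; simp
    refine (hgood.image hg.injOn).mono ?_
    rintro _ ⟨b, hb, rfl⟩
    have h1 : (e (e.symm (Nat.pair (c i) b))).unpair.1 = c i := by simp
    change c (s _) = c i
    rw [hcs, hk2 _ (by rw [h1]; exact hb), h1]

/-! ### Diagonal operators -/

section Diagonal

variable {𝓗 : Type*} [NormedAddCommGroup 𝓗] [InnerProductSpace ℂ 𝓗]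

/-- The sesquilinear form with the matrix `M` with respect to linearly independent vectors. -/
theorem exists_form_of_matrix {ι : Type*} {e : ι → 𝓗} (he : LinearIndependent ℂ e)
    (M : ι → ι → ℂ) : ∃ Q : 𝓗 →ₗ⋆[ℂ] 𝓗 →ₗ[ℂ] ℂ, ∀ j k, Q (e j) (e k) = M j k := by
  -- The coordinate map on the span is extended algebraically to the whole space. Coordinates have
  -- finite support, so the matrix needs no summability.
  obtain ⟨ρ, hρ⟩ := (he.repr : Submodule.span ℂ (Set.range e) →ₗ[ℂ] ι →₀ ℂ).exists_extend
  have hρe : ∀ j, ρ (e j) = Finsupp.single j 1 := fun j => by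
    have h1 := LinearMap.congr_fun hρ ⟨e j, Submodule.subset_span ⟨j, rfl⟩⟩
    have h2 := he.repr_eq_single j ⟨e j, Submodule.subset_span ⟨j, rfl⟩⟩ rfl
    exact h1.trans h2
  let w : 𝓗 → ι → ℂ := fun ψ j => Finsupp.linearCombination ℂ (M j) (ρ ψ)
  refine ⟨LinearMap.mk₂'ₛₗ (starRingEnd ℂ) (RingHom.id ℂ)
    (fun φ ψ => (ρ φ).sum fun j a => conj a * w ψ j) ?_ ?_ ?_ ?_, fun j k => ?_⟩
  · intro φ φ' ψ
    rw [map_add, Finsupp.sum_add_index']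
    · simp
    · intros; rw [map_add, add_mul]
  · intro c φ ψ
    rw [map_smul, Finsupp.sum_smul_index' (by simp), Finsupp.smul_sum]
    exact Finsupp.sum_congr fun j _ => by simp [mul_assoc]
  · intro φ ψ ψ'
    simp only [w, map_add, mul_add, Finsupp.sum_add]
  · intro c φ ψ
    simp only [w, map_smul, RingHom.id_apply, smul_eq_mul, mul_left_comm _ c, Finsupp.mul_sum]
  · simp [hρe, w]

/-- The span of the differences of the vectors of a family that belong to the same class. -/
def differenceSpan {ι : Type*} (e : ι → 𝓗) (c : ι → ℕ) : Submodule ℂ 𝓗 :=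
  Submodule.span ℂ {x | ∃ j k, c j = c k ∧ x = e j - e k}

theorem differenceSpan_le {ι : Type*} (e : ι → 𝓗) (c : ι → ℕ) :
    differenceSpan e c ≤ Submodule.span ℂ (Set.range e) := by
  refine Submodule.span_le.2 ?_
  rintro _ ⟨j, k, -, rfl⟩
  exact Submodule.sub_mem _ (Submodule.subset_span ⟨j, rfl⟩) (Submodule.subset_span ⟨k, rfl⟩)

/-- A sesquilinear form vanishes on the span of a set if it does so on the set. -/
theorem form_eq_zero_of_span {Q : 𝓗 → 𝓗 → ℂ}
    (hl : ∀ φ φ' ψ, Q (φ + φ') ψ = Q φ ψ + Q φ' ψ) (hl' : ∀ (c : ℂ) φ ψ, Q (c • φ) ψ = conj c * Q φ ψ)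
    (hr : ∀ φ ψ ψ', Q φ (ψ + ψ') = Q φ ψ + Q φ ψ') (hr' : ∀ (c : ℂ) φ ψ, Q φ (c • ψ) = c * Q φ ψ)
    {s : Set 𝓗} (hs : ∀ φ ∈ s, ∀ ψ ∈ s, Q φ ψ = 0) :
    ∀ φ ∈ Submodule.span ℂ s, ∀ ψ ∈ Submodule.span ℂ s, Q φ ψ = 0 := by
  intro φ hφ ψ hψ
  induction hφ using Submodule.span_induction with
  | mem φ hφ =>
    induction hψ using Submodule.span_induction with
    | mem ψ hψ => exact hs φ hφ ψ hψ
    | zero => simpa using hr' 0 φ 0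
    | add ψ ψ' _ _ h h' => rw [hr, h, h', add_zero]
    | smul c ψ _ h => rw [hr', h, mul_zero]
  | zero => simpa using hl' 0 0 ψ
  | add φ φ' _ _ h h' => rw [hl, h, h', add_zero]
  | smul c φ _ h => rw [hl', h, mul_zero]

/-- A form that is canonically conjugate to the diagonal operator with eigenvectors `e j` and
eigenvalues `lam j`, on the differences of the eigenvectors in the same class. -/
theorem exists_form_conjugate_to_diagonal {ι : Type*} {e : ι → 𝓗} (he : Orthonormal ℂ e)
    {lam : ι → ℝ} {c : ι → ℕ} (hc : ∀ i j, c i = c j → lam i = lam j → i = j)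
    (L : 𝓗 →ₗ[ℂ] 𝓗) (hL : ∀ j, L (e j) = (lam j : ℂ) • e j) :
    ∃ Q : 𝓗 →ₗ⋆[ℂ] 𝓗 →ₗ[ℂ] ℂ,
      (∀ φ ∈ Submodule.span ℂ (Set.range e), ∀ ψ ∈ Submodule.span ℂ (Set.range e),
        conj (Q φ ψ) = Q ψ φ) ∧
      ∀ φ ∈ differenceSpan e c, ∀ ψ ∈ differenceSpan e c,
        Q (L φ) ψ - conj (Q (L ψ) φ) = -Complex.I * ⟪φ, ψ⟫_ℂ := by
  classical
  -- The diagonal entries are `I / 0 = 0` by convention, which is the value wanted.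
  obtain ⟨Q, hQ⟩ := exists_form_of_matrix he.linearIndependent
    fun j k => if c j = c k then Complex.I / ((lam j : ℂ) - lam k) else 0
  have hsym : ∀ φ ∈ Submodule.span ℂ (Set.range e), ∀ ψ ∈ Submodule.span ℂ (Set.range e),
      Q φ ψ - conj (Q ψ φ) = 0 := by
    refine form_eq_zero_of_span (Q := fun φ ψ => Q φ ψ - conj (Q ψ φ)) ?_ ?_ ?_ ?_ ?_
    · intro φ φ' ψ; simp only [map_add, LinearMap.add_apply]; ring
    · intro z φ ψ; simp only [LinearMap.map_smulₛₗ, LinearMap.smul_apply, smul_eq_mul, map_mul,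
        RingHom.id_apply]; ring
    · intro φ ψ ψ'; simp only [map_add, LinearMap.add_apply]; ring
    · intro z φ ψ; simp only [LinearMap.map_smulₛₗ, LinearMap.smul_apply, smul_eq_mul, map_mul,
        RingHom.id_apply, Complex.conj_conj]; ring
    · rintro _ ⟨j, rfl⟩ _ ⟨k, rfl⟩
      rw [hQ, hQ]
      by_cases h : c j = c k
      · rw [if_pos h, if_pos h.symm]
        simp only [map_div₀, Complex.conj_I, map_sub, Complex.conj_ofReal]
        rw [neg_div, ← div_neg, neg_sub, sub_self]
      · rw [if_neg h, if_neg (Ne.symm h)]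
        simp
  refine ⟨Q, fun φ hφ ψ hψ => (sub_eq_zero.1 (hsym ψ hψ φ hφ)).symm, ?_⟩
  let Ω : 𝓗 → 𝓗 → ℂ := fun φ ψ => Q (L φ) ψ - conj (Q (L ψ) φ) + Complex.I * ⟪φ, ψ⟫_ℂ
  have hl : ∀ φ φ' ψ, Ω (φ + φ') ψ = Ω φ ψ + Ω φ' ψ := by
    intro φ φ' ψ; simp only [Ω, map_add, LinearMap.add_apply, inner_add_left]; ring
  have hl' : ∀ (z : ℂ) φ ψ, Ω (z • φ) ψ = conj z * Ω φ ψ := by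
    intro z φ ψ; simp only [Ω, LinearMap.map_smulₛₗ, LinearMap.smul_apply, smul_eq_mul, map_mul,
        RingHom.id_apply, inner_smul_left]; ring
  have hr : ∀ φ ψ ψ', Ω φ (ψ + ψ') = Ω φ ψ + Ω φ ψ' := by
    intro φ ψ ψ'; simp only [Ω, map_add, LinearMap.add_apply, inner_add_right]; ring
  have hr' : ∀ (z : ℂ) φ ψ, Ω φ (z • ψ) = z * Ω φ ψ := by
    intro z φ ψ; simp only [Ω, LinearMap.map_smulₛₗ, LinearMap.smul_apply, smul_eq_mul, map_mul,
        RingHom.id_apply, Complex.conj_conj, inner_smul_right]; ring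
  -- The defect from the canonical relation is `i` throughout a class: off the diagonal it comes
  -- from `(lam j - lam k)` times the entry, on the diagonal from the inner product. A constant
  -- matrix cancels on pairs of differences.
  have hΩe : ∀ j k, Ω (e j) (e k) = if c j = c k then Complex.I else 0 := by
    intro j k
    simp only [Ω, hL, LinearMap.map_smulₛₗ, LinearMap.smul_apply, smul_eq_mul, map_mul, hQ,
      Complex.conj_ofReal]
    by_cases h : c j = c k
    · rw [if_pos h, if_pos h, if_pos h.symm]
      simp only [map_div₀, Complex.conj_I, map_sub, Complex.conj_ofReal]
      by_cases hjk : j = k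
      · subst hjk
        simp [he.1 j]
      · have h1 : (lam j : ℂ) - lam k ≠ 0 := fun h0 =>
          hjk (hc j k h (by exact_mod_cast sub_eq_zero.1 h0))
        have h2 : (lam k : ℂ) - lam j ≠ 0 := fun h0 => h1 (by linear_combination -h0)
        rw [he.2 hjk]
        field_simp
        ring
    · have hjk : j ≠ k := fun h' => h (by rw [h'])
      rw [if_neg h, if_neg h, if_neg (Ne.symm h), he.2 hjk]
      simp
  have hneg : ∀ φ ψ, Ω φ (-ψ) = -Ω φ ψ := fun φ ψ => by simpa using hr' (-1) φ ψ
  have hneg' : ∀ φ ψ, Ω (-φ) ψ = -Ω φ ψ := fun φ ψ => by simpa using hl' (-1) φ ψ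
  have hΩ : ∀ φ ∈ differenceSpan e c, ∀ ψ ∈ differenceSpan e c, Ω φ ψ = 0 := by
    refine form_eq_zero_of_span hl hl' hr hr' ?_
    rintro _ ⟨j, k, hjk, rfl⟩ _ ⟨l, m, hlm, rfl⟩
    simp only [sub_eq_add_neg, hl, hr, hneg, hneg', hΩe, hjk, hlm]
    ring
  intro φ hφ ψ hψ
  linear_combination hΩ φ hφ ψ hψ

/-- A vector that is orthogonal to the differences is orthogonal to the vectors of the family if all
classes are infinite. -/
theorem inner_eq_zero_of_orthogonal_differenceSpan {ι : Type*} {e : ι → 𝓗} (he : Orthonormal ℂ e)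
    {c : ι → ℕ} (hc : ∀ i, {j | c j = c i}.Infinite) {χ : 𝓗}
    (hχ : ∀ φ ∈ differenceSpan e c, ⟪φ, χ⟫_ℂ = 0) (i : ι) : ⟪e i, χ⟫_ℂ = 0 := by
  by_contra h
  have h1 : ∀ j, c j = c i → ⟪e j, χ⟫_ℂ = ⟪e i, χ⟫_ℂ := fun j hj => by
    have := hχ _ (Submodule.subset_span ⟨j, i, hj, rfl⟩)
    rwa [inner_sub_left, sub_eq_zero] at this
  -- Bessel's inequality sends the coefficients to zero along the cofinite filter, which is
  -- incompatible with a non-zero constant value on an infinite class.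
  have h2 := (he.inner_products_summable (x := χ)).tendsto_cofinite_zero
  have h3 : ∀ᶠ j in cofinite, ‖⟪e j, χ⟫_ℂ‖ ^ 2 < ‖⟪e i, χ⟫_ℂ‖ ^ 2 :=
    h2.eventually_lt_const (by positivity)
  refine hc i ((eventually_cofinite.1 h3).subset fun j hj => ?_)
  rw [Set.mem_ofPred_eq, h1 j hj]
  exact lt_irrefl _

end Diagonal

/-! ### Eigenvectors of functions of the generator -/

namespace ProjectionValuedMeasure

variable {𝓗 : Type*} [NormedAddCommGroup 𝓗] [InnerProductSpace ℂ 𝓗] [CompleteSpace 𝓗]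
variable (E : ProjectionValuedMeasure 𝓗)

/-- The spaces `V y`, ranges of `E` on `f⁻¹{y} ∩ P`, are orthogonal for different `y`, non-zero, and
contained in eigenspaces of `f(H)`, hence finite-dimensional. Orthonormal bases of them, put
together, reach every eigenvector of `H`. Countability of `P` makes these sets Lebesgue null, which
gives orthogonality to the absolutely continuous subspace. -/
theorem exists_eigenvectors {f : ℝ → ℝ} (hf : Measurable f) {P : Set ℝ} (hP : P.Countable)
    (hPE : ∀ x, x ∈ P ↔ (x : ℂ) ∈ pointSpectrum E.generator) (hinf : (f '' P).Infinite)
    (hfin : ∀ y ∈ f '' P, FiniteDimensional ℂ (eigenspace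
      (E.integral (fun x => (f x : ℂ)) (Complex.measurable_ofReal.comp hf)) (y : ℂ))) :
    ∃ (ι : Type) (e : ι → 𝓗) (lam : ι → ℝ) (c : ι → ℕ), Nonempty ι ∧ Orthonormal ℂ e ∧
      (∀ j, e j ∈ eigenspace
        (E.integral (fun x => (f x : ℂ)) (Complex.measurable_ofReal.comp hf)) (lam j : ℂ)) ∧
      (∀ i j, c i = c j → lam i = lam j → i = j) ∧ (∀ i, {j | c j = c i}.Infinite) ∧
      (∀ j, ∀ φ ∈ E.acSubspace, ⟪φ, e j⟫_ℂ = 0) ∧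
      ∀ ψ, (∀ j, ⟪e j, ψ⟫_ℂ = 0) → ∀ x, E.proj {x} ψ = 0 := by
  let B : f '' P → Set ℝ := fun y => f ⁻¹' {(y : ℝ)} ∩ P
  have hB : ∀ y, MeasurableSet (B y) := fun y =>
    (hf (measurableSet_singleton _)).inter hP.measurableSet
  let V : f '' P → Submodule ℂ 𝓗 := fun y => (E.proj (B y)).range
  have hVfix : ∀ y, ∀ ψ ∈ V y, E.proj (B y) ψ = ψ := by
    rintro y _ ⟨ψ, rfl⟩
    change E.proj (B y) (E.proj (B y) ψ) = E.proj (B y) ψ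
    rw [E.proj_proj (hB y) (hB y), Set.inter_self]
  have hVeig : ∀ y, V y ≤ eigenspace
      (E.integral (fun x => (f x : ℂ)) (Complex.measurable_ofReal.comp hf)) ((y : ℝ) : ℂ) := by
    rintro y _ ⟨ψ, rfl⟩
    have h := E.apply_proj_of_eq (f := fun x => (f x : ℂ)) (c := ((y : ℝ) : ℂ))
      (Complex.measurable_ofReal.comp hf) (hB y) (fun x hx => by rw [hx.1]) ψ
    exact ⟨h.1, h.2⟩
  have hVfin : ∀ y, FiniteDimensional ℂ (V y) := fun y => by
    have := hfin y y.2
    exact Submodule.finiteDimensional_of_le (hVeig y)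
  have hVorth : OrthogonalFamily ℂ (fun y => V y) fun y => (V y).subtypeₗᵢ := by
    intro y z hyz φ ψ
    change ⟪(φ : 𝓗), (ψ : 𝓗)⟫_ℂ = 0
    rw [← hVfix y φ φ.2, ← hVfix z ψ ψ.2]
    rw [E.inner_proj_left, E.proj_proj (hB y) (hB z)]
    have : B y ∩ B z = ∅ := by
      ext x
      simp only [B, Set.mem_inter_iff, Set.mem_preimage, Set.mem_singleton_iff,
        Set.mem_empty_iff_false, iff_false]
      rintro ⟨⟨h1, -⟩, h2, -⟩
      exact hyz (Subtype.ext (h1.symm.trans h2))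
    rw [this, E.proj_empty]
    simp
  have hsub : ∀ {x} (hx : x ∈ P) ψ,
      E.proj {x} (E.proj (B ⟨f x, Set.mem_image_of_mem f hx⟩) ψ) = E.proj {x} ψ := fun {x} hx ψ => by
    rw [E.proj_proj (measurableSet_singleton x) (hB _), Set.inter_eq_left.2]
    rintro _ rfl
    exact ⟨rfl, hx⟩
  have hVne : ∀ y, V y ≠ ⊥ := by
    rintro ⟨_, x, hx, rfl⟩ h
    obtain ⟨ψ, hψ⟩ := (E.proj_singleton_ne_zero_iff x).2 ((hPE x).1 hx)
    have h1 : E.proj (B ⟨f x, Set.mem_image_of_mem f hx⟩) ψ = 0 :=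
      (Submodule.eq_bot_iff _).1 h _ ⟨ψ, rfl⟩
    rw [← hsub hx, h1, map_zero] at hψ
    exact hψ rfl
  let b : ∀ y, OrthonormalBasis (Fin (Module.finrank ℂ (V y))) ℂ (V y) := fun y =>
    stdOrthonormalBasis ℂ (V y)
  let ι := Σ y : f '' P, Fin (Module.finrank ℂ (V y))
  let e : ι → 𝓗 := fun j => b j.1 j.2
  have heV : ∀ j : ι, e j ∈ V j.1 := fun j => (b j.1 j.2).2
  have hcount : Countable (f '' P) := (hP.image f).to_subtype
  have hW : Infinite (f '' P) := hinf.to_subtype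
  obtain ⟨c, hc1, hc2⟩ := exists_infinite_injective_classes (ι := ι) (W := f '' P) Sigma.fst
    (fun y => by
      have h1 : 0 < Module.finrank ℂ (V y) := Submodule.one_le_finrank_iff.2 (hVne y)
      exact ⟨⟨y, ⟨0, h1⟩⟩, rfl⟩)
    (fun y => by
      refine (Set.finite_range fun i : Fin (Module.finrank ℂ (V y)) => (⟨y, i⟩ : ι)).subset ?_
      rintro ⟨z, i⟩ rfl
      exact ⟨i, rfl⟩)
  have hne : Nonempty ι := by
    obtain ⟨y⟩ := (inferInstance : Nonempty (f '' P))
    exact ⟨⟨y, ⟨0, Submodule.one_le_finrank_iff.2 (hVne y)⟩⟩⟩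
  refine ⟨ι, e, fun j => j.1, c, hne,
    hVorth.orthonormal_sigma_orthonormal fun y => (b y).orthonormal, fun j => hVeig _ (heV j),
    fun i j h1 h2 => hc1 i j h1 (Subtype.ext h2), hc2, fun j φ hφ => ?_, fun ψ hψ x => ?_⟩
  · have h0 : volume (B j.1) = 0 :=
      measure_mono_null Set.inter_subset_right (hP.measure_zero volume)
    rw [← hVfix j.1 (e j) (heV j), ← E.inner_proj_left,
      (E.proj_eq_zero_iff (hB j.1) φ).2 (hφ h0), inner_zero_left]
  · by_cases hx : x ∈ P
    · rw [← hsub hx]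
      set y : f '' P := ⟨f x, Set.mem_image_of_mem f hx⟩
      have h1 : (⟨E.proj (B y) ψ, ψ, rfl⟩ : V y) = 0 := by
        refine (b y).repr.injective ?_
        ext i
        rw [map_zero, OrthonormalBasis.repr_apply_apply]
        change ⟪(b y i : 𝓗), E.proj (B y) ψ⟫_ℂ = 0
        rw [← E.inner_proj_left, hVfix y _ (b y i).2]
        exact hψ ⟨y, i⟩
      rw [show E.proj (B y) ψ = 0 from congrArg Subtype.val h1, map_zero]
    · by_contra h
      exact hx ((hPE x).2 ((E.proj_singleton_ne_zero_iff x).1 ⟨ψ, h⟩))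

end ProjectionValuedMeasure

end

/-! ### Borel extension of representations, and the spectral theorem. -/

section

variable {𝓗 : Type*} [NormedAddCommGroup 𝓗] [InnerProductSpace ℂ 𝓗] [CompleteSpace 𝓗]

/-! ### Representations of continuous functions -/

namespace Representation

open ProjectionValuedMeasure CompactlySupported

variable {X : Type*} [MetricSpace X] [CompactSpace X] [MeasurableSpace X]
  [BorelSpace X] (π : C(X, ℂ) →⋆ₐ[ℂ] (𝓗 →L[ℂ] 𝓗))

/-- A real continuous function as a complex continuous function. -/
def ofRealMap (g : C(X, ℝ)) : C(X, ℂ) := ⟨fun x => (g x : ℂ), by fun_prop⟩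

theorem inner_apply_apply (g h : C(X, ℂ)) (φ ψ : 𝓗) :
    ⟪π g φ, π h ψ⟫_ℂ = ⟪φ, π (star g * h) ψ⟫_ℂ := by
  rw [map_mul, map_star, mul_apply_eq_comp, ContinuousLinearMap.star_eq_adjoint,
    ContinuousLinearMap.adjoint_inner_right]

/-- The positive functional `g ↦ ⟪ψ, π(g) ψ⟫`. -/
def vectorFunctional (ψ : 𝓗) : C_c(X, ℝ) →ₚ[ℝ] ℝ :=
  PositiveLinearMap.mk₀
    { toFun := fun g => (⟪ψ, π (ofRealMap g) ψ⟫_ℂ).re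
      map_add' := fun g h => by
        have h1 : ofRealMap (X := X) (g + h : C_c(X, ℝ)) = ofRealMap g + ofRealMap h := by
          ext x; simp [ofRealMap]
        rw [h1, map_add, add_apply, inner_add_right, Complex.add_re]
      map_smul' := fun c g => by
        have h1 : ofRealMap (X := X) (c • g : C_c(X, ℝ)) = (c : ℂ) • ofRealMap g := by
          ext x; simp [ofRealMap]
        rw [h1, map_smul, smul_apply, inner_smul_right, Complex.re_ofReal_mul]
        rfl }
    -- A non-negative function is the square of its root, so its value is a squared norm.
    fun g hg => by
      have h1 : ofRealMap (X := X) g = star (ofRealMap ⟨fun x => √(g x), by fun_prop⟩)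
          * ofRealMap ⟨fun x => √(g x), by fun_prop⟩ := by
        ext x
        have : (g x : ℂ) = ((√(g x) * √(g x) : ℝ) : ℂ) := by rw [Real.mul_self_sqrt (hg x)]
        simpa [ofRealMap] using this
      change 0 ≤ (⟪ψ, π (ofRealMap g) ψ⟫_ℂ).re
      rw [h1, ← inner_apply_apply]
      exact inner_self_nonneg (𝕜 := ℂ)

/-- The measure that represents `g ↦ ⟪ψ, π(g) ψ⟫`. -/
def vectorMeasure (ψ : 𝓗) : Measure X := RealRMK.rieszMeasure (vectorFunctional π ψ)

instance (ψ : 𝓗) : IsFiniteMeasure (vectorMeasure π ψ) :=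
  inferInstanceAs (IsFiniteMeasure (RealRMK.rieszMeasure _))

instance (ψ : 𝓗) : (vectorMeasure π ψ).Regular :=
  inferInstanceAs (RealRMK.rieszMeasure _).Regular

theorem integral_vectorMeasure (g : C(X, ℝ)) (ψ : 𝓗) :
    ∫ x, g x ∂(vectorMeasure π ψ) = (⟪ψ, π (ofRealMap g) ψ⟫_ℂ).re :=
  RealRMK.integral_rieszMeasure (vectorFunctional π ψ)
    (CompactlySupportedContinuousMap.continuousMapEquiv g)

/-- `‖π(g)ψ‖²` is the functional at `|g|²`, hence an integral for the Riesz measure. Through this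
isometry `π` extends to bounded Borel functions. -/
theorem enorm_apply (g : C(X, ℂ)) (ψ : 𝓗) : ‖π g ψ‖ₑ = eLpNorm g 2 (vectorMeasure π ψ) := by
  have h1 : ‖π g ψ‖ ^ 2 = ∫ x, ‖g x‖ ^ 2 ∂(vectorMeasure π ψ) := by
    have h2 := integral_vectorMeasure π (ψ := ψ) ⟨fun x => ‖g x‖ ^ 2, by fun_prop⟩
    have h3 : ofRealMap (X := X) ⟨fun x => ‖g x‖ ^ 2, by fun_prop⟩ = star g * g := by
      ext x
      simp [ofRealMap, Complex.conj_mul']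
    rw [h3, ← inner_apply_apply, inner_self_eq_norm_sq_to_K] at h2
    refine Eq.trans ?_ h2.symm
    norm_cast
  have h4 : Integrable (fun x => ‖g x‖ ^ 2) (vectorMeasure π ψ) :=
    (map_continuous g).norm.pow 2 |>.integrable_of_hasCompactSupport
      (HasCompactSupport.of_compactSpace _)
  rw [eLpNorm_eq_lintegral_rpow_enorm_toReal (by simp) (by simp)]
  have h5 : ∫⁻ x, ‖g x‖ₑ ^ (2 : ℝ) ∂(vectorMeasure π ψ) = ‖π g ψ‖ₑ ^ (2 : ℝ) := by
    rw [← ofReal_norm (π g ψ), ENNReal.ofReal_rpow_of_nonneg (norm_nonneg _) (by norm_num),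
      Real.rpow_ofNat, h1, ofReal_integral_eq_lintegral_ofReal h4
        (Eventually.of_forall fun x => by positivity)]
    refine lintegral_congr fun x => ?_
    rw [← ofReal_norm, ENNReal.ofReal_rpow_of_nonneg (norm_nonneg _) (by norm_num), Real.rpow_ofNat]
  simp only [ENNReal.toReal_ofNat]
  rw [h5, ← ENNReal.rpow_mul]
  norm_num

variable {π}

/-- Bounded Borel functions can be approximated by continuous functions in `L²`. -/
theorem exists_tendsto_eLpNorm {f : X → ℂ} (hf : IsBddMeasurable f) (ν : Measure X)
    [IsFiniteMeasure ν] [ν.WeaklyRegular] :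
    ∃ g : ℕ → C(X, ℂ), Tendsto (fun n => eLpNorm (f - ⇑(g n)) 2 ν) atTop (𝓝 0) := by
  obtain ⟨ε, -, hε, hlim⟩ := exists_seq_strictAnti_tendsto' (show (0 : ℝ≥0∞) < 1 by simp)
  have h : ∀ n, ∃ g : C(X, ℂ), eLpNorm (f - ⇑g) 2 ν ≤ ε n := fun n => by
    obtain ⟨g, hg, -⟩ := (hf.memLp ν).exists_boundedContinuous_eLpNorm_sub_le (by simp)
      (hε n).1.ne'
    exact ⟨g.toContinuousMap, hg⟩
  choose g hg using h
  exact ⟨g, tendsto_of_tendsto_of_tendsto_of_le_of_le tendsto_const_nhds hlim (fun _ => zero_le) hg⟩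

-- The limit is described by its distances to all `π(g)ψ`, which makes no reference to an
-- approximating sequence and determines the vector uniquely by density of continuous functions in
-- `L²`.
variable (π) in
theorem exists_limit {f : X → ℂ} (hf : IsBddMeasurable f) (ψ : 𝓗) :
    ∃ v, ∀ g : C(X, ℂ), ‖v - π g ψ‖ₑ = eLpNorm (f - ⇑g) 2 (vectorMeasure π ψ) := by
  set μ := vectorMeasure π ψ with hμ
  obtain ⟨g, hg⟩ := exists_tendsto_eLpNorm hf μ
  have hmeas : ∀ h : C(X, ℂ), AEStronglyMeasurable (f - ⇑h) μ := fun h =>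
    (hf.measurable.sub (map_continuous h).measurable).aestronglyMeasurable
  have hdist : ∀ h k : C(X, ℂ), ‖π h ψ - π k ψ‖ₑ = eLpNorm (⇑h - ⇑k) 2 μ := fun h k => by
    rw [← sub_apply, ← map_sub, enorm_apply]
    rfl
  have hC : CauchySeq fun n => π (g n) ψ := by
    refine EMetric.cauchySeq_iff'.2 fun ε hε => ?_
    obtain ⟨N, hN⟩ := eventually_atTop.1 (hg.eventually_lt_const (ENNReal.half_pos hε.ne'))
    refine ⟨N, fun n hn => ?_⟩
    rw [edist_eq_enorm_sub, hdist, show (⇑(g n) - ⇑(g N)) = (f - ⇑(g N)) - (f - ⇑(g n)) by abel]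
    calc eLpNorm ((f - ⇑(g N)) - (f - ⇑(g n))) 2 μ
        ≤ eLpNorm (f - ⇑(g N)) 2 μ + eLpNorm (f - ⇑(g n)) 2 μ :=
          eLpNorm_sub_le (hmeas _) (hmeas _) (by norm_num)
      _ < ε / 2 + ε / 2 := ENNReal.add_lt_add (hN N le_rfl) (hN n hn)
      _ = ε := ENNReal.add_halves ε
  obtain ⟨v, hv⟩ := cauchySeq_tendsto_of_complete hC
  refine ⟨v, fun h => ?_⟩
  have h1 : Tendsto (fun n => ‖π (g n) ψ - π h ψ‖ₑ) atTop (𝓝 ‖v - π h ψ‖ₑ) :=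
    (hv.sub_const _).enorm
  refine tendsto_nhds_unique h1 ?_
  have h2 : Tendsto (fun n => eLpNorm (f - ⇑h) 2 μ - eLpNorm (f - ⇑(g n)) 2 μ) atTop
      (𝓝 (eLpNorm (f - ⇑h) 2 μ)) := by
    simpa using ENNReal.Tendsto.sub (tendsto_const_nhds (x := eLpNorm (f - ⇑h) 2 μ)) hg
      (Or.inr (by simp))
  have h3 : Tendsto (fun n => eLpNorm (f - ⇑h) 2 μ + eLpNorm (f - ⇑(g n)) 2 μ) atTop
      (𝓝 (eLpNorm (f - ⇑h) 2 μ)) := by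
    simpa using tendsto_const_nhds (x := eLpNorm (f - ⇑h) 2 μ).add hg
  refine tendsto_of_tendsto_of_tendsto_of_le_of_le h2 h3 (fun n => ?_) fun n => ?_
  · rw [hdist, tsub_le_iff_right]
    calc eLpNorm (f - ⇑h) 2 μ = eLpNorm ((⇑(g n) - ⇑h) + (f - ⇑(g n))) 2 μ := by congr 1; abel
      _ ≤ _ := eLpNorm_add_le
        ((map_continuous _).sub (map_continuous _)).aestronglyMeasurable (hmeas _) (by norm_num)
  · rw [hdist]
    calc eLpNorm (⇑(g n) - ⇑h) 2 μ = eLpNorm ((f - ⇑h) - (f - ⇑(g n))) 2 μ := by congr 1; abel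
      _ ≤ _ := eLpNorm_sub_le (hmeas _) (hmeas _) (by norm_num)

/-- The extension of `π` to bounded Borel functions, at a vector. -/
def borelApply (π : C(X, ℂ) →⋆ₐ[ℂ] (𝓗 →L[ℂ] 𝓗)) {f : X → ℂ} (hf : IsBddMeasurable f) (ψ : 𝓗) : 𝓗 :=
  (exists_limit π hf ψ).choose

theorem enorm_borelApply_sub {f : X → ℂ} (hf : IsBddMeasurable f) (ψ : 𝓗) (g : C(X, ℂ)) :
    ‖borelApply π hf ψ - π g ψ‖ₑ = eLpNorm (f - ⇑g) 2 (vectorMeasure π ψ) :=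
  (exists_limit π hf ψ).choose_spec g

theorem tendsto_borelApply {f : X → ℂ} (hf : IsBddMeasurable f) {ψ : 𝓗} {g : ℕ → C(X, ℂ)}
    (h : Tendsto (fun n => eLpNorm (f - ⇑(g n)) 2 (vectorMeasure π ψ)) atTop (𝓝 0)) :
    Tendsto (fun n => π (g n) ψ) atTop (𝓝 (borelApply π hf ψ)) := by
  rw [tendsto_iff_edist_tendsto_0]
  refine h.congr fun n => ?_
  rw [edist_comm, edist_eq_enorm_sub, enorm_borelApply_sub]

-- Approximating in `L²` of the sum of the vector measures serves finitely many vectors at once;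
-- linearity, products and adjoints each compare several vectors.
variable (π) in
theorem exists_common_tendsto {f : X → ℂ} (hf : IsBddMeasurable f) (s : Finset 𝓗) :
    ∃ g : ℕ → C(X, ℂ), ∀ ψ ∈ s,
      Tendsto (fun n => eLpNorm (f - ⇑(g n)) 2 (vectorMeasure π ψ)) atTop (𝓝 0) := by
  obtain ⟨g, hg⟩ := exists_tendsto_eLpNorm hf (∑ ψ ∈ s, vectorMeasure π ψ)
  refine ⟨g, fun ψ hψ => tendsto_of_tendsto_of_tendsto_of_le_of_le tendsto_const_nhds hg
    (fun _ => zero_le) fun n => eLpNorm_mono_measure _ ?_⟩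
  exact Finset.single_le_sum (f := vectorMeasure π) (fun _ _ => Measure.zero_le _) hψ

theorem enorm_borelApply {f : X → ℂ} (hf : IsBddMeasurable f) (ψ : 𝓗) :
    ‖borelApply π hf ψ‖ₑ = eLpNorm f 2 (vectorMeasure π ψ) := by
  simpa using enorm_borelApply_sub (π := π) hf ψ 0

variable (π) in
/-- The extension of `π` to bounded Borel functions. -/
def borelOp {f : X → ℂ} (hf : IsBddMeasurable f) : 𝓗 →L[ℂ] 𝓗 :=
  LinearMap.mkContinuousOfExistsBound
    { toFun := borelApply π hf
      map_add' := fun ψ φ => by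
        classical
        obtain ⟨g, hg⟩ := exists_common_tendsto π hf {ψ, φ, ψ + φ}
        refine tendsto_nhds_unique (tendsto_borelApply hf (hg (ψ + φ) (by simp))) ?_
        simpa only [map_add] using (tendsto_borelApply hf (hg ψ (by simp))).add
          (tendsto_borelApply hf (hg φ (by simp)))
      map_smul' := fun c ψ => by
        classical
        obtain ⟨g, hg⟩ := exists_common_tendsto π hf {ψ, c • ψ}
        refine tendsto_nhds_unique (tendsto_borelApply hf (hg (c • ψ) (by simp))) ?_
        simpa only [map_smul, RingHom.id_apply] using (tendsto_borelApply hf (hg ψ (by simp))).const_smul c }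
    (by
      obtain ⟨C, hC⟩ := hf.bdd
      refine ⟨|C|, fun ψ => ?_⟩
      have h1 : ‖borelApply π hf ψ‖ₑ ≤ ‖π (algebraMap ℂ C(X, ℂ) C) ψ‖ₑ := by
        rw [enorm_borelApply, enorm_apply]
        refine eLpNorm_mono fun x => (hC x).trans ((le_abs_self C).trans ?_)
        simp
      rw [enorm_le_iff_norm_le, AlgHomClass.commutes, Algebra.algebraMap_eq_smul_one, smul_apply,
        norm_smul] at h1
      exact h1.trans_eq (by simp))

variable {f h : X → ℂ} (hf : IsBddMeasurable f) (hh : IsBddMeasurable h)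

theorem tendsto_borelOp {ψ : 𝓗} {g : ℕ → C(X, ℂ)}
    (h : Tendsto (fun n => eLpNorm (f - ⇑(g n)) 2 (vectorMeasure π ψ)) atTop (𝓝 0)) :
    Tendsto (fun n => π (g n) ψ) atTop (𝓝 (borelOp π hf ψ)) :=
  tendsto_borelApply hf h

theorem enorm_borelOp (ψ : 𝓗) : ‖borelOp π hf ψ‖ₑ = eLpNorm f 2 (vectorMeasure π ψ) :=
  enorm_borelApply hf ψ

theorem borelOp_continuousMap (g : C(X, ℂ)) (hg : IsBddMeasurable ⇑g) : borelOp π hg = π g := by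
  ext ψ
  have h1 := enorm_borelApply_sub (π := π) hg ψ g
  rw [sub_self, eLpNorm_zero, enorm_eq_zero, sub_eq_zero] at h1
  exact h1

theorem borelOp_congr (hfh : ∀ x, f x = h x) : borelOp π hf = borelOp π hh := by
  obtain rfl : f = h := funext hfh
  rfl

theorem borelOp_sub_apply (ψ : 𝓗) :
    borelOp π (hf.sub hh) ψ = borelOp π hf ψ - borelOp π hh ψ := by
  obtain ⟨g, hg⟩ := exists_common_tendsto π hf {ψ}
  obtain ⟨k, hk⟩ := exists_common_tendsto π hh {ψ}
  replace hg := hg ψ (by simp)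
  replace hk := hk ψ (by simp)
  have h1 := (tendsto_borelOp hf hg).sub (tendsto_borelOp hh hk)
  have h2 : Tendsto (fun n => eLpNorm ((fun x => f x - h x) - ⇑(g n - k n)) 2 (vectorMeasure π ψ))
      atTop (𝓝 0) := by
    refine tendsto_of_tendsto_of_tendsto_of_le_of_le tendsto_const_nhds
      (by simpa using hg.add hk) (fun _ => zero_le) fun n => ?_
    rw [show (fun x => f x - h x) - ⇑(g n - k n) = (f - ⇑(g n)) - (h - ⇑(k n)) by
      ext x; simp; ring]
    exact eLpNorm_sub_le (hf.measurable.sub (map_continuous _).measurable).aestronglyMeasurable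
      (hh.measurable.sub (map_continuous _).measurable).aestronglyMeasurable (by norm_num)
  refine tendsto_nhds_unique (tendsto_borelOp (hf.sub hh) h2) ?_
  simpa only [map_sub, sub_apply] using h1

theorem tendsto_eLpNorm_mul {μ : Measure X} {g : ℕ → C(X, ℂ)}
    (hg : Tendsto (fun n => eLpNorm (f - ⇑(g n)) 2 μ) atTop (𝓝 0)) (hh : IsBddMeasurable h) :
    Tendsto (fun n => eLpNorm (fun x => f x * h x - g n x * h x) 2 μ) atTop (𝓝 0) := by
  obtain ⟨C, hC⟩ := hh.bdd
  have h1 : Tendsto (fun n => ENNReal.ofReal C * eLpNorm (f - ⇑(g n)) 2 μ) atTop (𝓝 0) := by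
    simpa using ENNReal.Tendsto.const_mul hg (Or.inr ENNReal.ofReal_ne_top)
  refine tendsto_of_tendsto_of_tendsto_of_le_of_le tendsto_const_nhds h1 (fun _ => zero_le)
    fun n => eLpNorm_le_mul_eLpNorm_of_ae_le_mul (Eventually.of_forall fun x => ?_) 2
  rw [← sub_mul, norm_mul, mul_comm]
  exact mul_le_mul_of_nonneg_right (hC x) (norm_nonneg _)

theorem apply_borelOp (g : C(X, ℂ)) (hg : IsBddMeasurable ⇑g) (ψ : 𝓗) :
    π g (borelOp π hf ψ) = borelOp π (hg.mul hf) ψ := by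
  obtain ⟨k, hk⟩ := exists_common_tendsto π hf {ψ}
  replace hk := hk ψ (by simp)
  have h1 := ((π g).continuous.tendsto _).comp (tendsto_borelOp hf hk)
  refine tendsto_nhds_unique h1 ?_
  refine (tendsto_borelOp (hg.mul hf) (g := fun n => g * k n) ?_).congr fun n => ?_
  · refine (tendsto_eLpNorm_mul hk hg).congr fun n => ?_
    congr 1
    ext x
    simp
    ring
  · rw [map_mul, mul_apply_eq_comp]
    rfl

/-- A sequence for `f` is chosen to converge for both `ψ` and the image of `ψ` under `h`.
Multiplying by the bounded `h` preserves `L²` convergence. -/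
theorem borelOp_borelOp (ψ : 𝓗) :
    borelOp π hf (borelOp π hh ψ) = borelOp π (hf.mul hh) ψ := by
  classical
  obtain ⟨g, hg⟩ := exists_common_tendsto π hf {ψ, borelOp π hh ψ}
  have hgb : ∀ n, IsBddMeasurable ⇑(g n) := fun n =>
    ⟨(map_continuous _).measurable, ‖g n‖, (g n).norm_coe_le_norm⟩
  refine tendsto_nhds_unique (tendsto_borelOp hf (hg _ (by simp))) ?_
  rw [tendsto_iff_edist_tendsto_0]
  refine (tendsto_eLpNorm_mul (hg ψ (by simp)) hh).congr fun n => ?_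
  rw [apply_borelOp _ _ (hgb n), edist_comm, edist_eq_enorm_sub, ← borelOp_sub_apply, enorm_borelOp]

theorem inner_borelOp_left (φ ψ : 𝓗) :
    ⟪borelOp π hf φ, ψ⟫_ℂ = ⟪φ, borelOp π hf.conjugate ψ⟫_ℂ := by
  classical
  obtain ⟨g, hg⟩ := exists_common_tendsto π hf {ψ, φ}
  have h1 := (tendsto_borelOp hf (hg φ (by simp))).inner (𝕜 := ℂ) (tendsto_const_nhds (x := ψ))
  have h2 : Tendsto (fun n => eLpNorm ((fun x => conj (f x)) - ⇑(star (g n))) 2 (vectorMeasure π ψ))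
      atTop (𝓝 0) := by
    refine (hg ψ (by simp)).congr fun n => eLpNorm_congr_norm_ae (Eventually.of_forall fun x => ?_)
    simp [← map_sub]
  have h3 := (tendsto_const_nhds (x := φ)).inner (𝕜 := ℂ) (tendsto_borelOp hf.conjugate h2)
  refine tendsto_nhds_unique h1 (h3.congr fun n => ?_)
  rw [map_star, ContinuousLinearMap.star_eq_adjoint, ContinuousLinearMap.adjoint_inner_right]

/-! ### The projection-valued measure of a representation -/

theorem isBddMeasurable_indicator {S : Set X} (hS : MeasurableSet S) :
    IsBddMeasurable (S.indicator fun _ => (1 : ℂ)) := (IsBddMeasurable.const 1).indicator hS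

variable (π) in
/-- The spectral projection of a Borel set. -/
def setOp {S : Set X} (hS : MeasurableSet S) : 𝓗 →L[ℂ] 𝓗 :=
  borelOp π (isBddMeasurable_indicator hS)

variable {S S' : Set X} (hS : MeasurableSet S) (hS' : MeasurableSet S')

theorem norm_sq_setOp (ψ : 𝓗) : ‖setOp π hS ψ‖ ^ 2 = (vectorMeasure π ψ).real S := by
  have h1 : ‖setOp π hS ψ‖ₑ ^ 2 = vectorMeasure π ψ S := by
    rw [setOp, enorm_borelOp, eLpNorm_indicator_const hS (by simp) (by simp), ← ENNReal.rpow_natCast,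
      enorm_one, one_mul, ← ENNReal.rpow_mul]
    norm_num
  rw [measureReal_def, ← h1, ENNReal.toReal_pow, toReal_enorm]

theorem setOp_setOp {S'' : Set X} (hS'' : MeasurableSet S'') (h : S ∩ S' = S'') (ψ : 𝓗) :
    setOp π hS (setOp π hS' ψ) = setOp π hS'' ψ := by
  subst h
  rw [setOp, setOp, borelOp_borelOp, setOp]
  refine congrArg (fun T : 𝓗 →L[ℂ] 𝓗 => T ψ) (borelOp_congr _ _ fun x => ?_)
  by_cases hx : x ∈ S <;> by_cases hx' : x ∈ S' <;> simp [hx, hx']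

theorem inner_setOp_left (φ ψ : 𝓗) : ⟪setOp π hS φ, ψ⟫_ℂ = ⟪φ, setOp π hS ψ⟫_ℂ := by
  rw [setOp, inner_borelOp_left]
  refine congrArg (fun T : 𝓗 →L[ℂ] 𝓗 => ⟪φ, T ψ⟫_ℂ) (borelOp_congr _ _ fun x => ?_)
  by_cases hx : x ∈ S <;> simp [hx]

theorem inner_setOp_setOp {S'' : Set X} (hS'' : MeasurableSet S'') (h : S ∩ S' = S'') (φ ψ : 𝓗) :
    ⟪setOp π hS φ, setOp π hS' ψ⟫_ℂ = ⟪φ, setOp π hS'' ψ⟫_ℂ := by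
  rw [inner_setOp_left, setOp_setOp _ _ hS'' h]

theorem setOp_univ : setOp π MeasurableSet.univ = 1 := by
  have h1 := borelOp_continuousMap (π := π) 1 (IsBddMeasurable.const 1)
  rw [map_one] at h1
  rw [← h1, setOp]
  exact borelOp_congr _ _ fun x => by simp

theorem setOp_empty : setOp π MeasurableSet.empty = 0 := by
  ext ψ
  have h1 := norm_sq_setOp (π := π) MeasurableSet.empty ψ
  simpa using h1

/-- Orthogonal vectors whose inner products with `v` and whose norms match those of an orthogonal
expansion of `v` sum up to `v`. -/
theorem hasSum_of_orthogonal {ι : Type*} {u : ι → 𝓗} {v : 𝓗}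
    (ho : Pairwise fun i j => ⟪u i, u j⟫_ℂ = 0) (hv : ∀ i, ⟪u i, v⟫_ℂ = ⟪u i, u i⟫_ℂ)
    (hs : HasSum (fun i => ‖u i‖ ^ 2) (‖v‖ ^ 2)) : HasSum u v := by
  classical
  rw [HasSum, tendsto_iff_norm_sub_tendsto_zero]
  -- By Pythagoras the squared distance from `v` to a partial sum is the missing part of the norm
  -- sum.
  have h1 : ∀ s : Finset ι, ‖∑ i ∈ s, u i - v‖ ^ 2 = ‖v‖ ^ 2 - ∑ i ∈ s, ‖u i‖ ^ 2 := fun s => by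
    have h2 : ⟪∑ i ∈ s, u i, v⟫_ℂ = ((∑ i ∈ s, ‖u i‖ ^ 2 : ℝ) : ℂ) := by
      rw [sum_inner]
      push_cast
      exact Finset.sum_congr rfl fun i _ => by rw [hv, inner_self_eq_norm_sq_to_K]; rfl
    have h3 : ⟪∑ i ∈ s, u i, ∑ i ∈ s, u i⟫_ℂ = ((∑ i ∈ s, ‖u i‖ ^ 2 : ℝ) : ℂ) := by
      rw [← h2, sum_inner, sum_inner]
      refine Finset.sum_congr rfl fun i hi => ?_
      rw [inner_sum, hv, Finset.sum_eq_single_of_mem i hi fun j _ hj => ho hj.symm]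
    rw [norm_sub_sq (𝕜 := ℂ), h2, ← inner_self_eq_norm_sq (𝕜 := ℂ), h3]
    simp only [RCLike.re_to_complex, Complex.ofReal_re]
    ring
  have h4 : Tendsto (fun s : Finset ι => ‖∑ i ∈ s, u i - v‖ ^ 2) atTop (𝓝 0) := by
    simp only [h1]
    rw [← sub_self (‖v‖ ^ 2)]
    exact Tendsto.const_sub (‖v‖ ^ 2) hs
  simpa [Real.sqrt_sq] using h4.sqrt

variable (π) in
open Classical in
/-- The image under a Borel function `κ` of the projection-valued measure of `π`. -/
def projectionValuedMeasure {κ : X → ℝ} (hκ : Measurable κ) : ProjectionValuedMeasure 𝓗 where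
  proj B := if hB : MeasurableSet B then setOp π (hκ hB) else 0
  isStarProjection B := by
    split_ifs with hB
    · refine ⟨?_, ?_⟩
      · ext ψ
        exact setOp_setOp (hκ hB) (hκ hB) (hκ hB) (Set.inter_self _) ψ
      · rw [ContinuousLinearMap.isSelfAdjoint_iff_isSymmetric]
        exact inner_setOp_left _
    · exact IsStarProjection.zero _
  proj_of_not_measurable B hB := by simp [hB]
  proj_empty := by
    rw [dif_pos MeasurableSet.empty]
    exact setOp_empty
  proj_univ := by
    rw [dif_pos MeasurableSet.univ]
    exact setOp_univ
  proj_inter B C hB hC := by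
    rw [dif_pos hB, dif_pos hC, dif_pos (hB.inter hC)]
    ext ψ
    exact (setOp_setOp (hκ hB) (hκ hC) (hκ (hB.inter hC)) rfl ψ).symm
  hasSum_iUnion B hB hd ψ := by
    simp only [hB, dif_pos, MeasurableSet.iUnion hB]
    have hd' : Pairwise (Function.onFun Disjoint fun n => κ ⁻¹' B n) := fun m n hmn =>
      (hd hmn).preimage κ
    refine hasSum_of_orthogonal (fun m n hmn => ?_) (fun n => ?_) ?_
    · refine (inner_setOp_setOp _ _ MeasurableSet.empty (hd' hmn).inter_eq ψ ψ).trans ?_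
      rw [setOp_empty, zero_apply, inner_zero_right]
    · rw [inner_setOp_setOp _ _ (hκ (hB n)) (Set.inter_self _), inner_setOp_setOp _ _ (hκ (hB n))]
      exact Set.inter_eq_left.2 (Set.preimage_mono (Set.subset_iUnion B n))
    · simp only [norm_sq_setOp, Set.preimage_iUnion, measureReal_def]
      rw [measure_iUnion hd' fun n => hκ (hB n), ENNReal.tsum_toReal_eq fun n => measure_ne_top _ _]
      refine (ENNReal.summable_toReal ?_).hasSum
      rw [← measure_iUnion hd' fun n => hκ (hB n)]
      exact measure_ne_top _ _

theorem scalarMeasure_projectionValuedMeasure {κ : X → ℝ} (hκ : Measurable κ) (ψ : 𝓗) :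
    (projectionValuedMeasure π hκ).scalarMeasure ψ = (vectorMeasure π ψ).map κ := by
  ext B hB
  rw [Measure.map_apply hκ hB, ProjectionValuedMeasure.scalarMeasure_apply _ _ hB]
  rw [show (projectionValuedMeasure π hκ).proj B = setOp π (hκ hB) from dif_pos hB, norm_sq_setOp, ofReal_measureReal]

/-- Bounded operators are equal if their translates by scalars have the same norms at each vector. -/
theorem eq_of_norm_add_smul {S T : 𝓗 →L[ℂ] 𝓗} (h : ∀ (c : ℂ) ψ, ‖S ψ + c • ψ‖ = ‖T ψ + c • ψ‖) :
    S = T := by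
  have h1 : (S : 𝓗 →ₗ[ℂ] 𝓗) = T := (ext_inner_map _ _).1 fun ψ => by
    simp only [ContinuousLinearMap.coe_coe]
    rw [inner_eq_sum_norm_sq_div_four (𝕜 := ℂ), inner_eq_sum_norm_sq_div_four (𝕜 := ℂ)]
    have h2 := h 1 ψ
    have h3 := h (-1) ψ
    have h4 := h (-Complex.I) ψ
    have h5 := h Complex.I ψ
    simp only [one_smul, neg_smul, ← sub_eq_add_neg] at h2 h3 h4 h5
    simp only [RCLike.I_to_complex, h2, h3, h4, h5]
  exact ContinuousLinearMap.coe_injective h1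

/-- Both functional calculi are isometric for measures that correspond under `κ`, so after adding
any scalar the norms agree; polarisation then recovers the operators. -/
theorem apply_eq_op {κ : X → ℝ} (hκ : Measurable κ) {g : C(X, ℂ)} {h : ℝ → ℂ}
    (hh : IsBddMeasurable h) (hgh : ∀ ψ, ∀ᵐ x ∂(vectorMeasure π ψ), g x = h (κ x)) :
    π g = (projectionValuedMeasure π hκ).op h hh := by
  refine eq_of_norm_add_smul fun c ψ => ?_
  set E := projectionValuedMeasure π hκ with hE
  have h1 : E.op h hh ψ + c • ψ = E.op (fun x => h x + c) (hh.add (IsBddMeasurable.const c)) ψ := by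
    rw [E.op_add_apply hh (IsBddMeasurable.const c)]
    have h2 := E.op_const_mul_apply (IsBddMeasurable.const 1) c ψ
    simp only [mul_one] at h2
    rw [h2, E.op_one]
  have h2 : π g ψ + c • ψ = π (g + algebraMap ℂ C(X, ℂ) c) ψ := by
    rw [map_add, AlgHomClass.commutes, Algebra.algebraMap_eq_smul_one]
    rfl
  have h3 : ‖π (g + algebraMap ℂ C(X, ℂ) c) ψ‖ₑ
      = ‖E.op (fun x => h x + c) (hh.add (IsBddMeasurable.const c)) ψ‖ₑ := by
    rw [enorm_apply, E.op_apply, E.enorm_apply _ ((hh.add (IsBddMeasurable.const c)).memLp _),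
      scalarMeasure_projectionValuedMeasure, eLpNorm_map_measure
        (hh.add (IsBddMeasurable.const c)).measurable.aestronglyMeasurable hκ.aemeasurable]
    refine eLpNorm_congr_ae ?_
    filter_upwards [hgh ψ] with x hx
    simp [hx]
  rw [h1, h2, ← toReal_enorm, h3, toReal_enorm]

end Representation

/-! ### Resolvents of self-adjoint operators -/

section Resolvent

variable {A : 𝓗 →ₗ.[ℂ] 𝓗}

theorem isFormalAdjoint_of_isSelfAdjoint (hA : IsSelfAdjoint A) : A.IsFormalAdjoint A := by
  have h := LinearPMap.adjoint_isFormalAdjoint hA.dense_domain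
  rwa [LinearPMap.isSelfAdjoint_def.1 hA] at h

theorem norm_sq_sub_smul (hA : A.IsFormalAdjoint A) {c : ℂ} (hc : conj c = -c) (ψ : A.domain) :
    ‖A ψ - c • (ψ : 𝓗)‖ ^ 2 = ‖A ψ‖ ^ 2 + ‖c‖ ^ 2 * ‖(ψ : 𝓗)‖ ^ 2 := by
  have h1 : (⟪A ψ, c • (ψ : 𝓗)⟫_ℂ).re = 0 := by
    have h2 : conj ⟪A ψ, c • (ψ : 𝓗)⟫_ℂ = -⟪A ψ, c • (ψ : 𝓗)⟫_ℂ := by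
      rw [inner_conj_symm, inner_smul_left, inner_smul_right, hc, hA ψ ψ, neg_mul]
    have h3 := congrArg Complex.re h2
    rw [Complex.conj_re, Complex.neg_re] at h3
    linarith
  rw [norm_sub_sq (𝕜 := ℂ), norm_smul, mul_pow]
  simp [h1]

/-- For `c = ±i` one has `‖(A - c)ψ‖² = ‖Aψ‖² + ‖ψ‖²`. This gives injectivity, closed range since
`A` is closed, and dense range since a vector orthogonal to the range lies in the kernel of `A + c`.
-/
theorem exists_resolvent (hA : IsSelfAdjoint A) {c : ℂ} (hc : conj c = -c) (hc1 : ‖c‖ = 1) :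
    ∃ R : 𝓗 →L[ℂ] 𝓗, (∀ φ, ∃ h : R φ ∈ A.domain, A ⟨R φ, h⟩ - c • R φ = φ) ∧
      ∀ ψ : A.domain, R (A ψ - c • (ψ : 𝓗)) = ψ := by
  have hsymm := isFormalAdjoint_of_isSelfAdjoint hA
  have hnorm : ∀ ψ : A.domain, ‖(ψ : 𝓗)‖ ≤ ‖A ψ - c • (ψ : 𝓗)‖ := fun ψ => by
    have h := norm_sq_sub_smul hsymm hc ψ
    rw [hc1] at h
    refine le_of_sq_le_sq ?_ (norm_nonneg _)
    nlinarith [sq_nonneg ‖A ψ‖]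
  let B : A.domain →ₗ[ℂ] 𝓗 := A.toFun - c • A.domain.subtype
  have hB : ∀ ψ, B ψ = A ψ - c • (ψ : 𝓗) := fun ψ => rfl
  have hinj : LinearMap.ker B = ⊥ := by
    refine LinearMap.ker_eq_bot'.2 fun ψ hψ => ?_
    have := hnorm ψ
    rw [← hB, hψ, norm_zero, norm_le_zero_iff] at this
    exact Subtype.ext this
  have hclosed : IsClosed (LinearMap.range B : Set 𝓗) := by
    refine isClosed_of_closure_subset fun φ hφ => ?_
    obtain ⟨u, hu, hlim⟩ := mem_closure_iff_seq_limit.1 hφ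
    choose ψ hψ using hu
    have h1 : CauchySeq fun n => ((ψ n : A.domain) : 𝓗) := by
      refine Metric.cauchySeq_iff.2 fun ε hε => ?_
      obtain ⟨N, hN⟩ := Metric.cauchySeq_iff.1 hlim.cauchySeq ε hε
      refine ⟨N, fun m hm n hn => lt_of_le_of_lt ?_ (hN m hm n hn)⟩
      rw [dist_eq_norm, dist_eq_norm, ← hψ, ← hψ, ← map_sub]
      exact hnorm (ψ m - ψ n)
    obtain ⟨χ, hχ⟩ := cauchySeq_tendsto_of_complete h1
    have h2 : Tendsto (fun n => A (ψ n)) atTop (𝓝 (φ + c • χ)) := by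
      refine (hlim.add (hχ.const_smul c)).congr fun n => ?_
      rw [← hψ, hB, sub_add_cancel]
    have h3 : (χ, φ + c • χ) ∈ A.graph := by
      refine hA.isClosed.mem_of_tendsto (hχ.prodMk_nhds h2) (Eventually.of_forall fun n => ?_)
      exact A.mem_graph (ψ n)
    obtain ⟨χ', h4, h5⟩ := (LinearPMap.mem_graph_iff A).1 h3
    refine ⟨χ', ?_⟩
    simp only at h4 h5
    rw [hB, h5, h4, add_sub_cancel_right]
  have hrange : LinearMap.range B = ⊤ := by
    have : CompleteSpace (LinearMap.range B) := hclosed.completeSpace_coe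
    rw [← Submodule.orthogonal_eq_bot_iff, Submodule.eq_bot_iff]
    intro φ hφ
    have h1 : ∀ ψ : A.domain, ⟪-c • φ, (ψ : 𝓗)⟫_ℂ = ⟪φ, A ψ⟫_ℂ := fun ψ => by
      have h2 := inner_eq_zero_symm.1 ((Submodule.mem_orthogonal _ _).1 hφ _ ⟨ψ, rfl⟩)
      rw [hB, inner_sub_right, sub_eq_zero, inner_smul_right] at h2
      rw [inner_smul_left, map_neg, hc, neg_neg, h2]
    have h3 : ∃ h : φ ∈ A.adjoint.domain, A.adjoint ⟨φ, h⟩ = -c • φ :=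
      ⟨LinearPMap.mem_adjoint_domain_of_exists φ ⟨_, h1⟩,
        LinearPMap.adjoint_apply_eq hA.dense_domain _ h1⟩
    rw [LinearPMap.isSelfAdjoint_def.1 hA] at h3
    obtain ⟨h4, h5⟩ := h3
    have h6 := norm_sq_sub_smul hsymm (c := -c) (by rw [map_neg, hc]) ⟨φ, h4⟩
    rw [h5, sub_self, norm_neg, hc1, norm_zero] at h6
    exact norm_eq_zero.1 (by nlinarith [sq_nonneg ‖-c • φ‖, norm_nonneg φ])
  let e := LinearEquiv.ofBijective B ⟨LinearMap.ker_eq_bot.1 hinj, LinearMap.range_eq_top.1 hrange⟩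
  refine ⟨LinearMap.mkContinuous (A.domain.subtype ∘ₗ e.symm.toLinearMap) 1 fun φ => ?_,
    fun φ => ⟨(e.symm φ).2, e.apply_symm_apply φ⟩, fun ψ => ?_⟩
  · rw [one_mul]
    exact (hnorm (e.symm φ)).trans_eq (congrArg norm (e.apply_symm_apply φ))
  · exact congrArg Subtype.val (e.symm_apply_apply ψ)

end Resolvent

/-! ### The spectral theorem -/

/-- The resolvent `R = (A - i)⁻¹` is bounded and normal, so its continuous functional calculus
yields a spectral measure on its spectrum. Transporting this by `z ↦ Re (1/z)`, the inverse of `x ↦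
1/(x - i)`, gives the measure of `A`. -/
theorem exists_generator_eq {A : 𝓗 →ₗ.[ℂ] 𝓗} (hA : IsSelfAdjoint A) :
    ∃ E : ProjectionValuedMeasure 𝓗, E.generator = A := by
  have hsymm := isFormalAdjoint_of_isSelfAdjoint hA
  obtain ⟨R, hR, hR'⟩ := exists_resolvent hA (c := Complex.I) (by simp) (by simp)
  obtain ⟨Q, hQ, hQ'⟩ := exists_resolvent hA (c := -Complex.I) (by simp) (by simp)
  -- the resolvent identity
  have hadj : ContinuousLinearMap.adjoint R = Q := by
    refine (ContinuousLinearMap.eq_adjoint_iff _ _).2 (fun φ ψ => ?_) |>.symm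
    obtain ⟨h1, h2⟩ := hR ψ
    obtain ⟨h3, h4⟩ := hQ φ
    conv_lhs => rw [← h2]
    conv_rhs => rw [← h4]
    rw [inner_sub_left, inner_sub_right, inner_smul_left, inner_smul_right,
      hsymm ⟨Q φ, h3⟩ ⟨R ψ, h1⟩]
    simp
  have hRQ : ∀ φ, R φ - Q φ = (2 * Complex.I) • R (Q φ) := fun φ => by
    obtain ⟨h3, h4⟩ := hQ φ
    have h5 := hR' ⟨Q φ, h3⟩
    rw [neg_smul, sub_neg_eq_add] at h4
    rw [eq_sub_of_add_eq h4, map_sub, map_sub, map_smul] at h5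
    change R φ - Complex.I • R (Q φ) - Complex.I • R (Q φ) = Q φ at h5
    linear_combination (norm := module) (1 : ℂ) • h5
  have hQR : ∀ φ, R φ - Q φ = (2 * Complex.I) • Q (R φ) := fun φ => by
    obtain ⟨h3, h4⟩ := hR φ
    have h5 := hQ' ⟨R φ, h3⟩
    rw [eq_add_of_sub_eq h4, map_sub, map_add, map_smul, map_smul, neg_smul] at h5
    change Q φ + Complex.I • Q (R φ) - -(Complex.I • Q (R φ)) = R φ at h5
    linear_combination (norm := module) (-1 : ℂ) • h5
  have hnormal : IsStarNormal R := ⟨by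
    rw [ContinuousLinearMap.star_eq_adjoint, hadj]
    ext φ
    exact smul_right_injective 𝓗 (show (2 * Complex.I) ≠ 0 by simp) ((hQR φ).symm.trans (hRQ φ))⟩
  have hRinj : ∀ φ, R φ = 0 → φ = 0 := fun φ hφ => by
    obtain ⟨h1, h2⟩ := hR φ
    rw [← h2]
    have h3 : (⟨R φ, h1⟩ : A.domain) = 0 := Subtype.ext hφ
    rw [h3, hφ]
    simp
  -- the spectrum of the resolvent lies on a circle through `0`
  let π := cfcHom (R := ℂ) hnormal
  let z : C(_root_.spectrum ℂ R, ℂ) := (ContinuousMap.id ℂ).restrict (_root_.spectrum ℂ R)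
  have hz : π z = R := cfcHom_id hnormal
  have hcircle : ∀ x : _root_.spectrum ℂ R, 
      (x : ℂ) - conj (x : ℂ) = 2 * Complex.I * (conj (x : ℂ) * x) := by
    have h1 : z - star z = (2 * Complex.I) • (star z * z) := by
      refine cfcHom_injective hnormal ?_
      change π _ = π _
      rw [map_sub, map_smul, map_mul, map_star, hz, ContinuousLinearMap.star_eq_adjoint, hadj]
      ext φ
      exact hQR φ
    exact fun x => congrArg (fun g : C(_root_.spectrum ℂ R, ℂ) => g x) h1
  let κ : _root_.spectrum ℂ R → ℝ := fun x => ((x : ℂ)⁻¹).re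
  have hκ : Measurable κ := Complex.measurable_re.comp measurable_subtype_coe.inv
  let h : ℝ → ℂ := fun x => ((x : ℂ) - Complex.I)⁻¹
  have hne : ∀ x : ℝ, (x : ℂ) - Complex.I ≠ 0 := fun x hx => by
    simpa using congrArg Complex.im hx
  have hh : ProjectionValuedMeasure.IsBddMeasurable h := by
    refine ⟨(Complex.measurable_ofReal.sub_const _).inv, 1, fun x => ?_⟩
    rw [norm_inv]
    refine inv_le_one_of_one_le₀ ?_
    simpa using Complex.abs_im_le_norm ((x : ℂ) - Complex.I)
  -- The circle equation divided by `|x|²` says that `1/x` has imaginary part `-1`.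
  have hhκ : ∀ x : _root_.spectrum ℂ R, (x : ℂ) ≠ 0 → (x : ℂ) = h (κ x) := fun x hx => by
    have h1 : conj (x : ℂ)⁻¹ - (x : ℂ)⁻¹ = 2 * Complex.I := by
      have h2 : conj (x : ℂ) ≠ 0 := by simpa using hx
      rw [map_inv₀]
      field_simp
      linear_combination hcircle x
    have h3 : (x : ℂ)⁻¹ = (κ x : ℂ) - Complex.I := by
      refine Complex.ext (by simp [κ]) ?_
      have h4 := congrArg Complex.im h1
      simp only [Complex.sub_im, Complex.conj_im, Complex.mul_im, Complex.I_re, Complex.I_im,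
        Complex.re_ofNat, Complex.im_ofNat, Complex.ofReal_im] at h4 ⊢
      linarith
    simp only [h]
    rw [← h3, inv_inv]
  -- The point `0` may belong to the spectrum of `R`, but its spectral projection maps into the
  -- kernel of `R`, which is trivial.
  have hzero : ∀ ψ, ∀ᵐ x ∂(Representation.vectorMeasure π ψ), z x = h (κ x) := fun ψ => by
    have hS : MeasurableSet {x : _root_.spectrum ℂ R | (x : ℂ) = 0} :=
      measurable_subtype_coe (measurableSet_singleton 0)
    have hzb : ProjectionValuedMeasure.IsBddMeasurable ⇑z :=
      ⟨(map_continuous z).measurable, ‖z‖, z.norm_coe_le_norm⟩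
    have h1 : Representation.setOp π hS ψ = 0 := by
      refine hRinj _ ?_
      refine (congrArg (fun T : 𝓗 →L[ℂ] 𝓗 => T _) hz.symm).trans ?_
      rw [Representation.setOp, Representation.apply_borelOp _ _ hzb, ← enorm_eq_zero,
        Representation.enorm_borelOp]
      have h2 : (fun x => z x * {x : _root_.spectrum ℂ R | (x : ℂ) = 0}.indicator
          (fun _ => (1 : ℂ)) x) = 0 := by
        ext x
        by_cases hx : (x : ℂ) = 0 <;> simp [hx, z]
      rw [h2, eLpNorm_zero]
    have h2 := Representation.norm_sq_setOp (π := π) hS ψ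
    rw [h1, norm_zero, zero_pow two_ne_zero, eq_comm, measureReal_eq_zero_iff] at h2
    refine measure_mono_null (fun x hx => ?_) h2
    by_contra h3
    exact hx (hhκ x h3)
  set E := Representation.projectionValuedMeasure π hκ with hE
  have hRE : R = E.op h hh := hz.symm.trans (Representation.apply_eq_op hκ hh hzero)
  refine ⟨E, ?_⟩
  have hRgen : ∀ φ, ∃ h : R φ ∈ E.generator.domain, E.generator ⟨R φ, h⟩ = φ + Complex.I • R φ := fun φ => by
    have h1 : ∀ x : ℝ, (x : ℂ) * h x = 1 + Complex.I * h x := fun x => by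
      have := hne x
      simp only [h]
      field_simp
      ring
    have h2 := (ProjectionValuedMeasure.IsBddMeasurable.const (α := ℝ) 1).add
      (hh.const_mul Complex.I)
    have h3 : ProjectionValuedMeasure.IsBddMeasurable fun x : ℝ => (x : ℂ) * h x := by
      simpa only [h1] using h2
    rw [hRE]
    refine ⟨E.op_mem_domain hh Complex.measurable_ofReal h3 φ, ?_⟩
    refine (E.apply_op hh Complex.measurable_ofReal h3 φ).trans ?_
    rw [ProjectionValuedMeasure.op_congr h3 h2 h1, E.op_add_apply
      (ProjectionValuedMeasure.IsBddMeasurable.const 1) (hh.const_mul Complex.I),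
      E.op_const_mul_apply, E.op_one]
  have hle : ∀ ψ : A.domain, ∃ h : (ψ : 𝓗) ∈ E.generator.domain, E.generator ⟨ψ, h⟩ = A ψ :=
    fun ψ => by
    have h1 := hRgen (A ψ - Complex.I • (ψ : 𝓗))
    rw [hR'] at h1
    simpa using h1
  -- With `φ = (generator - i)ψ`, the vector `ψ - R φ` is annihilated by `generator - i` and so
  -- vanishes; hence `ψ` is in the range of `R`.
  have hge : ∀ ψ ∈ E.generator.domain, ψ ∈ A.domain := fun ψ hψ => by
    set φ := E.generator ⟨ψ, hψ⟩ - Complex.I • ψ with hφ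
    obtain ⟨h1, h2⟩ := hRgen φ
    have h3 := norm_sq_sub_smul (A := E.generator) E.generator_symmetric (c := Complex.I) (by simp)
      (⟨ψ, hψ⟩ - ⟨R φ, h1⟩)
    rw [LinearPMap.map_sub, h2] at h3
    have h4 : E.generator ⟨ψ, hψ⟩ - (φ + Complex.I • R φ) - Complex.I • (ψ - R φ) = 0 := by
      rw [hφ, smul_sub]
      abel
    have h5 : ‖ψ - R φ‖ = 0 := by
      rw [show (((⟨ψ, hψ⟩ - ⟨R φ, h1⟩ : E.generator.domain)) : 𝓗) = ψ - R φ from rfl, h4,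
        norm_zero, Complex.norm_I] at h3
      nlinarith [sq_nonneg ‖E.generator ⟨ψ, hψ⟩ - (φ + Complex.I • R φ)‖, norm_nonneg (ψ - R φ)]
    rw [sub_eq_zero.1 (norm_eq_zero.1 h5)]
    exact (hR φ).1
  refine LinearPMap.ext (Submodule.ext fun ψ => ⟨hge ψ, fun hψ => (hle ⟨ψ, hψ⟩).1⟩)
    fun ψ h1 h2 => ?_
  exact (hle ⟨ψ, h2⟩).2

end

/-! ### Gluing the absolutely continuous and the point parts. -/

section

/-! ### Time operators of functions of the generator -/

namespace ProjectionValuedMeasure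

variable {𝓗 : Type*} [NormedAddCommGroup 𝓗] [InnerProductSpace ℂ 𝓗] [CompleteSpace 𝓗]
variable (E : ProjectionValuedMeasure 𝓗)

/-- The direct sum of a conjugate operator on the absolutely continuous subspace and of a conjugate
form on the span of the eigenvectors. -/
theorem exists_ultraWeakTimeOperator_integral {f : ℝ → ℝ} (hf : Measurable f)
    (hsc : E.scSubspace = ⊥) {P : Set ℝ} (hP : P.Countable)
    (hPE : ∀ x, x ∈ P ↔ (x : ℂ) ∈ pointSpectrum E.generator) (hinf : (f '' P).Infinite)
    (hfin : ∀ y ∈ f '' P, FiniteDimensional ℂ (eigenspace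
      (E.integral (fun x => (f x : ℂ)) (Complex.measurable_ofReal.comp hf)) (y : ℂ)))
    {T : E.acSubspace →ₗ.[ℂ] E.acSubspace} (hT : (acMeasure E).IsWeakWeyl T)
    {U : Set ℝ} (hU : IsOpen U) (hUc : volume Uᶜ = 0) (hfU : ContDiffOn ℝ 1 f U) {u : ℝ → ℝ}
    (hu : ContDiffOn ℝ 1 u U) (hfu : ∀ x ∈ U, u x * deriv f x = 1) :
    ∃ (D₁ D₂ : Submodule ℂ 𝓗) (𝔱 : D₁ →ₗ⋆[ℂ] D₂ →ₗ[ℂ] ℂ),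
      IsUltraWeakTimeOperator
        (E.integral (fun x => (f x : ℂ)) (Complex.measurable_ofReal.comp hf)) 𝔱 ∧
      ∃ 𝓔 : Submodule ℂ 𝓗, IsUltraWeakCCRDomain
        (E.integral (fun x => (f x : ℂ)) (Complex.measurable_ofReal.comp hf)) 𝔱 𝓔 ∧
        Dense (𝓔 : Set 𝓗) := by
  set A := E.integral (fun x => (f x : ℂ)) (Complex.measurable_ofReal.comp hf) with hA
  obtain ⟨A', hA'⟩ := exists_linearMap_extension A
  set K := E.acSubspace with hK
  obtain ⟨𝓔₁, S, h𝓔d, h𝓔dom, h𝓔inv, hSsym, hSccr⟩ := hT.exists_conjugate hU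
    (fun ψ => by
      rw [acMeasure, E.restrict_scalarMeasure]
      exact ψ.2 hUc) hf hfU hu hfu
  obtain ⟨ι, e, lam, c, ⟨j₀⟩, he, hlam, hc1, hc2, hac, hcompl⟩ :=
    E.exists_eigenvectors hf hP hPE hinf hfin
  have hAe : ∀ j, A' (e j) = (lam j : ℂ) • e j := fun j => by
    obtain ⟨h1, h2⟩ := hlam j
    exact (hA' ⟨e j, h1⟩).trans h2
  obtain ⟨Q, hQsym, hQccr⟩ := exists_form_conjugate_to_diagonal he hc1 A' hAe
  set V := Submodule.span ℂ (Set.range e) with hV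
  -- the absolutely continuous part
  have hdom₁ : ∀ φ ∈ 𝓔₁, (φ : 𝓗) ∈ A.domain := fun φ hφ => by
    have := h𝓔dom φ hφ
    rw [mem_integral_domain, acMeasure, E.restrict_scalarMeasure] at this
    exact this
  have hA₁ : ∀ φ ∈ 𝓔₁, (((acMeasure E).apply (fun x => (f x : ℂ))
      (Complex.measurable_ofReal.comp hf) φ : K) : 𝓗) = A' (φ : 𝓗) := fun φ hφ =>
    (E.coe_restrict_apply E.acSubspace E.proj_mem_acSubspace _ (hdom₁ φ hφ)).trans
      (hA' ⟨φ, hdom₁ φ hφ⟩).symm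
  -- the point part
  have hVK : ∀ ψ ∈ V, ∀ φ ∈ K, ⟪φ, ψ⟫_ℂ = 0 := fun ψ hψ φ hφ => by
    induction hψ using Submodule.span_induction with
    | mem x hx => obtain ⟨j, rfl⟩ := hx; exact hac j φ hφ
    | zero => simp
    | add x y _ _ hx hy => rw [inner_add_right, hx, hy, add_zero]
    | smul z x _ hx => rw [inner_smul_right, hx, mul_zero]
  have hVA : ∀ ψ ∈ V, ψ ∈ A.domain ∧ A' ψ ∈ V := fun ψ hψ => by
    induction hψ using Submodule.span_induction with
    | mem x hx =>
      obtain ⟨j, rfl⟩ := hx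
      refine ⟨(hlam j).1, ?_⟩
      rw [hAe]
      exact V.smul_mem _ (Submodule.subset_span ⟨j, rfl⟩)
    | zero => simp
    | add x y _ _ hx hy =>
      rw [map_add]
      exact ⟨A.domain.add_mem hx.1 hy.1, V.add_mem hx.2 hy.2⟩
    | smul z x _ hx =>
      rw [map_smul]
      exact ⟨A.domain.smul_mem z hx.1, V.smul_mem z hx.2⟩
  -- the form
  let p : 𝓗 →ₗ[ℂ] K := K.orthogonalProjectionOnto.toLinearMap
  let q : 𝓗 →ₗ[ℂ] 𝓗 := LinearMap.id - K.subtype ∘ₗ p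
  have hp : ∀ (φ : K) (ψ : 𝓗), ψ ∈ V → p (φ + ψ) = φ ∧ q (φ + ψ) = ψ := fun φ ψ hψ => by
    have h1 : p (φ + ψ) = φ := by
      have h2 : K.orthogonalProjectionOnto ψ = 0 :=
        Submodule.orthogonalProjectionOnto_eq_zero_iff.2
          ((Submodule.mem_orthogonal _ _).2 fun φ hφ => hVK ψ hψ φ hφ)
      change K.orthogonalProjectionOnto (φ + ψ) = φ
      rw [map_add, h2, add_zero, Submodule.orthogonalProjectionOnto_mem_subspace_eq_self]
    refine ⟨h1, ?_⟩
    simp only [q, LinearMap.sub_apply, LinearMap.id_apply, LinearMap.comp_apply, h1,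
      Submodule.subtype_apply]
    abel
  -- The form is block diagonal: `p` is the orthogonal projection onto the absolutely continuous
  -- subspace and `q` its complement, so `V` is seen only by `Q`.
  let t : 𝓗 →ₗ⋆[ℂ] 𝓗 →ₗ[ℂ] ℂ := LinearMap.mk₂'ₛₗ (starRingEnd ℂ) (RingHom.id ℂ)
    (fun φ ψ => ⟪S (p φ), p ψ⟫_ℂ + Q (q φ) (q ψ))
    (fun φ φ' ψ => by simp only [map_add, inner_add_left, LinearMap.add_apply]; ring)
    (fun z φ ψ => by
      simp only [map_smul, LinearMap.map_smulₛₗ, inner_smul_left, LinearMap.smul_apply, smul_eq_mul]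
      ring)
    (fun φ ψ ψ' => by simp only [map_add, inner_add_right]; ring)
    (fun z φ ψ => by
      simp only [map_smul, inner_smul_right, smul_eq_mul, RingHom.id_apply]
      ring)
  have ht : ∀ (φ φ' : K) (ψ ψ' : 𝓗), ψ ∈ V → ψ' ∈ V →
      t (φ + ψ) (φ' + ψ') = ⟪S φ, φ'⟫_ℂ + Q ψ ψ' := fun φ φ' ψ ψ' hψ hψ' => by
    change ⟪S (p _), p _⟫_ℂ + Q (q _) (q _) = _
    rw [(hp φ ψ hψ).1, (hp φ ψ hψ).2, (hp φ' ψ' hψ').1, (hp φ' ψ' hψ').2]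
  -- `D` uses the full span `V` of the eigenvectors: `A` preserves `V`, but need not preserve the
  -- span of differences that enters `𝓔`.
  let D : Submodule ℂ 𝓗 := 𝓔₁.map K.subtype ⊔ V
  let 𝓔 : Submodule ℂ 𝓗 := 𝓔₁.map K.subtype ⊔ differenceSpan e c
  have hDmem : ∀ χ ∈ D, ∃ φ ∈ 𝓔₁, ∃ ψ ∈ V, (φ : 𝓗) + ψ = χ := fun χ hχ => by
    obtain ⟨_, ⟨φ, hφ, rfl⟩, ψ, hψ, rfl⟩ := Submodule.mem_sup.1 hχ
    exact ⟨φ, hφ, ψ, hψ, rfl⟩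
  have h𝓔mem : ∀ χ ∈ 𝓔, ∃ φ ∈ 𝓔₁, ∃ ψ ∈ differenceSpan e c, (φ : 𝓗) + ψ = χ := fun χ hχ => by
    obtain ⟨_, ⟨φ, hφ, rfl⟩, ψ, hψ, rfl⟩ := Submodule.mem_sup.1 hχ
    exact ⟨φ, hφ, ψ, hψ, rfl⟩
  have hDV := differenceSpan_le e c
  have h𝓔D : 𝓔 ≤ D := sup_le_sup_left hDV _
  have hDA : ∀ χ ∈ D, χ ∈ A.domain ∧ A' χ ∈ D := fun χ hχ => by
    obtain ⟨φ, hφ, ψ, hψ, rfl⟩ := hDmem χ hχ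
    refine ⟨A.domain.add_mem (hdom₁ φ hφ) (hVA ψ hψ).1, ?_⟩
    rw [map_add, ← hA₁ φ hφ]
    exact Submodule.add_mem_sup ⟨_, h𝓔inv φ hφ, rfl⟩ (hVA ψ hψ).2
  have hdense : Dense (𝓔 : Set 𝓗) := by
    rw [Submodule.dense_iff_topologicalClosure_eq_top, Submodule.topologicalClosure_eq_top_iff,
      Submodule.eq_bot_iff]
    intro χ hχ
    have hχ' : ∀ φ ∈ 𝓔, ⟪φ, χ⟫_ℂ = 0 := (Submodule.mem_orthogonal _ _).1 hχ
    refine E.eq_zero_of_orthogonal hsc (fun φ hφ => ?_) (hcompl χ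
      (inner_eq_zero_of_orthogonal_differenceSpan he hc2 fun φ hφ =>
        hχ' φ (Submodule.mem_sup_right hφ)))
    have h1 : p χ = 0 := by
      refine h𝓔d.eq_zero_of_inner_right (𝕜 := ℂ) fun φ hφ => ?_
      rw [show ⟪φ, p χ⟫_ℂ = ⟪(φ : 𝓗), χ⟫_ℂ from
        Submodule.inner_orthogonalProjectionOnto_eq_of_mem_left φ χ]
      exact hχ' _ (Submodule.mem_sup_left ⟨φ, hφ, rfl⟩)
    have h2 : ⟪(⟨φ, hφ⟩ : K), p χ⟫_ℂ = ⟪φ, χ⟫_ℂ :=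
      Submodule.inner_orthogonalProjectionOnto_eq_of_mem_left ⟨φ, hφ⟩ χ
    rw [← h2, h1, inner_zero_right]
  have hne : ∀ W : Submodule ℂ 𝓗, 𝓔 ≤ W → W ≠ ⊥ := fun W hW h => by
    have h1 : 𝓔 = ⊥ := le_bot_iff.1 (h ▸ hW)
    rw [h1] at hdense
    have h2 : e j₀ ∈ closure ((⊥ : Submodule ℂ 𝓗) : Set 𝓗) := hdense _
    rw [Submodule.bot_coe, closure_singleton, Set.mem_singleton_iff] at h2
    exact he.ne_zero j₀ h2
  have hCCR : IsUltraWeakCCRDomain A (t.domRestrict₁₂ D D) 𝓔 := by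
    refine ⟨hne 𝓔 le_rfl, D, hne D h𝓔D, le_rfl, le_rfl,
      fun χ hχ => ⟨(hDA χ (h𝓔D hχ)).1, h𝓔D hχ⟩, ?_, fun φ => ?_, ?_⟩
    · rintro ⟨χ, hχ⟩ ⟨χ', hχ'⟩
      change conj (t χ χ') = t χ' χ
      obtain ⟨φ, hφ, ψ, hψ, rfl⟩ := hDmem χ hχ
      obtain ⟨φ', hφ', ψ', hψ', rfl⟩ := hDmem χ' hχ'
      rw [ht _ _ _ _ hψ hψ', ht _ _ _ _ hψ' hψ, map_add, hQsym ψ hψ ψ' hψ', inner_conj_symm,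
        hSsym φ' hφ' φ hφ]
    · rw [← hA']
      exact (hDA φ (h𝓔D φ.2)).2
    · rintro ⟨χ, hχ⟩ ⟨χ', hχ'⟩
      have hAt : ∀ (χ : 𝓗) (hχ : χ ∈ A.domain), A ⟨χ, hχ⟩ = A' χ := fun χ hχ => (hA' ⟨χ, hχ⟩).symm
      suffices h0 : t (A' χ) χ' - conj (t (A' χ') χ) = -Complex.I * ⟪χ, χ'⟫_ℂ by
        rw [← hAt χ (hDA χ (h𝓔D hχ)).1, ← hAt χ' (hDA χ' (h𝓔D hχ')).1] at h0
        exact h0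
      obtain ⟨φ, hφ, ψ, hψ, rfl⟩ := h𝓔mem χ hχ
      obtain ⟨φ', hφ', ψ', hψ', rfl⟩ := h𝓔mem χ' hχ'
      rw [map_add A', map_add A', ← hA₁ φ hφ, ← hA₁ φ' hφ', ht _ _ _ _ (hVA ψ (hDV hψ)).2 (hDV hψ'),
        ht _ _ _ _ (hVA ψ' (hDV hψ')).2 (hDV hψ), map_add]
      have h1 := hSccr φ hφ φ' hφ'
      have h2 := hQccr ψ hψ ψ' hψ'
      -- The mixed inner products vanish, so the two canonical relations simply add.
      have h3 : ⟪(φ : 𝓗) + ψ, (φ' : 𝓗) + ψ'⟫_ℂ = ⟪φ, φ'⟫_ℂ + ⟪ψ, ψ'⟫_ℂ := by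
        rw [inner_add_left, inner_add_right, inner_add_right, hVK ψ' (hDV hψ') φ φ.2,
          inner_eq_zero_symm.1 (hVK ψ (hDV hψ) φ' φ'.2), Submodule.coe_inner]
        ring
      rw [h3]
      linear_combination h1 + h2
  exact ⟨D, D, t.domRestrict₁₂ D D,
    ⟨E.isSelfAdjoint_integral hf, hne D h𝓔D, hne D h𝓔D, 𝓔, hCCR⟩, 𝓔, hCCR, hdense⟩

end ProjectionValuedMeasure

end

end TimeOp

end

/-! ### Application to the class `S₁`. -/

theorem corollary5 {𝓗 : Type*} [NormedAddCommGroup 𝓗] [InnerProductSpace ℂ 𝓗] [CompleteSpace 𝓗]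
    (H : 𝓗 →ₗ.[ℂ] 𝓗) (hH : TimeOp.ClassS1 H)
    (f : ℝ → ℝ) (hf : Measurable f)
    (K : Set ℝ) (hK : IsClosed K) (hK_null : MeasureTheory.volume K = 0)
    (hf_smooth : ContDiffOn ℝ 2 f Kᶜ)
    (hf_deriv : MeasureTheory.volume {x | x ∈ Kᶜ ∧ deriv f x = 0} = 0)
    (hf_zero : ContinuousAt f 0)
    (h_infinite : (f '' {x : ℝ | (x : ℂ) ∈ TimeOp.discreteSpectrum H}).Infinite)
    (h_finite : ∀ y ∈ f '' {x : ℝ | (x : ℂ) ∈ TimeOp.discreteSpectrum H},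
      FiniteDimensional ℂ (TimeOp.eigenspace (TimeOp.functionalCalculus H f hf) (y : ℂ)))
    (h_not_eigenvalue :
      ((f 0 : ℝ) : ℂ) ∉ TimeOp.pointSpectrum (TimeOp.functionalCalculus H f hf)) :
    ∃ (D₁ D₂ : Submodule ℂ 𝓗) (𝔱 : D₁ →ₗ⋆[ℂ] D₂ →ₗ[ℂ] ℂ),
      TimeOp.IsUltraWeakTimeOperator (TimeOp.functionalCalculus H f hf) 𝔱 ∧
      ∃ 𝓔 : Submodule ℂ 𝓗,
        TimeOp.IsUltraWeakCCRDomain (TimeOp.functionalCalculus H f hf) 𝔱 𝓔 ∧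
        Dense (𝓔 : Set 𝓗) := by
  have hE : (TimeOp.spectralMeasure H).generator = H :=
    TimeOp.generator_spectralMeasure (TimeOp.exists_generator_eq hH.isSelfAdjoint)
  obtain ⟨T, hT⟩ := hH.exists_strong
  obtain ⟨ev, -, -, -, hdisc, hpoint⟩ := hH.discrete
  have hP : {x : ℝ | (x : ℂ) ∈ TimeOp.discreteSpectrum H}.Countable := by
    refine (Set.countable_range ev).mono fun x hx => ?_
    rw [Set.mem_ofPred_eq, hdisc] at hx
    obtain ⟨n, hn⟩ := hx
    exact ⟨n, Complex.ofReal_injective hn⟩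
  have hsc : (TimeOp.spectralMeasure H).scSubspace = ⊥ :=
    (TimeOp.spectralMeasure H).scSubspace_eq_bot (by rw [hE]; exact hH.sc_spectrum)
  have hKo : IsOpen Kᶜ := hK.isOpen_compl
  have hd1 : ContDiffOn ℝ 1 (deriv f) Kᶜ :=
    ((contDiffOn_succ_iff_deriv_of_isOpen (n := 1) hKo).1 (by rwa [one_add_one_eq_two])).2.2
  -- On `U` the reciprocal of `f'` is `C¹`, because `f` is `C²` there; this is the regularity that
  -- the symmetrised product requires of its coefficient.
  let U : Set ℝ := Kᶜ ∩ deriv f ⁻¹' {0}ᶜ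
  have hU : IsOpen U := hd1.continuousOn.isOpen_inter_preimage hKo isOpen_compl_singleton
  have hUc : MeasureTheory.volume Uᶜ = 0 := by
    refine measure_mono_null (t := K ∪ {x | x ∈ Kᶜ ∧ deriv f x = 0}) (fun x hx => ?_)
      (measure_union_null hK_null hf_deriv)
    by_cases hxK : x ∈ K
    · exact Or.inl hxK
    · refine Or.inr ⟨hxK, ?_⟩
      by_contra h
      exact hx ⟨hxK, h⟩
  exact (TimeOp.spectralMeasure H).exists_ultraWeakTimeOperator_integral hf hsc hP
    (fun x => by rw [hE, Set.mem_ofPred_eq, hdisc, hpoint]) h_infinite h_finite (hT.isWeakWeyl hE)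
    hU hUc ((hf_smooth.of_le (by norm_num)).mono Set.inter_subset_left)
    (u := fun x => (deriv f x)⁻¹)
    ((hd1.mono Set.inter_subset_left).inv fun x hx => hx.2)
    (fun x hx => inv_mul_cancel₀ hx.2)
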